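/- Let $d\ge 1$, $l>0$, $0<\nu<1$, $\xi,\omega\in\mathbb R$, $\Delta_\pm=\frac d2\pm\nu$, $m^2l^2=\Delta_\pm(\Delta_\pm-d)=\nu^2-\frac{d^2}{4}$, and $f(\phi)=\xi\phi^\omega$. Consider a free scalar of mass $m$ on the hyperbolic space $\mathbb R_r\times\mathbb R^d_x$ with metric $dr^2+e^{2r/l}dx^2$. The sourceless gap equation for the boundary mode $\phi_-$ is $$-\Big(\frac l2\Big)^{2\nu-1}\frac{\Gamma(1-\nu)}{\Gamma(\nu)}(-\square)^\nu\phi_- - f'(\phi_-)=0 ,\qquad (1)$$ understood in the sense of distributions (tested against Schwartz functions, with $(-\square)^\nu$ the Fourier multiplier $|p|^{2\nu}$ moved to the test function and all pairings absolutely convergent). Its integral form is $$\phi_-(x)+\frac{\Gamma(\frac d2-\nu)}{2\pi^{d/2}l^{2\nu-1}\Gamma(1-\nu)}\int_{\mathbb R^d}\frac{f'(\phi_-(y))}{|x-y|^{d-2\nu}}\,d^dy=0\qquad(x\ne0),\qquad (2)$$ with an absolutely convergent integral. Look for solutions $\phi_-(x)=b/|x|^c$ with $b>0$. (a) Equation (2)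 has such a solution for some $b>0$, $c\in\mathbb R$ if and only if $$\omega>2,\qquad \xi<0,\qquad \frac{(\omega-1)\nu}{\omega-2}<\frac d2. \qquad (3)$$ The same is true of equation (1) with $b>0$, $c>0$. (b) For $b>0$, $c\in\mathbb R$ the function $b/|x|^c$ solves (2) if and only if (3) holds, $$c=\frac{2\nu}{\omega-2}\quad\text{and}\quad b^{\omega-2}=\frac{2l^{2\nu-1}\,\Gamma(1-\nu)\,\Gamma\big(\frac d2-\frac{\nu}{\omega-2}\big)\,\Gamma\big(\frac{(\omega-1)\nu}{\omega-2}\big)}{\omega|\xi|\,\Gamma(\nu)\,\Gamma\big(\frac{\nu}{\omega-2}\big)\,\Gamma\big(\frac d2-\frac{(\omega-1)\nu}{\omega-2}\big)} .$$ For $b>0$, $c>0$ the same three conditions characterize the solutions $b/|x|^c$ of (1). (c) If $b>0$ and $\phi_-=b/|x|^c$ solves (2), put $$\phi(r,x)=b\,l^{-\frac{2\nu}{\omega-2}}\,\frac{\Gamma\big(\frac d2-\frac{\nu}{\omega-2}\big)\Gamma\big(\frac{(\omega-1)\nu}{\omega-2}\big)}{\Gamma(\frac d2)\Gamma(\nu)}\,e^{-\left(\frac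 d2-\frac{\omega\nu}{\omega-2}\right)\frac rl}\,F\Big(\frac{\nu}{\omega-2},\frac{(\omega-1)\nu}{\omega-2};\frac d2;-\frac{1}{l^2}e^{2r/l}|x|^2\Big),$$ where $F$ is the Gauss hypergeometric function, continued analytically to $(-\infty,1)$. Then $\phi$ is the bulk field determined by $\phi_-$, $$\phi(r,x)=\frac{l^\nu}{2^{\nu-1}\Gamma(\nu)}e^{-dr/2l}\int\frac{d^dp}{(2\pi)^d}\,\tilde\phi_-(p)\,|p|^\nu K_\nu\big(l|p|e^{-r/l}\big)e^{ip\cdot x},$$ where the distributional Fourier transform $\tilde\phi_-$ is a function and the integral converges absolutely, with $K_\nu$ the modified Bessel function of the second kind. Moreover $\phi$ is a smooth solution of the Klein-Gordon equation $(-\square_g+m^2)\phi=0$ on all of $\mathbb R\times\mathbb R^d$. For every $x\neq0$, as $r\to\infty$, $$\phi(r,x)=e^{-\Delta_-r/l}\phi_-(x)+e^{-\Delta_+r/l}\phi_+(x)+o\big(e^{-\Delta_+r/l}\big),\qquad \phi_+=\frac{l}{2\nu}\,\omega\,\xi\,\phi_-^{\omega-1},$$ and $\phi$ satisfies the sourceless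 mixed boundary condition $-\hat\pi-f'(\phi_-)=0$ at $x$, where $\hat\pi(x)=\lim_{r\to\infty}e^{\Delta_+r/l}\big(\partial_r\phi+\frac{\Delta_-}{l}\phi\big)$ is the renormalized radial momentum. -/

import Mathlib

open MeasureTheory Filter Topology Set
open scoped SchwartzMap

noncomputable section

namespace AdSToy

/-- The boundary space `ℝ^d` with its Euclidean norm. -/
abbrev Bdry (d : ℕ) : Type := EuclideanSpace ℝ (Fin d)

/-- `Δ_- = d/2 - ν`, so that `Δ_± = d/2 ± ν` and `ν = (Δ_+ - Δ_-)/2`. -/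
def deltaMinus (d : ℕ) (ν : ℝ) : ℝ := (d : ℝ) / 2 - ν

/-- `Δ_+ = d/2 + ν`. -/
def deltaPlus (d : ℕ) (ν : ℝ) : ℝ := (d : ℝ) / 2 + ν

/-- The mass squared: `m² l² = Δ_+ (Δ_+ - d) = Δ_- (Δ_- - d)`. -/
def massSq (d : ℕ) (ν l : ℝ) : ℝ := deltaPlus d ν * (deltaPlus d ν - d) / l ^ 2

/-- Sanity check: `Δ_-` and `Δ_+` are the two roots of `m² l² = Δ (Δ - d)`. -/
theorem massSq_mul (d : ℕ) (ν l : ℝ) (hl : l ≠ 0) (D : ℝ) :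
    massSq d ν l * l ^ 2 = D * (D - d) ↔ D = deltaMinus d ν ∨ D = deltaPlus d ν := by
  have h : massSq d ν l * l ^ 2 = ((d : ℝ) / 2 + ν) * ((d : ℝ) / 2 + ν - d) := by
    unfold massSq deltaPlus
    field_simp
  rw [h]
  unfold deltaMinus deltaPlus
  constructor
  · intro e
    have e' : (D - ((d : ℝ) / 2 - ν)) * (D - ((d : ℝ) / 2 + ν)) = 0 := by linarith
    rcases mul_eq_zero.mp e' with e1 | e1
    · left; linarith
    · right; linarith
  · rintro (e | e) <;> subst e <;> ring

/-! ### The boundary problem -/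

/-- The potential `f(φ) = ξ φ^ω`. -/
def powPotential (ξ ω : ℝ) : ℝ → ℝ := fun t => ξ * t ^ ω

/-- The profile `φ_-(x) = b / |x|^c`. -/
def profile {d : ℕ} (b c : ℝ) : Bdry d → ℝ := fun x => b / ‖x‖ ^ c

/-- The Fourier transform `∫ e^{-i p·x} ψ(x) d^d x`. -/
def fourierT {d : ℕ} (ψ : Bdry d → ℂ) (p : Bdry d) : ℂ :=
  ∫ x, Complex.exp (-(Complex.I * ((inner ℝ p x : ℝ) : ℂ))) * ψ x

/-- The operator `(-□)^ν` on test functions, i.e. the Fourier multiplier `|p|^{2ν}`. -/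
def fracLaplacian {d : ℕ} (ν : ℝ) (ψ : 𝓢(Bdry d, ℂ)) (x : Bdry d) : ℂ :=
  (1 / (2 * Real.pi) ^ d : ℝ) *
    ∫ p, ((‖p‖ ^ (2 * ν) : ℝ) : ℂ) * fourierT ψ p *
      Complex.exp (Complex.I * ((inner ℝ p x : ℝ) : ℂ))

/-- The gap equation with source `J`,
that is `-(l/2)^{2ν-1} Γ(1-ν)/Γ(ν) (-□)^ν φ - f'(φ) = J`, in the sense of distributions: the
(symmetric) operator `(-□)^ν` is moved to the Schwartz test function, and all pairings have
to converge absolutely. -/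
def SolvesGapEquation {d : ℕ} (ν l : ℝ) (f : ℝ → ℝ) (J φ : Bdry d → ℝ) : Prop :=
  ∀ ψ : 𝓢(Bdry d, ℂ),
    Integrable (fun x => (φ x : ℂ) * fracLaplacian ν ψ x) ∧
    Integrable (fun x => ((deriv f (φ x) : ℝ) : ℂ) * ψ x) ∧
    Integrable (fun x => (J x : ℂ) * ψ x) ∧
    -(((l / 2) ^ (2 * ν - 1) * (Real.Gamma (1 - ν) / Real.Gamma ν) : ℝ) : ℂ) *
        (∫ x, (φ x : ℂ) * fracLaplacian ν ψ x) - (∫ x, ((deriv f (φ x) : ℝ) : ℂ) * ψ x) =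
      ∫ x, (J x : ℂ) * ψ x

/-- The sourceless gap equation in integral form, i.e. after inversion of `(-□)^ν` by its
Riesz kernel, required with an absolutely convergent integral at every point `x ≠ 0`
(the profiles `b / |x|^c` are singular at the origin). -/
def SolvesIntegralGapEquation {d : ℕ} (ν l : ℝ) (f : ℝ → ℝ) (φ : Bdry d → ℝ) : Prop :=
  ∀ x : Bdry d, x ≠ 0 →
    Integrable (fun y => deriv f (φ y) / ‖x - y‖ ^ ((d : ℝ) - 2 * ν)) ∧
    φ x + Real.Gamma ((d : ℝ) / 2 - ν) /
          (2 * Real.pi ^ ((d : ℝ) / 2) * l ^ (2 * ν - 1) * Real.Gamma (1 - ν)) *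
        (∫ y, deriv f (φ y) / ‖x - y‖ ^ ((d : ℝ) - 2 * ν)) = 0

/-- The value that the instanton solution prescribes for `b^(ω-2)`. -/
def instantonAmplitude (d : ℕ) (ν l ξ ω : ℝ) : ℝ :=
  (2 * l ^ (2 * ν - 1) * Real.Gamma (1 - ν) * Real.Gamma ((d : ℝ) / 2 - ν / (ω - 2)) *
      Real.Gamma ((ω - 1) * ν / (ω - 2))) /
    (ω * |ξ| * Real.Gamma ν * Real.Gamma (ν / (ω - 2)) *
      Real.Gamma ((d : ℝ) / 2 - (ω - 1) * ν / (ω - 2)))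

/-! ### The bulk problem -/

/-- `φ` is a smooth solution of the Klein-Gordon equation `(-□_g + msq) φ = 0` for the
metric `g = dr² + e^{2r/l} dx²` on `ℝ × ℝ^d`. Here `√g = e^{dr/l}`, hence
the operator is `□_g φ = e^{-dr/l} ∂_r (e^{dr/l} ∂_r φ) + e^{-2r/l} Δ_x φ`. -/
def SolvesKleinGordon {d : ℕ} (l msq : ℝ) (φ : ℝ → Bdry d → ℝ) : Prop :=
  ContDiff ℝ ((⊤ : ℕ∞) : WithTop ℕ∞) (fun q : ℝ × Bdry d => φ q.1 q.2) ∧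
  ∀ (r : ℝ) (x : Bdry d),
    -(Real.exp (-((d : ℝ) * r / l)) *
          deriv (fun s => Real.exp ((d : ℝ) * s / l) * deriv (fun t => φ t x) s) r +
        Real.exp (-(2 * r / l)) * Laplacian.laplacian (φ r) x) +
      msq * φ r x = 0

/-- The renormalized radial momentum at the boundary point `x` is `P`:
subtracting the counterterm `π_{(Δ_-)} = -(1/l) Δ_- φ` (the only one needed for `0 < ν < 1`),
the number `P = lim_{r → ∞} e^{Δ_+ r/l} (∂_r φ + (1/l) Δ_- φ)`. -/
def HasRenMomentum {d : ℕ} (ν l : ℝ) (φ : ℝ → Bdry d → ℝ) (x : Bdry d) (P : ℝ) : Prop :=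
  Tendsto (fun r : ℝ => Real.exp (deltaPlus d ν * r / l) *
      (deriv (fun s => φ s x) r + deltaMinus d ν / l * φ r x)) atTop (𝓝 P)

/-- `φ(r,x) = e^{-Δ_- r/l} u + e^{-Δ_+ r/l} v + o(e^{-Δ_+ r/l})` as `r → ∞`, i.e. `u` and `v`
are the non-normalizable mode `φ_-(x)` and the normalizable mode `φ_+(x)`. -/
def HasModes {d : ℕ} (ν l : ℝ) (φ : ℝ → Bdry d → ℝ) (x : Bdry d) (u v : ℝ) : Prop :=
  Tendsto (fun r : ℝ => Real.exp (deltaMinus d ν * r / l) * φ r x) atTop (𝓝 u) ∧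
  Tendsto (fun r : ℝ => Real.exp (deltaPlus d ν * r / l) *
      (φ r x - Real.exp (-(deltaMinus d ν * r / l)) * u)) atTop (𝓝 v)

/-- The mixed boundary condition defined by `f` with vanishing source at the boundary point `x`,
namely `J_f = -π̂_{(Δ_+)} - f'(φ_-) = 0`. -/
def SatisfiesMixedBC {d : ℕ} (ν l : ℝ) (f : ℝ → ℝ) (φ : ℝ → Bdry d → ℝ) (x : Bdry d) : Prop :=
  ∃ u v P : ℝ, HasModes ν l φ x u v ∧ HasRenMomentum ν l φ x P ∧ -P - deriv f u = 0

/-- The modified Bessel function of the second kind,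
given by `K_ν(z) = ∫_0^∞ e^{-z cosh t} cosh(ν t) dt`, for `z > 0`. -/
def besselK (ν z : ℝ) : ℝ :=
  ∫ t in Ioi (0 : ℝ), Real.exp (-(z * Real.cosh t)) * Real.cosh (ν * t)

/-- The distributional Fourier transform of the function `φ` is the function `φt`:
that is `⟨φt, ψ⟩ = ⟨φ, ψ̃⟩` for all Schwartz functions `ψ`, with convergent pairings. -/
def IsFourierTransform {d : ℕ} (φ : Bdry d → ℝ) (φt : Bdry d → ℂ) : Prop :=
  ∀ ψ : 𝓢(Bdry d, ℂ),
    Integrable (fun p => φt p * ψ p) ∧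
    Integrable (fun x => (φ x : ℂ) * fourierT ψ x) ∧
    (∫ p, φt p * ψ p) = ∫ x, (φ x : ℂ) * fourierT ψ x

/-- `Φ` is the bulk field with boundary mode `φ_-` given by the general regular solution
the formula `Φ(r,x) = l^ν / (2^{ν-1} Γ(ν)) e^{-dr/2l} ∫ d^d p/(2π)^d φ̃_-(p) p^ν K_ν(l p e^{-r/l}) e^{ip·x}`,
with an absolutely convergent integral. -/
def IsBulkField {d : ℕ} (ν l : ℝ) (φm : Bdry d → ℝ) (Φ : ℝ → Bdry d → ℝ) : Prop :=
  ∃ φt : Bdry d → ℂ, IsFourierTransform φm φt ∧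
    ∀ (r : ℝ) (x : Bdry d),
      Integrable (fun p => φt p * ((‖p‖ ^ ν * besselK ν (l * ‖p‖ * Real.exp (-(r / l))) : ℝ) : ℂ) *
        Complex.exp (Complex.I * ((inner ℝ p x : ℝ) : ℂ))) ∧
      (Φ r x : ℂ) =
        ((l ^ ν / (2 ^ (ν - 1) * Real.Gamma ν) * Real.exp (-((d : ℝ) * r / (2 * l))) *
            (1 / (2 * Real.pi) ^ d) : ℝ) : ℂ) *
          ∫ p, φt p * ((‖p‖ ^ ν * besselK ν (l * ‖p‖ * Real.exp (-(r / l))) : ℝ) : ℂ) *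
            Complex.exp (Complex.I * ((inner ℝ p x : ℝ) : ℂ))

/-- `F` is the hypergeometric function `F(α, β; γ; ·)` on `(-∞, 1)`: the real-analytic
continuation of Gauss' series from `(-1, 1)`. By the identity theorem it is unique there. -/
def IsHypergeometric (α β γ : ℝ) (F : ℝ → ℝ) : Prop :=
  AnalyticOnNhd ℝ F (Iio 1) ∧ ∀ z ∈ Ioo (-1 : ℝ) 1, F z = ordinaryHypergeometric α β γ z

/-- The bulk instanton, where `F` stands for `F(ν/(ω-2), (ω-1)ν/(ω-2); d/2; ·)`. -/
def instantonBulk {d : ℕ} (ν l ω b : ℝ) (F : ℝ → ℝ) (r : ℝ) (x : Bdry d) : ℝ :=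
  b * l ^ (-(2 * ν / (ω - 2))) *
    (Real.Gamma ((d : ℝ) / 2 - ν / (ω - 2)) * Real.Gamma ((ω - 1) * ν / (ω - 2)) /
      (Real.Gamma ((d : ℝ) / 2) * Real.Gamma ν)) *
    Real.exp (-(((d : ℝ) / 2 - ω * ν / (ω - 2)) * (r / l))) *
    F (-(1 / l ^ 2 * Real.exp (2 * r / l) * ‖x‖ ^ 2))

end AdSToy

end

noncomputable section

namespace AdSToy

variable {d : ℕ}

/-! ### Gamma and Beta integrals -/

theorem integral_rpow_mul_exp {s r : ℝ} (hs : 0 < s) (hr : 0 < r) :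
    ∫ t in Ioi (0 : ℝ), t ^ (s - 1) * Real.exp (-(r * t)) = Real.Gamma s * r ^ (-s) := by
  rw [Real.integral_rpow_mul_exp_neg_mul_Ioi hs hr, one_div, Real.inv_rpow hr.le,
    Real.rpow_neg hr.le, mul_comm]

/-- A function that is not integrable has integral 0 by convention, so a positive value of the
integral already proves integrability. -/
theorem integrableOn_rpow_mul_exp {s r : ℝ} (hs : 0 < s) (hr : 0 < r) :
    IntegrableOn (fun t : ℝ => t ^ (s - 1) * Real.exp (-(r * t))) (Ioi 0) := by
  by_contra h
  have h1 := integral_rpow_mul_exp hs hr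
  rw [integral_undef h] at h1
  have := Real.Gamma_pos_of_pos hs
  have : 0 < Real.Gamma s * r ^ (-s) := by positivity
  linarith

theorem lintegral_rpow_mul_exp {s r : ℝ} (hs : 0 < s) (hr : 0 < r) :
    ∫⁻ t in Ioi (0 : ℝ), ENNReal.ofReal (t ^ (s - 1) * Real.exp (-(r * t))) =
      ENNReal.ofReal (Real.Gamma s * r ^ (-s)) := by
  rw [← integral_rpow_mul_exp hs hr,
    ofReal_integral_eq_lintegral_ofReal (integrableOn_rpow_mul_exp hs hr)]
  filter_upwards [ae_restrict_mem measurableSet_Ioi] with t ht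
  have : (0 : ℝ) < t := ht
  positivity

/-- A nonnegative function with finite, known lower integral is integrable, with known integral. -/
theorem integrable_and_integral_of_lintegral {X : Type*} [MeasurableSpace X] {μ : Measure X}
    {f : X → ℝ} (hm : AEStronglyMeasurable f μ) (hf : 0 ≤ᵐ[μ] f) {I : ℝ} (hI : 0 ≤ I)
    (h : ∫⁻ x, ENNReal.ofReal (f x) ∂μ = ENNReal.ofReal I) :
    Integrable f μ ∧ ∫ x, f x ∂μ = I := by
  refine ⟨⟨hm, ?_⟩, ?_⟩
  · rw [hasFiniteIntegral_iff_ofReal hf, h]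
    exact ENNReal.ofReal_lt_top
  · rw [integral_eq_lintegral_of_nonneg_ae hf hm, h, ENNReal.toReal_ofReal hI]

/-- After multiplication by Γ(p+q), the power (1+v)^(-(p+q)) is a Gamma integral in w; integrating
over v first leaves Γ(p), then Γ(q). With lower integrals the exchange needs no integrability, and
finiteness is part of the result. -/
theorem lintegral_betaPrime {p q : ℝ} (hp : 0 < p) (hq : 0 < q) :
    ∫⁻ v in Ioi (0 : ℝ), ENNReal.ofReal (v ^ (p - 1) * (1 + v) ^ (-(p + q))) =
      ENNReal.ofReal (Real.Gamma p * Real.Gamma q / Real.Gamma (p + q)) := by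
  have hG := Real.Gamma_pos_of_pos (add_pos hp hq)
  have hGp := Real.Gamma_pos_of_pos hp
  have hGq := Real.Gamma_pos_of_pos hq
  have key : ∫⁻ v in Ioi (0 : ℝ), ENNReal.ofReal (Real.Gamma (p + q)) *
      ENNReal.ofReal (v ^ (p - 1) * (1 + v) ^ (-(p + q))) =
      ENNReal.ofReal (Real.Gamma p * Real.Gamma q) := by
    calc _ = ∫⁻ v in Ioi (0 : ℝ), ∫⁻ w in Ioi (0 : ℝ),
          ENNReal.ofReal (v ^ (p - 1) * (w ^ (p + q - 1) * Real.exp (-((1 + v) * w)))) := by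
          refine setLIntegral_congr_fun measurableSet_Ioi fun v hv => ?_
          have hv' : (0 : ℝ) < v := hv
          have h1 : ∀ w : ℝ, ENNReal.ofReal
              (v ^ (p - 1) * (w ^ (p + q - 1) * Real.exp (-((1 + v) * w)))) =
              ENNReal.ofReal (v ^ (p - 1)) *
                ENNReal.ofReal (w ^ (p + q - 1) * Real.exp (-((1 + v) * w))) := fun w =>
            ENNReal.ofReal_mul (by positivity)
          simp only [h1]
          rw [lintegral_const_mul' _ _ ENNReal.ofReal_ne_top,
            lintegral_rpow_mul_exp (add_pos hp hq) (by positivity), ← ENNReal.ofReal_mul (by positivity),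
            ← ENNReal.ofReal_mul (by positivity)]
          ring_nf
      _ = ∫⁻ w in Ioi (0 : ℝ), ∫⁻ v in Ioi (0 : ℝ),
          ENNReal.ofReal (v ^ (p - 1) * (w ^ (p + q - 1) * Real.exp (-((1 + v) * w)))) := by
          rw [lintegral_lintegral_swap]
          refine Measurable.aemeasurable ?_
          unfold Function.uncurry
          fun_prop
      _ = ∫⁻ w in Ioi (0 : ℝ), ENNReal.ofReal (Real.Gamma p) *
            ENNReal.ofReal (w ^ (q - 1) * Real.exp (-(1 * w))) := by
          refine setLIntegral_congr_fun measurableSet_Ioi fun w hw => ?_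
          have hw' : (0 : ℝ) < w := hw
          have h1 : ∀ v : ℝ, ENNReal.ofReal
              (v ^ (p - 1) * (w ^ (p + q - 1) * Real.exp (-((1 + v) * w)))) =
              ENNReal.ofReal (w ^ (p + q - 1) * Real.exp (-w)) *
                ENNReal.ofReal (v ^ (p - 1) * Real.exp (-(w * v))) := fun v => by
            rw [← ENNReal.ofReal_mul (by positivity), show -((1 + v) * w) = -w + -(w * v) by ring,
              Real.exp_add]
            ring_nf
          simp only [h1]
          rw [lintegral_const_mul' _ _ ENNReal.ofReal_ne_top, lintegral_rpow_mul_exp hp hw',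
            ← ENNReal.ofReal_mul (by positivity), ← ENNReal.ofReal_mul (by positivity)]
          congr 1
          rw [show p + q - 1 = p + (q - 1) by ring, Real.rpow_add hw', Real.rpow_neg hw'.le]
          have : w ^ p ≠ 0 := by positivity
          field_simp
      _ = _ := by
          rw [lintegral_const_mul' _ _ ENNReal.ofReal_ne_top, lintegral_rpow_mul_exp hq one_pos,
            ← ENNReal.ofReal_mul (by positivity)]
          simp
  rw [lintegral_const_mul' _ _ ENNReal.ofReal_ne_top] at key
  rw [ENNReal.ofReal_div_of_pos hG, ← key, mul_comm, ENNReal.mul_div_cancel_right]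
  · simpa using hG
  · exact ENNReal.ofReal_ne_top

theorem integral_betaPrime {p q : ℝ} (hp : 0 < p) (hq : 0 < q) :
    IntegrableOn (fun v : ℝ => v ^ (p - 1) * (1 + v) ^ (-(p + q))) (Ioi 0) ∧
    ∫ v in Ioi (0 : ℝ), v ^ (p - 1) * (1 + v) ^ (-(p + q)) =
      Real.Gamma p * Real.Gamma q / Real.Gamma (p + q) := by
  have := Real.Gamma_pos_of_pos (add_pos hp hq)
  have := Real.Gamma_pos_of_pos hp
  have := Real.Gamma_pos_of_pos hq
  refine integrable_and_integral_of_lintegral ?_ ?_ (by positivity) (lintegral_betaPrime hp hq)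
  · exact Measurable.aestronglyMeasurable (by fun_prop)
  · filter_upwards [ae_restrict_mem measurableSet_Ioi] with v hv
    have : (0 : ℝ) < v := hv
    positivity

/-- The Gamma integral after t ↦ 1/t, the form in which exp(-‖p‖²/(4t)), the transform of a Gaussian
of rate t, is integrated. -/
theorem integral_rpow_mul_exp_inv {s r : ℝ} (hs : 0 < s) (hr : 0 < r) :
    ∫ t in Ioi (0 : ℝ), t ^ (-s - 1) * Real.exp (-(r / t)) = Real.Gamma s * r ^ (-s) := by
  rw [← integral_rpow_mul_exp hs hr, ← integral_comp_rpow_Ioi _ (p := -1) (by norm_num)]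
  refine setIntegral_congr_fun measurableSet_Ioi fun t ht => ?_
  have ht' : (0 : ℝ) < t := ht
  simp only [abs_neg, abs_one, one_mul, smul_eq_mul, Real.rpow_neg_one]
  rw [← mul_assoc, Real.inv_rpow ht'.le, ← Real.rpow_neg ht'.le, ← Real.rpow_add ht', div_inv_eq_mul]
  ring_nf

theorem integrableOn_rpow_mul_exp_inv {s r : ℝ} (hs : 0 < s) (hr : 0 < r) :
    IntegrableOn (fun t : ℝ => t ^ (-s - 1) * Real.exp (-(r / t))) (Ioi 0) := by
  by_contra h
  have h1 := integral_rpow_mul_exp_inv hs hr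
  rw [integral_undef h] at h1
  have := Real.Gamma_pos_of_pos hs
  have : 0 < Real.Gamma s * r ^ (-s) := by positivity
  linarith

/-! ### Gaussian integrals -/

theorem integral_gaussian_mul_exp_inner {τ : ℝ} (hτ : 0 < τ) (x : Bdry d) :
    ∫ p : Bdry d, ((Real.exp (-(τ * ‖p‖ ^ 2)) : ℝ) : ℂ) *
        Complex.exp (Complex.I * ((inner ℝ p x : ℝ) : ℂ)) =
      (((Real.pi / τ) ^ ((d : ℝ) / 2) * Real.exp (-(‖x‖ ^ 2 / (4 * τ))) : ℝ) : ℂ) := by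
  have h := GaussianFourier.integral_cexp_neg_mul_sq_norm_add (V := Bdry d) (b := (τ : ℂ))
    (by simpa using hτ) Complex.I x
  rw [finrank_euclideanSpace_fin] at h
  convert h using 1
  · refine integral_congr_ae (Eventually.of_forall fun p => ?_)
    simp only [Complex.ofReal_exp]
    rw [← Complex.exp_add, real_inner_comm]
    push_cast
    ring_nf
  · push_cast
    rw [Complex.ofReal_cpow (by positivity)]
    push_cast
    congr 2
    rw [Complex.I_sq]
    ring

theorem integral_gaussian {τ : ℝ} (hτ : 0 < τ) :
    ∫ p : Bdry d, Real.exp (-(τ * ‖p‖ ^ 2)) = (Real.pi / τ) ^ ((d : ℝ) / 2) := by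
  have h := GaussianFourier.integral_rexp_neg_mul_sq_norm (V := Bdry d) hτ
  rw [finrank_euclideanSpace_fin] at h
  simpa using h

theorem integrable_gaussian {τ : ℝ} (hτ : 0 < τ) :
    Integrable fun p : Bdry d => Real.exp (-(τ * ‖p‖ ^ 2)) := by
  by_contra h
  have h1 := integral_gaussian (d := d) hτ
  rw [integral_undef h] at h1
  have : 0 < (Real.pi / τ) ^ ((d : ℝ) / 2) := by positivity
  linarith

theorem lintegral_gaussian {τ : ℝ} (hτ : 0 < τ) :
    ∫⁻ p : Bdry d, ENNReal.ofReal (Real.exp (-(τ * ‖p‖ ^ 2))) =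
      ENNReal.ofReal ((Real.pi / τ) ^ ((d : ℝ) / 2)) := by
  rw [← integral_gaussian hτ, ofReal_integral_eq_lintegral_ofReal (integrable_gaussian hτ)]
  exact Eventually.of_forall fun p => (Real.exp_pos _).le

/-- Completing the square: the product of two Gaussians. -/
theorem lintegral_gaussian_mul_gaussian {s v : ℝ} (hs : 0 < s) (hv : 0 < v) (x : Bdry d) :
    ∫⁻ y : Bdry d, ENNReal.ofReal (Real.exp (-(s * (‖y‖ ^ 2 + v * ‖x - y‖ ^ 2)))) =
      ENNReal.ofReal ((Real.pi / (s * (1 + v))) ^ ((d : ℝ) / 2) *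
        Real.exp (-(s * (v / (1 + v) * ‖x‖ ^ 2)))) := by
  have h1 : ∀ y : Bdry d, s * (‖y‖ ^ 2 + v * ‖x - y‖ ^ 2) =
      s * (v / (1 + v) * ‖x‖ ^ 2) + s * (1 + v) * ‖y - (v / (1 + v)) • x‖ ^ 2 := by
    intro y
    rw [@norm_sub_sq_real, @norm_sub_sq_real, norm_smul, Real.norm_eq_abs, inner_smul_right,
      mul_pow, sq_abs, real_inner_comm]
    field_simp
    ring
  have h2 : ∀ y : Bdry d, ENNReal.ofReal (Real.exp (-(s * (‖y‖ ^ 2 + v * ‖x - y‖ ^ 2)))) =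
      ENNReal.ofReal (Real.exp (-(s * (v / (1 + v) * ‖x‖ ^ 2)))) *
        ENNReal.ofReal (Real.exp (-(s * (1 + v) * ‖y - (v / (1 + v)) • x‖ ^ 2))) := by
    intro y
    rw [h1, neg_add, Real.exp_add, ENNReal.ofReal_mul (Real.exp_pos _).le]
  simp only [h2]
  rw [lintegral_const_mul' _ _ ENNReal.ofReal_ne_top,
    lintegral_sub_right_eq_self
      (fun y : Bdry d => ENNReal.ofReal (Real.exp (-(s * (1 + v) * ‖y‖ ^ 2)))),
    lintegral_gaussian (by positivity), ← ENNReal.ofReal_mul (by positivity), mul_comm]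

/-! ### The Riesz potential of a power -/

theorem sq_rpow_neg_half {t : ℝ} (ht : 0 ≤ t) (a : ℝ) : (t ^ 2) ^ (-(a / 2)) = t ^ (-a) := by
  rw [← Real.rpow_natCast, ← Real.rpow_mul ht]
  congr 1
  push_cast
  ring

theorem ae_ne_point [NeZero d] (x : Bdry d) : ∀ᵐ y : Bdry d, y ≠ x := by
  have : Nonempty (Fin d) := ⟨0⟩
  rw [ae_iff]
  simp

/-- A product of two powers as a superposition of Gaussians. -/
theorem lintegral_riesz_superposition {a b A B : ℝ} (ha : 0 < a) (hb : 0 < b) (hA : 0 < A)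
    (hB : 0 < B) :
    ∫⁻ s in Ioi (0 : ℝ), ∫⁻ v in Ioi (0 : ℝ),
        ENNReal.ofReal (v ^ (b / 2 - 1) * s ^ ((a + b) / 2 - 1) *
          Real.exp (-(s * (A ^ 2 + v * B ^ 2)))) =
      ENNReal.ofReal (Real.Gamma (a / 2) * Real.Gamma (b / 2)) *
        ENNReal.ofReal (A ^ (-a) * B ^ (-b)) := by
  have hGa := Real.Gamma_pos_of_pos (half_pos ha)
  have hGb := Real.Gamma_pos_of_pos (half_pos hb)
  calc _ = ∫⁻ s in Ioi (0 : ℝ), ENNReal.ofReal (Real.Gamma (b / 2) * B ^ (-b)) *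
        ENNReal.ofReal (s ^ (a / 2 - 1) * Real.exp (-(A ^ 2 * s))) := by
        refine setLIntegral_congr_fun measurableSet_Ioi fun s hs => ?_
        have hs' : (0 : ℝ) < s := hs
        have h1 : ∀ v : ℝ, ENNReal.ofReal (v ^ (b / 2 - 1) * s ^ ((a + b) / 2 - 1) *
            Real.exp (-(s * (A ^ 2 + v * B ^ 2)))) =
            ENNReal.ofReal (s ^ ((a + b) / 2 - 1) * Real.exp (-(A ^ 2 * s))) *
              ENNReal.ofReal (v ^ (b / 2 - 1) * Real.exp (-(s * B ^ 2 * v))) := fun v => by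
          rw [← ENNReal.ofReal_mul (by positivity),
            show -(s * (A ^ 2 + v * B ^ 2)) = -(A ^ 2 * s) + -(s * B ^ 2 * v) by ring, Real.exp_add]
          ring_nf
        simp only [h1]
        rw [lintegral_const_mul' _ _ ENNReal.ofReal_ne_top,
          lintegral_rpow_mul_exp (half_pos hb) (by positivity), ← ENNReal.ofReal_mul (by positivity),
          ← ENNReal.ofReal_mul (by positivity), Real.mul_rpow hs'.le (by positivity),
          sq_rpow_neg_half hB.le, show (a + b) / 2 - 1 = (a / 2 - 1) + b / 2 by ring,
          Real.rpow_add hs', Real.rpow_neg hs'.le]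
        congr 1
        have : s ^ (b / 2) ≠ 0 := by positivity
        field_simp
    _ = _ := by
        rw [lintegral_const_mul' _ _ ENNReal.ofReal_ne_top,
          lintegral_rpow_mul_exp (half_pos ha) (by positivity), sq_rpow_neg_half hA.le,
          ← ENNReal.ofReal_mul (by positivity), ← ENNReal.ofReal_mul (by positivity)]
        ring_nf

/-- The constant in the Riesz potential of a power. -/
def rieszConst (d : ℕ) (a b : ℝ) : ℝ :=
  Real.pi ^ ((d : ℝ) / 2) *
    (Real.Gamma (((d : ℝ) - a) / 2) * Real.Gamma (((d : ℝ) - b) / 2) *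
      Real.Gamma ((a + b - d) / 2)) /
    (Real.Gamma (a / 2) * Real.Gamma (b / 2) *
      Real.Gamma (((d : ℝ) - a) / 2 + ((d : ℝ) - b) / 2))

theorem rieszConst_pos {a b : ℝ} (ha : 0 < a) (hb : 0 < b) (had : a < d) (hbd : b < d)
    (hab : d < a + b) : 0 < rieszConst d a b := by
  have := Real.Gamma_pos_of_pos (half_pos ha)
  have := Real.Gamma_pos_of_pos (half_pos hb)
  have := Real.Gamma_pos_of_pos (half_pos (sub_pos.2 had))
  have := Real.Gamma_pos_of_pos (half_pos (sub_pos.2 hbd))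
  have := Real.Gamma_pos_of_pos (half_pos (sub_pos.2 hab))
  have := Real.Gamma_pos_of_pos (add_pos (half_pos (sub_pos.2 had)) (half_pos (sub_pos.2 hbd)))
  unfold rieszConst
  positivity

/-- The two powers become Gaussians of rates s and s·v. Completing the square integrates out y,
after which s gives a Gamma integral and v a beta-prime integral with p = (d-a)/2, q = (d-b)/2. The
conditions a < d, b < d, d < a + b are convergence at 0, at x and at infinity. -/
theorem lintegral_riesz [NeZero d] {a b : ℝ} (ha : 0 < a) (hb : 0 < b) (had : a < d) (hbd : b < d)
    (hab : d < a + b) {x : Bdry d} (hx : x ≠ 0) :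
    ∫⁻ y : Bdry d, ENNReal.ofReal (‖y‖ ^ (-a) * ‖x - y‖ ^ (-b)) =
      ENNReal.ofReal (rieszConst d a b * ‖x‖ ^ ((d : ℝ) - a - b)) := by
  have hGa := Real.Gamma_pos_of_pos (half_pos ha)
  have hGb := Real.Gamma_pos_of_pos (half_pos hb)
  have hp : 0 < ((d : ℝ) - a) / 2 := half_pos (sub_pos.2 had)
  have hq : 0 < ((d : ℝ) - b) / 2 := half_pos (sub_pos.2 hbd)
  have hr : 0 < (a + b - d) / 2 := half_pos (sub_pos.2 hab)
  have hGp := Real.Gamma_pos_of_pos hp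
  have hGq := Real.Gamma_pos_of_pos hq
  have hGr := Real.Gamma_pos_of_pos hr
  have hGpq := Real.Gamma_pos_of_pos (add_pos hp hq)
  have hX : 0 < ‖x‖ := norm_pos_iff.2 hx
  set K : ℝ × ℝ → Bdry d → ENNReal := fun z y =>
    ENNReal.ofReal (z.2 ^ (b / 2 - 1) * z.1 ^ ((a + b) / 2 - 1) *
          Real.exp (-(z.1 * (‖y‖ ^ 2 + z.2 * ‖x - y‖ ^ 2)))) with hK
  have key : ENNReal.ofReal (Real.Gamma (a / 2) * Real.Gamma (b / 2)) *
      ∫⁻ y : Bdry d, ENNReal.ofReal (‖y‖ ^ (-a) * ‖x - y‖ ^ (-b)) =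
      ENNReal.ofReal (Real.Gamma (a / 2) * Real.Gamma (b / 2)) *
        ENNReal.ofReal (rieszConst d a b * ‖x‖ ^ ((d : ℝ) - a - b)) := by
    calc _ = ∫⁻ y : Bdry d, ∫⁻ s in Ioi (0 : ℝ), ∫⁻ v in Ioi (0 : ℝ), K (s, v) y := by
          rw [← lintegral_const_mul' _ _ ENNReal.ofReal_ne_top]
          refine lintegral_congr_ae ?_
          filter_upwards [ae_ne_point (0 : Bdry d), ae_ne_point x] with y h0 h1
          rw [← lintegral_riesz_superposition ha hb (norm_pos_iff.2 h0)
            (norm_pos_iff.2 (sub_ne_zero.2 h1.symm))]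
      _ = ∫⁻ s in Ioi (0 : ℝ), ∫⁻ y : Bdry d, ∫⁻ v in Ioi (0 : ℝ), K (s, v) y := by
          rw [lintegral_lintegral_swap]
          refine (Measurable.lintegral_prod_right'
            (f := fun z : (Bdry d × ℝ) × ℝ => K (z.1.2, z.2) z.1.1) ?_).aemeasurable
          simp only [hK]
          fun_prop
      _ = ∫⁻ s in Ioi (0 : ℝ), ∫⁻ v in Ioi (0 : ℝ), ∫⁻ y : Bdry d, K (s, v) y := by
          refine lintegral_congr fun s => ?_
          rw [lintegral_lintegral_swap]
          refine Measurable.aemeasurable ?_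
          simp only [hK, Function.uncurry_def]
          fun_prop
      _ = ∫⁻ v in Ioi (0 : ℝ), ∫⁻ s in Ioi (0 : ℝ), ∫⁻ y : Bdry d, K (s, v) y := by
          rw [lintegral_lintegral_swap]
          refine (Measurable.lintegral_prod_right'
            (f := fun z : (ℝ × ℝ) × Bdry d => K (z.1.1, z.1.2) z.2) ?_).aemeasurable
          simp only [hK]
          fun_prop
      _ = ∫⁻ v in Ioi (0 : ℝ), ENNReal.ofReal (Real.pi ^ ((d : ℝ) / 2) *
            Real.Gamma ((a + b - d) / 2) * ‖x‖ ^ ((d : ℝ) - a - b)) *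
            ENNReal.ofReal (v ^ (((d : ℝ) - a) / 2 - 1) *
              (1 + v) ^ (-(((d : ℝ) - a) / 2 + ((d : ℝ) - b) / 2))) := by
          refine setLIntegral_congr_fun measurableSet_Ioi fun v hv => ?_
          have hv' : (0 : ℝ) < v := hv
          calc _ = ∫⁻ s in Ioi (0 : ℝ), ENNReal.ofReal (Real.pi ^ ((d : ℝ) / 2) *
                (v ^ (b / 2 - 1) * (1 + v) ^ (-((d : ℝ) / 2)))) *
                ENNReal.ofReal (s ^ ((a + b - d) / 2 - 1) *
                  Real.exp (-(v / (1 + v) * ‖x‖ ^ 2 * s))) := by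
                refine setLIntegral_congr_fun measurableSet_Ioi fun s hs => ?_
                have hs' : (0 : ℝ) < s := hs
                have h1 : ∀ y, K (s, v) y =
                    ENNReal.ofReal (v ^ (b / 2 - 1) * s ^ ((a + b) / 2 - 1)) *
                    ENNReal.ofReal (Real.exp (-(s * (‖y‖ ^ 2 + v * ‖x - y‖ ^ 2)))) := fun y => by
                  rw [← ENNReal.ofReal_mul (by positivity)]
                simp only [h1]
                rw [lintegral_const_mul' _ _ ENNReal.ofReal_ne_top,
                  lintegral_gaussian_mul_gaussian hs' hv', ← ENNReal.ofReal_mul (by positivity),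
                  ← ENNReal.ofReal_mul (by positivity),
                  Real.div_rpow (by positivity) (by positivity), Real.mul_rpow hs'.le (by positivity),
                  show (a + b) / 2 - 1 = ((a + b - d) / 2 - 1) + (d : ℝ) / 2 by ring,
                  Real.rpow_add hs', Real.rpow_neg (by positivity)]
                congr 1
                have : s ^ ((d : ℝ) / 2) ≠ 0 := by positivity
                field_simp
            _ = _ := by
                rw [lintegral_const_mul' _ _ ENNReal.ofReal_ne_top,
                  lintegral_rpow_mul_exp hr (by positivity), ← ENNReal.ofReal_mul (by positivity),
                  ← ENNReal.ofReal_mul (by positivity), Real.mul_rpow (by positivity) (by positivity),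
                  sq_rpow_neg_half hX.le, Real.div_rpow hv'.le (by positivity),
                  show b / 2 - 1 = (((d : ℝ) - a) / 2 - 1) + (a + b - d) / 2 by ring,
                  Real.rpow_add hv',
                  show -(((d : ℝ) - a) / 2 + ((d : ℝ) - b) / 2) =
                    -((d : ℝ) / 2) + (a + b - d) / 2 by ring,
                  Real.rpow_add (by positivity : (0 : ℝ) < 1 + v),
                  Real.rpow_neg hv'.le ((a + b - d) / 2),
                  Real.rpow_neg (by positivity : (0 : ℝ) ≤ 1 + v) ((a + b - d) / 2),
                  show -(a + b - (d : ℝ)) = d - a - b by ring]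
                congr 1
                have : v ^ ((a + b - d) / 2) ≠ 0 := by positivity
                have : (1 + v) ^ ((a + b - d) / 2) ≠ 0 := by positivity
                field_simp
      _ = _ := by
          rw [lintegral_const_mul' _ _ ENNReal.ofReal_ne_top, lintegral_betaPrime hp hq,
            ← ENNReal.ofReal_mul (by positivity), ← ENNReal.ofReal_mul (by positivity)]
          congr 1
          unfold rieszConst
          field_simp
  refine (ENNReal.mul_right_inj ?_ ENNReal.ofReal_ne_top).1 key
  simp only [ne_eq, ENNReal.ofReal_eq_zero, not_le]
  positivity

theorem integral_riesz [NeZero d] {a b : ℝ} (ha : 0 < a) (hb : 0 < b) (had : a < d) (hbd : b < d)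
    (hab : d < a + b) {x : Bdry d} (hx : x ≠ 0) :
    Integrable (fun y : Bdry d => ‖y‖ ^ (-a) * ‖x - y‖ ^ (-b)) ∧
    ∫ y : Bdry d, ‖y‖ ^ (-a) * ‖x - y‖ ^ (-b) = rieszConst d a b * ‖x‖ ^ ((d : ℝ) - a - b) := by
  have := rieszConst_pos ha hb had hbd hab
  refine integrable_and_integral_of_lintegral ?_ ?_ (by positivity)
    (lintegral_riesz ha hb had hbd hab hx)
  · exact Measurable.aestronglyMeasurable (by fun_prop)
  · exact Eventually.of_forall fun y => by positivity

/-! ### Integrability of powers of the norm -/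

theorem nontrivial_bdry [NeZero d] : Nontrivial (Bdry d) := by
  have : Nonempty (Fin d) := ⟨0⟩
  infer_instance

theorem pow_pred_mul_rpow [NeZero d] {y : ℝ} (hy : 0 < y) (a : ℝ) :
    y ^ (d - 1) * y ^ (-a) = y ^ ((d : ℝ) - 1 - a) := by
  rw [← Real.rpow_natCast, ← Real.rpow_add hy]
  have : 1 ≤ d := Nat.one_le_iff_ne_zero.2 (NeZero.ne d)
  push_cast [this]
  ring_nf

theorem integrableOn_ball_norm_rpow [NeZero d] {a r : ℝ} (hr : 0 < r) :
    IntegrableOn (fun y : Bdry d => ‖y‖ ^ (-a)) (Metric.ball 0 r) ↔ a < d := by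
  have := nontrivial_bdry (d := d)
  rw [integrableOn_fun_norm_addHaar volume (f := fun t : ℝ => t ^ (-a)), finrank_euclideanSpace_fin,
    integrableOn_congr_fun (g := fun y : ℝ => y ^ ((d : ℝ) - 1 - a)) _ measurableSet_Ioo,
    intervalIntegral.integrableOn_Ioo_rpow_iff hr]
  · constructor <;> intro h <;> linarith
  · intro y hy
    exact pow_pred_mul_rpow hy.1 a

theorem integrableOn_compl_ball_norm_rpow [NeZero d] {a r : ℝ} (hr : 0 < r) :
    IntegrableOn (fun y : Bdry d => ‖y‖ ^ (-a)) (Metric.ball 0 r)ᶜ ↔ d < a := by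
  have := nontrivial_bdry (d := d)
  have h1 : IntegrableOn (fun y : Bdry d => ‖y‖ ^ (-a)) (Metric.ball 0 r)ᶜ ↔
      Integrable (fun y : Bdry d => (Ici r).indicator (fun t : ℝ => t ^ (-a)) ‖y‖) := by
    rw [← integrable_indicator_iff Metric.isOpen_ball.measurableSet.compl]
    refine integrable_congr (Eventually.of_forall fun y => ?_)
    simp [indicator]
  rw [h1, integrable_fun_norm_addHaar volume (f := (Ici r).indicator fun t : ℝ => t ^ (-a)),
    finrank_euclideanSpace_fin,
    integrableOn_congr_fun (g := (Ici r).indicator fun y : ℝ => y ^ ((d : ℝ) - 1 - a)) _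
      measurableSet_Ioi, IntegrableOn, integrable_indicator_iff measurableSet_Ici,
    IntegrableOn, Measure.restrict_restrict measurableSet_Ici,
    inter_eq_left.2 (Ici_subset_Ioi.2 hr), ← IntegrableOn,
    integrableOn_Ici_iff_integrableOn_Ioi,
    integrableOn_Ioi_rpow_iff hr]
  · constructor <;> intro h <;> linarith
  · intro y hy
    by_cases h : r ≤ y
    · simp [h, pow_pred_mul_rpow (d := d) hy]
    · simp [h]

/-- Within a factor 2 of the base, a power changes by at most the factor 2^|e|; logarithms treat
both signs of e at once. -/
theorem two_rpow_neg_abs_le {A t e : ℝ} (hA : 0 < A) (h1 : A / 2 ≤ t) (h2 : t ≤ 2 * A) :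
    (2 : ℝ) ^ (-|e|) * A ^ (-e) ≤ t ^ (-e) := by
  have ht : 0 < t := by linarith
  rw [Real.rpow_def_of_pos two_pos, Real.rpow_def_of_pos hA, Real.rpow_def_of_pos ht, ← Real.exp_add,
    Real.exp_le_exp]
  have h3 : Real.log t ≤ Real.log 2 + Real.log A := by
    rw [← Real.log_mul two_ne_zero hA.ne']
    exact Real.log_le_log ht h2
  have h4 : Real.log A ≤ Real.log 2 + Real.log t := by
    rw [← Real.log_mul two_ne_zero ht.ne']
    exact Real.log_le_log hA (by linarith)
  have h5 : |Real.log t - Real.log A| ≤ Real.log 2 := abs_le.2 ⟨by linarith, by linarith⟩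
  have h6 := le_abs_self ((Real.log t - Real.log A) * e)
  rw [abs_mul] at h6
  have h7 := mul_le_mul_of_nonneg_right h5 (abs_nonneg e)
  linarith

/-- Near 0 the second factor is comparable to a constant, far away to ‖y‖^(-e); the conclusions are
the convergence conditions at these two places. The singularity at y = x is not examined. -/
theorem exponents_of_integrable_riesz [NeZero d] {a e : ℝ} {x : Bdry d} (hx : x ≠ 0)
    (h : Integrable (fun y : Bdry d => ‖y‖ ^ (-a) * ‖x - y‖ ^ (-e))) : a < d ∧ d < a + e := by
  have hX : 0 < ‖x‖ := norm_pos_iff.2 hx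
  have h2 : (0 : ℝ) < 2 ^ (-|e|) := by positivity
  constructor
  · rw [← integrableOn_ball_norm_rpow (a := a) (half_pos hX)]
    refine Integrable.mono' ((h.integrableOn (s := Metric.ball 0 (‖x‖ / 2))).const_mul
      (2 ^ (-|e|) * ‖x‖ ^ (-e))⁻¹) (Measurable.aestronglyMeasurable (by fun_prop)) ?_
    filter_upwards [ae_restrict_mem Metric.isOpen_ball.measurableSet] with y hy
    rw [mem_ball_zero_iff] at hy
    have h3 : ‖x‖ / 2 ≤ ‖x - y‖ := by linarith [norm_sub_norm_le x y]
    have h4 : ‖x - y‖ ≤ 2 * ‖x‖ := by linarith [norm_sub_le x y]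
    have h5 := two_rpow_neg_abs_le (e := e) hX h3 h4
    rw [Real.norm_of_nonneg (by positivity), inv_mul_eq_div, le_div_iff₀ (by positivity)]
    exact mul_le_mul_of_nonneg_left h5 (by positivity)
  · rw [← integrableOn_compl_ball_norm_rpow (a := a + e) (mul_pos two_pos hX)]
    refine Integrable.mono' ((h.integrableOn (s := (Metric.ball 0 (2 * ‖x‖))ᶜ)).const_mul
      (2 ^ (-|e|))⁻¹) (Measurable.aestronglyMeasurable (by fun_prop)) ?_
    filter_upwards [ae_restrict_mem Metric.isOpen_ball.measurableSet.compl] with y hy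
    rw [mem_compl_iff, mem_ball_zero_iff, not_lt] at hy
    have hY : 0 < ‖y‖ := by linarith
    have h3 : ‖y‖ / 2 ≤ ‖x - y‖ := by linarith [norm_sub_norm_le y x, norm_sub_rev x y]
    have h4 : ‖x - y‖ ≤ 2 * ‖y‖ := by linarith [norm_sub_le x y]
    have h5 := two_rpow_neg_abs_le (e := e) hY h3 h4
    rw [Real.norm_of_nonneg (by positivity), inv_mul_eq_div, le_div_iff₀ (by positivity),
      neg_add, Real.rpow_add hY, mul_assoc, mul_comm (‖y‖ ^ (-e))]
    exact mul_le_mul_of_nonneg_left h5 (by positivity)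

/-! ### The integral gap equation for power profiles -/

theorem deriv_powPotential (ξ ω : ℝ) {t : ℝ} (ht : 0 < t) :
    deriv (powPotential ξ ω) t = ξ * ω * t ^ (ω - 1) := by
  have h := (Real.hasDerivAt_rpow_const (p := ω) (Or.inl ht.ne')).const_mul ξ
  rw [← mul_assoc] at h
  exact h.deriv

theorem profile_eq (b c : ℝ) (x : Bdry d) : profile b c x = b * ‖x‖ ^ (-c) := by
  rw [profile, Real.rpow_neg (norm_nonneg x), div_eq_mul_inv]

theorem deriv_powPotential_profile {ξ ω b c : ℝ} (hb : 0 < b) {y : Bdry d} (hy : y ≠ 0) :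
    deriv (powPotential ξ ω) (profile b c y) =
      ξ * ω * b ^ (ω - 1) * ‖y‖ ^ (-(c * (ω - 1))) := by
  have hY : 0 < ‖y‖ := norm_pos_iff.2 hy
  rw [profile_eq, deriv_powPotential _ _ (by positivity), Real.mul_rpow hb.le (by positivity),
    ← Real.rpow_mul hY.le, mul_assoc (ξ * ω), neg_mul]

theorem exists_norm_eq_one [NeZero d] : ∃ x : Bdry d, ‖x‖ = 1 :=
  ⟨EuclideanSpace.single 0 1, by simp⟩

/-- The condition on the parameters under which instantons exist. -/
def InstantonCondition (d : ℕ) (ν ξ ω : ℝ) : Prop :=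
  2 < ω ∧ ξ < 0 ∧ (ω - 1) * ν / (ω - 2) < (d : ℝ) / 2

/-- The exponent and the amplitude of the instanton. -/
def IsInstanton (d : ℕ) (ν l ξ ω b c : ℝ) : Prop :=
  InstantonCondition d ν ξ ω ∧ c = 2 * ν / (ω - 2) ∧ b ^ (ω - 2) = instantonAmplitude d ν l ξ ω

/-- The two Gamma function parameters `α = ν/(ω-2)` and `β = (ω-1)ν/(ω-2)`. -/
theorem InstantonCondition.params {ν ξ ω : ℝ} (hν : 0 < ν) (h : InstantonCondition d ν ξ ω) :
    0 < ν / (ω - 2) ∧ (ω - 1) * ν / (ω - 2) = ν / (ω - 2) + ν ∧ ν / (ω - 2) + ν < (d : ℝ) / 2 ∧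
      (ω - 2) * (2 * (ν / (ω - 2))) = 2 * ν := by
  obtain ⟨h1, -, h3⟩ := h
  have h4 : 0 < ω - 2 := by linarith
  have h5 : (ω - 1) * ν / (ω - 2) = ν / (ω - 2) + ν := by field_simp; ring
  refine ⟨by positivity, h5, h5 ▸ h3, ?_⟩
  field_simp

/-- The amplitude in terms of `α`. -/
theorem instantonAmplitude_eq {ν l ξ ω : ℝ} (hν : 0 < ν) (h : InstantonCondition d ν ξ ω) :
    instantonAmplitude d ν l ξ ω = (2 * l ^ (2 * ν - 1) * Real.Gamma (1 - ν) *
      Real.Gamma ((d : ℝ) / 2 - ν / (ω - 2)) * Real.Gamma (ν / (ω - 2) + ν)) /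
      (ω * (-ξ) * Real.Gamma ν * Real.Gamma (ν / (ω - 2)) *
        Real.Gamma ((d : ℝ) / 2 - (ν / (ω - 2) + ν))) := by
  rw [instantonAmplitude, (h.params hν).2.1, abs_of_neg h.2.1]

theorem instantonAmplitude_pos {ν l ξ ω : ℝ} (hν : 0 < ν) (hν1 : ν < 1) (hl : 0 < l)
    (h : InstantonCondition d ν ξ ω) : 0 < instantonAmplitude d ν l ξ ω := by
  obtain ⟨h1, -, h3, -⟩ := h.params hν
  have := h.1
  have := h.2.1
  have := Real.Gamma_pos_of_pos hν
  have := Real.Gamma_pos_of_pos h1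
  have := Real.Gamma_pos_of_pos (add_pos h1 hν)
  have := Real.Gamma_pos_of_pos (sub_pos.2 h3)
  have := Real.Gamma_pos_of_pos (sub_pos.2 hν1)
  have := Real.Gamma_pos_of_pos (show 0 < (d : ℝ) / 2 - ν / (ω - 2) by linarith)
  have : 0 < ω := by linarith
  have : 0 < -ξ := by linarith
  rw [instantonAmplitude_eq hν h]
  positivity

theorem exists_isInstanton_iff {ν l ξ ω : ℝ} (hν : 0 < ν) (hν1 : ν < 1) (hl : 0 < l) :
    (∃ b c : ℝ, 0 < b ∧ 0 < c ∧ IsInstanton d ν l ξ ω b c) ↔ InstantonCondition d ν ξ ω := by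
  constructor
  · rintro ⟨b, c, -, -, h⟩
    exact h.1
  · intro h
    have hA := instantonAmplitude_pos hν hν1 hl h
    have h2 : 0 < ω - 2 := by linarith [h.1]
    refine ⟨instantonAmplitude d ν l ξ ω ^ (ω - 2)⁻¹, 2 * ν / (ω - 2), by positivity, by positivity,
      h, rfl, ?_⟩
    rw [← Real.rpow_mul hA.le, inv_mul_cancel₀ h2.ne', Real.rpow_one]

theorem IsInstanton.two_mul_alpha {ν l ξ ω b c : ℝ} (h : IsInstanton d ν l ξ ω b c) :
    c = 2 * (ν / (ω - 2)) := by
  rw [h.2.1]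
  ring

/-- This is the coefficient of b‖x‖^(-c) in the integral equation: the integral term cancels the
profile exactly when b^(ω-2) has the prescribed value. Both directions of the equivalence use it. -/
theorem riesz_mul_amplitude {ν l ξ ω : ℝ} (hν : 0 < ν) (hν1 : ν < 1) (hl : 0 < l)
    (h : InstantonCondition d ν ξ ω) :
    Real.Gamma ((d : ℝ) / 2 - ν) /
        (2 * Real.pi ^ ((d : ℝ) / 2) * l ^ (2 * ν - 1) * Real.Gamma (1 - ν)) *
      (ξ * ω * rieszConst d (2 * (ν / (ω - 2)) + 2 * ν) ((d : ℝ) - 2 * ν)) *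
      instantonAmplitude d ν l ξ ω = -1 := by
  obtain ⟨h1, -, h3, -⟩ := h.params hν
  have h4 : 0 < ω := by linarith [h.1]
  have h5 : 0 < -ξ := by linarith [h.2.1]
  have h6 : ξ ≠ 0 := by linarith
  rw [instantonAmplitude_eq hν h, rieszConst]
  generalize ν / (ω - 2) = α at *
  rw [show ((d : ℝ) - (2 * α + 2 * ν)) / 2 = (d : ℝ) / 2 - (α + ν) by ring,
    show ((d : ℝ) - ((d : ℝ) - 2 * ν)) / 2 = ν by ring,
    show (2 * α + 2 * ν + ((d : ℝ) - 2 * ν) - d) / 2 = α by ring,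
    show (2 * α + 2 * ν) / 2 = α + ν by ring,
    show ((d : ℝ) - 2 * ν) / 2 = (d : ℝ) / 2 - ν by ring,
    show (d : ℝ) / 2 - (α + ν) + ν = (d : ℝ) / 2 - α by ring]
  have := Real.Gamma_pos_of_pos hν
  have := Real.Gamma_pos_of_pos h1
  have := Real.Gamma_pos_of_pos (add_pos h1 hν)
  have := Real.Gamma_pos_of_pos (sub_pos.2 h3)
  have := Real.Gamma_pos_of_pos (sub_pos.2 hν1)
  have := Real.Gamma_pos_of_pos (show 0 < (d : ℝ) / 2 - α by linarith)
  have := Real.Gamma_pos_of_pos (show 0 < (d : ℝ) / 2 - ν by linarith)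
  generalize Real.Gamma ((d : ℝ) / 2 - ν) = g₁ at *
  generalize Real.Gamma ((d : ℝ) / 2 - α) = g₂ at *
  generalize Real.Gamma ((d : ℝ) / 2 - (α + ν)) = g₃ at *
  field_simp

/-- The equality is only almost everywhere: at y = 0 the profile can be the default value of a
division by zero, while the formula for f' needs a positive argument. -/
theorem ae_integrand_eq [NeZero d] {ν ξ ω b c : ℝ} (hb : 0 < b) (x : Bdry d) :
    (fun y => deriv (powPotential ξ ω) (profile b c y) / ‖x - y‖ ^ ((d : ℝ) - 2 * ν)) =ᵐ[volume]
      fun y => (ξ * ω * b ^ (ω - 1)) *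
        (‖y‖ ^ (-(c * (ω - 1))) * ‖x - y‖ ^ (-((d : ℝ) - 2 * ν))) := by
  filter_upwards [ae_ne_point (0 : Bdry d)] with y hy
  rw [deriv_powPotential_profile hb hy, Real.rpow_neg (norm_nonneg (x - y)), div_eq_mul_inv,
    mul_assoc]

theorem eq_of_two_rpow_eq {p q : ℝ} (h : (2 : ℝ) ^ p = 2 ^ q) : p = q :=
  Real.rpow_right_inj two_pos (by norm_num) |>.1 h

/-- The power profiles that solve the gap equation in integral form. -/
theorem solvesIntegralGapEquation_iff [NeZero d] {ν l ξ ω b c : ℝ} (hν : 0 < ν) (hν1 : ν < 1)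
    (hl : 0 < l) (hb : 0 < b) :
    SolvesIntegralGapEquation (d := d) ν l (powPotential ξ ω) (profile b c) ↔
      IsInstanton d ν l ξ ω b c := by
  have hbω : b ^ (ω - 1) = b ^ (ω - 2) * b := by
    rw [← Real.rpow_add_one hb.ne']
    ring_nf
  constructor
  · intro h
    obtain ⟨e, he⟩ := exists_norm_eq_one (d := d)
    have he0 : e ≠ 0 := norm_pos_iff.1 (by rw [he]; exact one_pos)
    -- If this coefficient vanished, so would the integral, and the equation at a unit vector would
    -- read b = 0.
    have hk : ξ * ω * b ^ (ω - 1) ≠ 0 := by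
      intro hk
      have h1 := (h e he0).2
      rw [integral_congr_ae (ae_integrand_eq hb e), hk] at h1
      simp only [zero_mul, integral_zero, mul_zero, add_zero] at h1
      rw [profile_eq, he, Real.one_rpow] at h1
      linarith
    have hint := (h e he0).1
    rw [integrable_congr (ae_integrand_eq hb e),
      integrable_const_mul_iff (isUnit_iff_ne_zero.2 hk)] at hint
    obtain ⟨had, hda⟩ := exponents_of_integrable_riesz he0 hint
    set a := c * (ω - 1) with ha
    -- `had` and `hda` say 2ν < a < d. In particular d - 2ν > 0, which is not assumed but derived
    -- from convergence; `integral_riesz` and the sign of Γ(d/2 - ν) depend on it.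
    have hR : ∀ x : Bdry d, x ≠ 0 → b * ‖x‖ ^ (-c) + Real.Gamma ((d : ℝ) / 2 - ν) /
        (2 * Real.pi ^ ((d : ℝ) / 2) * l ^ (2 * ν - 1) * Real.Gamma (1 - ν)) *
        (ξ * ω * b ^ (ω - 1) * (rieszConst d a ((d : ℝ) - 2 * ν) * ‖x‖ ^ (2 * ν - a))) = 0 := by
      intro x hx
      have h1 := (h x hx).2
      rw [integral_congr_ae (ae_integrand_eq hb x), integral_const_mul,
        (integral_riesz (by linarith) (by linarith) had (by linarith) (by linarith) hx).2,
        profile_eq, show (d : ℝ) - a - ((d : ℝ) - 2 * ν) = 2 * ν - a by ring] at h1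
      exact h1
    -- The radii 1 and 2 suffice to identify the exponents on the two sides.
    have h1 := hR e he0
    have h2 := hR ((2 : ℝ) • e) (smul_ne_zero two_ne_zero he0)
    rw [norm_smul, he, Real.norm_of_nonneg zero_le_two, mul_one] at h2
    rw [he, Real.one_rpow, Real.one_rpow, mul_one, mul_one] at h1
    set G := Real.Gamma ((d : ℝ) / 2 - ν) /
        (2 * Real.pi ^ ((d : ℝ) / 2) * l ^ (2 * ν - 1) * Real.Gamma (1 - ν)) with hG
    set R := rieszConst d a ((d : ℝ) - 2 * ν) with hRdef
    have hGpos : 0 < G := by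
      have := Real.Gamma_pos_of_pos (sub_pos.2 hν1)
      have := Real.Gamma_pos_of_pos (show 0 < (d : ℝ) / 2 - ν by linarith)
      positivity
    have hRpos : 0 < R := rieszConst_pos (by linarith) (by linarith) had (by linarith) (by linarith)
    have h3 : (2 : ℝ) ^ (-c) = 2 ^ (2 * ν - a) := by
      have h4 : b * ((2 : ℝ) ^ (-c) - 2 ^ (2 * ν - a)) = 0 := by linear_combination h2 - 2 ^ (2 * ν - a) * h1
      rcases mul_eq_zero.1 h4 with h5 | h5
      · exact absurd h5 hb.ne'
      · linarith
    have h4 := eq_of_two_rpow_eq h3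
    have hc0 : 0 < c := by linarith
    have hcω : c * (ω - 2) = 2 * ν := by rw [ha] at h4; linarith
    have hω2 : 0 < ω - 2 := by
      by_contra hneg
      have := mul_nonpos_of_nonneg_of_nonpos hc0.le (not_lt.1 hneg)
      linarith
    have hc : c = 2 * ν / (ω - 2) := by
      rw [← hcω]
      field_simp
    -- For ξ ≥ 0 the integral term would be nonnegative and could not cancel the positive profile.
    have hξ : ξ < 0 := by
      by_contra hneg
      have h0 : 0 ≤ ξ := not_lt.1 hneg
      have h0' : 0 < ω := by linarith
      have : 0 ≤ G * (ξ * ω * b ^ (ω - 1) * R) := by positivity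
      linarith
    have hα : c = 2 * (ν / (ω - 2)) := by rw [hc]; ring
    have hcond : InstantonCondition d ν ξ ω := by
      refine ⟨by linarith, hξ, ?_⟩
      have : (ω - 1) * ν / (ω - 2) = a / 2 := by
        rw [ha, hc]
        field_simp
      linarith
    refine ⟨hcond, hc, ?_⟩
    have h5 := riesz_mul_amplitude hν hν1 hl hcond
    rw [show 2 * (ν / (ω - 2)) + 2 * ν = a by linarith, ← hG, ← hRdef] at h5
    have h6 : G * (ξ * ω * R) * b ^ (ω - 2) = -1 := by
      rw [hbω] at h1
      have h7 : b * (1 + G * (ξ * ω * R) * b ^ (ω - 2)) = 0 := by linear_combination h1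
      rcases mul_eq_zero.1 h7 with h8 | h8
      · exact absurd h8 hb.ne'
      · linarith
    have h7 : G * (ξ * ω * R) ≠ 0 := by
      intro h0
      rw [h0, zero_mul] at h6
      linarith
    exact mul_left_cancel₀ h7 (h6.trans h5.symm)
  · intro h x hx
    obtain ⟨h1, h2, h3, h4⟩ := h.1.params hν
    have hc := h.two_mul_alpha
    have ha : c * (ω - 1) = 2 * (ν / (ω - 2)) + 2 * ν := by
      rw [hc]
      linear_combination h4
    obtain ⟨hi, hv⟩ := integral_riesz (d := d) (a := c * (ω - 1)) (b := (d : ℝ) - 2 * ν)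
      (by linarith) (by linarith) (by linarith) (by linarith) (by linarith) hx
    refine ⟨?_, ?_⟩
    · rw [integrable_congr (ae_integrand_eq hb x)]
      exact hi.const_mul _
    · have h5 := riesz_mul_amplitude hν hν1 hl h.1
      rw [integral_congr_ae (ae_integrand_eq hb x), integral_const_mul, hv, profile_eq, hbω, h.2.2, ha,
        show (d : ℝ) - (2 * (ν / (ω - 2)) + 2 * ν) - ((d : ℝ) - 2 * ν) = -c by rw [hc]; ring]
      linear_combination b * ‖x‖ ^ (-c) * h5

/-! ### Pairing with a superposition -/

/-- Fubini for a function `κ` that is a superposition of nonnegative kernels. -/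
theorem integral_mixture {X T : Type*} [MeasurableSpace X] [MeasurableSpace T] {μ : Measure X}
    {τ : Measure T} [SFinite μ] [SFinite τ] {k : X → T → ℝ} {κ : X → ℝ} {h : X → ℂ}
    (hk : Measurable (Function.uncurry k)) (hk0 : ∀ᵐ x ∂μ, ∀ᵐ t ∂τ, 0 ≤ k x t)
    (hint : ∀ᵐ x ∂μ, Integrable (k x) τ ∧ ∫ t, k x t ∂τ = κ x) (hh : AEStronglyMeasurable h μ)
    (hκ : Integrable (fun x => (κ x : ℂ) * h x) μ) :
    Integrable (Function.uncurry fun x t => (k x t : ℂ) * h x) (μ.prod τ) ∧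
    ∫ x, (κ x : ℂ) * h x ∂μ = ∫ t, ∫ x, (k x t : ℂ) * h x ∂μ ∂τ := by
  have hI : Integrable (Function.uncurry fun x t => (k x t : ℂ) * h x) (μ.prod τ) := by
    have hm : AEStronglyMeasurable (Function.uncurry fun x t => (k x t : ℂ) * h x) (μ.prod τ) := by
      simp only [Function.uncurry_def]
      have e1 : AEStronglyMeasurable (fun z : X × T => ((k z.1 z.2 : ℝ) : ℂ)) (μ.prod τ) :=
        (Complex.measurable_ofReal.comp hk).aestronglyMeasurable
      exact e1.mul hh.comp_fst
    rw [integrable_prod_iff hm]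
    constructor
    · filter_upwards [hint] with x hx
      exact (hx.1.ofReal (𝕜 := ℂ)).mul_const (h x)
    · refine hκ.norm.congr ?_
      filter_upwards [hint, hk0] with x hx hx0
      have h1 : ∀ᵐ t ∂τ, ‖Function.uncurry (fun x t => (k x t : ℂ) * h x) (x, t)‖ =
          k x t * ‖h x‖ := by
        filter_upwards [hx0] with t ht
        simp [abs_of_nonneg ht]
      have h2 : 0 ≤ κ x := hx.2 ▸ integral_nonneg_of_ae hx0
      rw [integral_congr_ae h1, integral_mul_const, hx.2]
      simp [abs_of_nonneg h2]
  refine ⟨hI, ?_⟩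
  rw [← integral_integral_swap hI]
  refine integral_congr_ae ?_
  filter_upwards [hint] with x hx
  rw [integral_mul_const, integral_complex_ofReal, hx.2]

/-! ### The Fourier transform -/

theorem norm_exp_I_mul (t : ℝ) : ‖Complex.exp (Complex.I * (t : ℂ))‖ = 1 := by
  rw [mul_comm, Complex.norm_exp_ofReal_mul_I]

theorem norm_exp_neg_I_mul (t : ℝ) : ‖Complex.exp (-(Complex.I * (t : ℂ)))‖ = 1 := by
  have := norm_exp_I_mul (-t)
  push_cast at this
  rwa [mul_neg] at this

theorem integrable_exp_mul {g : Bdry d → ℂ} (hg : Integrable g) (x : Bdry d) :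
    Integrable fun p => Complex.exp (-(Complex.I * ((inner ℝ x p : ℝ) : ℂ))) * g p := by
  refine hg.norm.mono' ((Continuous.aestronglyMeasurable (by fun_prop)).mul
    hg.aestronglyMeasurable) (Eventually.of_forall fun p => ?_)
  rw [norm_mul, norm_exp_neg_I_mul, one_mul]

theorem continuous_fourierT {g : Bdry d → ℂ} (hg : Integrable g) : Continuous (fourierT g) := by
  refine continuous_of_dominated (bound := fun p => ‖g p‖)
    (fun x => (integrable_exp_mul hg x).aestronglyMeasurable) (fun x => ?_) hg.norm ?_
  · refine Eventually.of_forall fun p => ?_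
    rw [norm_mul, norm_exp_neg_I_mul, one_mul]
  · exact Eventually.of_forall fun p => by fun_prop

theorem norm_fourierT_le (g : Bdry d → ℂ) (x : Bdry d) : ‖fourierT g x‖ ≤ ∫ p, ‖g p‖ := by
  refine (norm_integral_le_integral_norm _).trans_eq (integral_congr_ae ?_)
  exact Eventually.of_forall fun p => by
    simp only [norm_mul, norm_exp_neg_I_mul, one_mul]

/-- Pairing a Fourier transform with a Gaussian. -/
theorem integral_gaussian_mul_fourierT {g : Bdry d → ℂ} (hg : Integrable g) {t : ℝ} (ht : 0 < t) :
    ∫ x, ((Real.exp (-(t * ‖x‖ ^ 2)) : ℝ) : ℂ) * fourierT g x =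
      ∫ p, (((Real.pi / t) ^ ((d : ℝ) / 2) * Real.exp (-(‖p‖ ^ 2 / (4 * t))) : ℝ) : ℂ) * g p := by
  have hI : Integrable (Function.uncurry fun (x p : Bdry d) =>
      ((Real.exp (-(t * ‖x‖ ^ 2)) : ℝ) : ℂ) *
        (Complex.exp (-(Complex.I * ((inner ℝ x p : ℝ) : ℂ))) * g p)) (volume.prod volume) := by
    have h1 := (integrable_gaussian (d := d) ht).ofReal (𝕜 := ℂ) |>.mul_prod hg
    refine h1.norm.mono' ?_ (Eventually.of_forall fun z => ?_)
    · simp only [Function.uncurry_def]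
      exact (Continuous.aestronglyMeasurable (by fun_prop)).mul
        ((Continuous.aestronglyMeasurable (by fun_prop)).mul hg.aestronglyMeasurable.comp_snd)
    · simp only [Function.uncurry_def, norm_mul, norm_exp_neg_I_mul, one_mul, le_refl,
        RCLike.norm_ofReal, Complex.norm_real, Real.norm_eq_abs]
  simp only [fourierT, ← integral_const_mul]
  rw [integral_integral_swap hI]
  refine integral_congr_ae (Eventually.of_forall fun p => ?_)
  simp only
  rw [← integral_gaussian_mul_exp_inner ht p |>.trans rfl, ← integral_mul_const]
  -- `fourierT` carries e^(-i x·p), the Gaussian formula e^(+i x·p); the formula at -p matches them,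
  -- the norm being even.
  have h2 := integral_gaussian_mul_exp_inner ht (-p)
  rw [norm_neg] at h2
  rw [integral_mul_const, integral_gaussian_mul_exp_inner ht p, ← h2, ← integral_mul_const]
  refine integral_congr_ae (Eventually.of_forall fun x => ?_)
  simp only [inner_neg_right, Complex.ofReal_neg, mul_neg, mul_assoc]

/-- The constant in the Fourier transform of `|x|^{-c}`. -/
def rieszFourierConst (d : ℕ) (c : ℝ) : ℝ :=
  Real.pi ^ ((d : ℝ) / 2) * 2 ^ ((d : ℝ) - c) * Real.Gamma (((d : ℝ) - c) / 2) / Real.Gamma (c / 2)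

theorem rieszFourierConst_pos {c : ℝ} (hc : 0 < c) (hcd : c < d) : 0 < rieszFourierConst d c := by
  have := Real.Gamma_pos_of_pos (half_pos hc)
  have := Real.Gamma_pos_of_pos (half_pos (sub_pos.2 hcd))
  unfold rieszFourierConst
  positivity

/-- The Fourier transform of `|x|^{-c}` is a multiple of `|p|^{c-d}`. -/
theorem integral_norm_rpow_mul_fourierT [NeZero d] {c : ℝ} (hc : 0 < c) (hcd : c < d)
    {g : Bdry d → ℂ} (hg : Integrable g)
    (h1 : Integrable fun p : Bdry d => ((‖p‖ ^ (c - d) : ℝ) : ℂ) * g p)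
    (h2 : Integrable fun x : Bdry d => ((‖x‖ ^ (-c) : ℝ) : ℂ) * fourierT g x) :
    ∫ x : Bdry d, ((‖x‖ ^ (-c) : ℝ) : ℂ) * fourierT g x =
      (rieszFourierConst d c : ℂ) * ∫ p : Bdry d, ((‖p‖ ^ (c - d) : ℝ) : ℂ) * g p := by
  have hcd' : 0 < ((d : ℝ) - c) / 2 := half_pos (sub_pos.2 hcd)
  have hGc := Real.Gamma_pos_of_pos (half_pos hc)
  have hGd := Real.Gamma_pos_of_pos hcd'
  -- ‖x‖^(-c) as a superposition of the Gaussians exp(-t‖x‖²) with weight t^(c/2-1).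
  have hA := (integral_mixture (μ := (volume : Measure (Bdry d)))
    (τ := (volume : Measure ℝ).restrict (Ioi 0))
    (k := fun x t => t ^ (c / 2 - 1) * Real.exp (-(‖x‖ ^ 2 * t)))
    (κ := fun x => Real.Gamma (c / 2) * ‖x‖ ^ (-c)) (h := fourierT g) (by fun_prop)
    (Eventually.of_forall fun x => by
      filter_upwards [ae_restrict_mem measurableSet_Ioi] with t ht
      have : (0 : ℝ) < t := ht
      positivity)
    (by
      filter_upwards [ae_ne_point (0 : Bdry d)] with x hx
      have hX : 0 < ‖x‖ := norm_pos_iff.2 hx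
      refine ⟨integrableOn_rpow_mul_exp (half_pos hc) (by positivity), ?_⟩
      rw [integral_rpow_mul_exp (half_pos hc) (by positivity), sq_rpow_neg_half hX.le])
    (continuous_fourierT hg).aestronglyMeasurable
    (by
      refine (h2.const_mul (Real.Gamma (c / 2) : ℂ)).congr (Eventually.of_forall fun x => ?_)
      push_cast
      ring)).2
  -- ‖p‖^(c-d) as the superposition of the transforms of the same Gaussians: their factor t^(-d/2)
  -- turns the weight into t^(-(d-c)/2-1), so the two pairings agree for each t.
  have hB := (integral_mixture (μ := (volume : Measure (Bdry d)))
    (τ := (volume : Measure ℝ).restrict (Ioi 0))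
    (k := fun p t => Real.pi ^ ((d : ℝ) / 2) *
      (t ^ (-(((d : ℝ) - c) / 2) - 1) * Real.exp (-(‖p‖ ^ 2 / 4 / t))))
    (κ := fun p => Real.pi ^ ((d : ℝ) / 2) *
      (Real.Gamma (((d : ℝ) - c) / 2) * (2 ^ ((d : ℝ) - c) * ‖p‖ ^ (c - d)))) (h := g) (by fun_prop)
    (Eventually.of_forall fun x => by
      filter_upwards [ae_restrict_mem measurableSet_Ioi] with t ht
      have : (0 : ℝ) < t := ht
      positivity)
    (by
      filter_upwards [ae_ne_point (0 : Bdry d)] with x hx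
      have hX : 0 < ‖x‖ := norm_pos_iff.2 hx
      refine ⟨(integrableOn_rpow_mul_exp_inv hcd' (by positivity)).const_mul _, ?_⟩
      rw [integral_const_mul, integral_rpow_mul_exp_inv hcd' (by positivity),
        show ‖x‖ ^ 2 / 4 = (‖x‖ / 2) ^ 2 by ring, sq_rpow_neg_half (by positivity),
        Real.div_rpow hX.le zero_le_two, neg_sub, ← neg_sub (d : ℝ) c,
        Real.rpow_neg zero_le_two, div_inv_eq_mul, mul_comm (‖x‖ ^ _)])
    hg.aestronglyMeasurable
    (by
      refine (h1.const_mul ((Real.pi ^ ((d : ℝ) / 2) *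
        (Real.Gamma (((d : ℝ) - c) / 2) * 2 ^ ((d : ℝ) - c)) : ℝ) : ℂ)).congr
        (Eventually.of_forall fun x => ?_)
      push_cast
      ring)).2
  have hAB : ∫ x, ((Real.Gamma (c / 2) * ‖x‖ ^ (-c) : ℝ) : ℂ) * fourierT g x =
      ∫ p, ((Real.pi ^ ((d : ℝ) / 2) *
      (Real.Gamma (((d : ℝ) - c) / 2) * (2 ^ ((d : ℝ) - c) * ‖p‖ ^ (c - d))) : ℝ) : ℂ) * g p := by
    rw [hA, hB]
    refine setIntegral_congr_fun measurableSet_Ioi fun t ht => ?_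
    have ht' : (0 : ℝ) < t := ht
    have h3 := integral_gaussian_mul_fourierT hg ht'
    have h4 := congrArg (fun z => ((t ^ (c / 2 - 1) : ℝ) : ℂ) * z) h3
    simp only [← integral_const_mul] at h4
    refine (integral_congr_ae (Eventually.of_forall fun x => ?_)).trans
      (h4.trans (integral_congr_ae (Eventually.of_forall fun p => ?_)))
    · simp only [mul_comm (‖x‖ ^ 2)]
      push_cast
      ring
    · simp only
      rw [← mul_assoc, ← Complex.ofReal_mul, Real.div_rpow Real.pi_pos.le ht'.le,
        show -(((d : ℝ) - c) / 2) - 1 = (c / 2 - 1) - (d : ℝ) / 2 by ring,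
        Real.rpow_sub ht' (c / 2 - 1),
        show ‖p‖ ^ 2 / 4 / t = ‖p‖ ^ 2 / (4 * t) by rw [div_div]]
      congr 2
      ring
  have hL : ∫ x : Bdry d, ((Real.Gamma (c / 2) * ‖x‖ ^ (-c) : ℝ) : ℂ) * fourierT g x =
      (Real.Gamma (c / 2) : ℂ) * ∫ x : Bdry d, ((‖x‖ ^ (-c) : ℝ) : ℂ) * fourierT g x := by
    rw [← integral_const_mul]
    refine integral_congr_ae (Eventually.of_forall fun x => ?_)
    push_cast
    ring
  have hR : ∫ p : Bdry d, ((Real.pi ^ ((d : ℝ) / 2) *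
      (Real.Gamma (((d : ℝ) - c) / 2) * (2 ^ ((d : ℝ) - c) * ‖p‖ ^ (c - d))) : ℝ) : ℂ) * g p =
      ((Real.Gamma (c / 2) * rieszFourierConst d c : ℝ) : ℂ) *
        ∫ p : Bdry d, ((‖p‖ ^ (c - d) : ℝ) : ℂ) * g p := by
    rw [← integral_const_mul]
    refine integral_congr_ae (Eventually.of_forall fun p => ?_)
    have h5 : Real.pi ^ ((d : ℝ) / 2) *
        (Real.Gamma (((d : ℝ) - c) / 2) * (2 ^ ((d : ℝ) - c) * ‖p‖ ^ (c - d))) =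
        Real.Gamma (c / 2) * rieszFourierConst d c * ‖p‖ ^ (c - d) := by
      rw [rieszFourierConst]
      field_simp
    simp only [h5]
    push_cast
    ring
  rw [hL, hR] at hAB
  refine mul_left_cancel₀ (Complex.ofReal_ne_zero.2 hGc.ne') (hAB.trans ?_)
  push_cast
  ring

/-! ### Schwartz functions -/

/-- The unit ball is controlled by the bound on h and c < d, the complement by ‖x‖^k, which
dominates ‖x‖^(-c) there. For c ≥ 0 the value k = 0 is enough, so h need only be bounded and
integrable; negative c requires decay. -/
theorem integrable_norm_rpow_mul [NeZero d] {c M : ℝ} (hcd : c < d) {k : ℕ} (hk : -c ≤ k)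
    {h : Bdry d → ℂ} (hm : AEStronglyMeasurable h volume) (hM : ∀ x, ‖h x‖ ≤ M)
    (hi : Integrable fun x => ‖x‖ ^ k * ‖h x‖) :
    Integrable fun x : Bdry d => ((‖x‖ ^ (-c) : ℝ) : ℂ) * h x := by
  have hms : AEStronglyMeasurable (fun x : Bdry d => ((‖x‖ ^ (-c) : ℝ) : ℂ) * h x) volume :=
    (Measurable.aestronglyMeasurable (by fun_prop)).mul hm
  rw [← integrableOn_univ, ← union_compl_self (Metric.ball (0 : Bdry d) 1), integrableOn_union]
  constructor
  · refine Integrable.mono' (((integrableOn_ball_norm_rpow one_pos).2 hcd).mul_const M)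
      hms.restrict (Eventually.of_forall fun x => ?_)
    rw [norm_mul, Complex.norm_real, Real.norm_of_nonneg (by positivity)]
    exact mul_le_mul_of_nonneg_left (hM x) (by positivity)
  · refine Integrable.mono' hi.integrableOn hms.restrict ?_
    filter_upwards [ae_restrict_mem Metric.isOpen_ball.measurableSet.compl] with x hx
    rw [mem_compl_iff, mem_ball_zero_iff, not_lt] at hx
    rw [norm_mul, Complex.norm_real, Real.norm_of_nonneg (by positivity), ← Real.rpow_natCast]
    exact mul_le_mul_of_nonneg_right (Real.rpow_le_rpow_of_exponent_le hx hk) (norm_nonneg _)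

theorem exists_norm_le_schwartz (ψ : 𝓢(Bdry d, ℂ)) : ∃ M, ∀ x, ‖ψ x‖ ≤ M :=
  ⟨SchwartzMap.seminorm ℝ 0 0 ψ, fun x => by
    have := SchwartzMap.norm_pow_mul_le_seminorm ℝ ψ 0 x
    simpa using this⟩

theorem integrable_norm_rpow_mul_schwartz [NeZero d] {c : ℝ} (hcd : c < d) (ψ : 𝓢(Bdry d, ℂ)) :
    Integrable fun x : Bdry d => ((‖x‖ ^ (-c) : ℝ) : ℂ) * ψ x := by
  obtain ⟨M, hM⟩ := exists_norm_le_schwartz ψ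
  exact integrable_norm_rpow_mul hcd (Nat.le_ceil (-c)) ψ.continuous.aestronglyMeasurable hM
    (ψ.integrable_pow_mul volume _)

/-- Scaling of Schwartz functions. -/
def scaleS (c : ℝ) (hc : c ≠ 0) (ψ : 𝓢(Bdry d, ℂ)) : 𝓢(Bdry d, ℂ) :=
  SchwartzMap.compCLMOfContinuousLinearEquiv ℂ
    (ContinuousLinearEquiv.smulLeft (R₁ := ℝ) (M₁ := Bdry d) (Units.mk0 c hc)) ψ

theorem scaleS_apply (c : ℝ) (hc : c ≠ 0) (ψ : 𝓢(Bdry d, ℂ)) (x : Bdry d) :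
    scaleS c hc ψ x = ψ (c • x) := rfl

open scoped FourierTransform

/-- Passing to the convention with 2π in the exponent makes Schwartz invariance and Fourier
inversion available for `fourierT`. -/
theorem fourierT_eq_fourier (ψ : 𝓢(Bdry d, ℂ)) (p : Bdry d) :
    fourierT ψ p = 𝓕 ψ ((2 * Real.pi)⁻¹ • p) := by
  rw [SchwartzMap.fourier_coe, Real.fourier_eq']
  refine integral_congr_ae (Eventually.of_forall fun x => ?_)
  simp only [smul_eq_mul, inner_smul_right]
  congr 2
  rw [real_inner_comm]
  have : (Real.pi : ℂ) ≠ 0 := Complex.ofReal_ne_zero.2 Real.pi_ne_zero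
  push_cast
  field_simp

theorem two_pi_inv_ne_zero : (2 * Real.pi)⁻¹ ≠ 0 := by positivity

/-- The Fourier transform of a Schwartz function as a Schwartz function. -/
def fourierS (ψ : 𝓢(Bdry d, ℂ)) : 𝓢(Bdry d, ℂ) := scaleS (2 * Real.pi)⁻¹ two_pi_inv_ne_zero (𝓕 ψ)

theorem coe_fourierS (ψ : 𝓢(Bdry d, ℂ)) : (fourierS ψ : Bdry d → ℂ) = fourierT ψ :=
  funext fun p => (fourierT_eq_fourier ψ p).symm

/-- The inverse Fourier transform. -/
def invFourierS (χ : 𝓢(Bdry d, ℂ)) : 𝓢(Bdry d, ℂ) :=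
  𝓕⁻ (scaleS (2 * Real.pi) (by positivity) χ)

theorem fourierS_invFourierS (χ : 𝓢(Bdry d, ℂ)) : fourierS (invFourierS χ) = χ := by
  ext p
  rw [fourierS, invFourierS, scaleS_apply, FourierTransform.fourier_fourierInv_eq, scaleS_apply,
    smul_smul, mul_inv_cancel₀ (by positivity), one_smul]

theorem integral_exp_inner_mul (χ : 𝓢(Bdry d, ℂ)) (x : Bdry d) :
    ∫ p, χ p * Complex.exp (Complex.I * ((inner ℝ p x : ℝ) : ℂ)) =
      (((2 * Real.pi) ^ d : ℝ) : ℂ) * invFourierS χ x := by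
  have h1 := Measure.integral_comp_smul_of_nonneg volume (fun p : Bdry d =>
    χ p * Complex.exp (Complex.I * ((inner ℝ p x : ℝ) : ℂ))) (2 * Real.pi) (hR := by positivity)
  rw [finrank_euclideanSpace_fin, Complex.real_smul] at h1
  have h2 : invFourierS χ x = ∫ p : Bdry d, χ ((2 * Real.pi) • p) *
      Complex.exp (Complex.I * ((inner ℝ ((2 * Real.pi) • p) x : ℝ) : ℂ)) := by
    rw [invFourierS, SchwartzMap.fourierInv_coe, Real.fourierInv_eq']
    refine integral_congr_ae (Eventually.of_forall fun p => ?_)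
    simp only [smul_eq_mul, inner_smul_left, scaleS_apply, mul_comm Complex.I]
    rw [mul_comm]
    simp
  rw [h2, h1, ← mul_assoc, ← Complex.ofReal_mul, mul_inv_cancel₀ (by positivity)]
  simp

theorem invFourierS_fourierS (ψ : 𝓢(Bdry d, ℂ)) : invFourierS (fourierS ψ) = ψ := by
  have h : scaleS (2 * Real.pi) (by positivity) (fourierS ψ) = 𝓕 ψ := by
    ext p
    rw [scaleS_apply, fourierS, scaleS_apply, smul_smul, inv_mul_cancel₀ (by positivity), one_smul]
  rw [invFourierS, h, FourierTransform.fourierInv_fourier_eq]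

/-- The Fourier transform of a power profile. -/
theorem isFourierTransform_profile [NeZero d] {b c : ℝ} (hc : 0 < c) (hcd : c < d) :
    IsFourierTransform (d := d) (profile b c)
      fun p => ((b * rieszFourierConst d c * ‖p‖ ^ (c - d) : ℝ) : ℂ) := by
  intro ψ
  have h1 : Integrable fun p : Bdry d => ((‖p‖ ^ (c - d) : ℝ) : ℂ) * ψ p := by
    have := integrable_norm_rpow_mul_schwartz (c := d - c) (by linarith) ψ
    rwa [neg_sub] at this
  have h2 := integrable_norm_rpow_mul_schwartz hcd (fourierS ψ)
  rw [coe_fourierS] at h2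
  have e1 : (fun p : Bdry d => ((b * rieszFourierConst d c * ‖p‖ ^ (c - d) : ℝ) : ℂ) * ψ p) =
      fun p => ((b * rieszFourierConst d c : ℝ) : ℂ) * (((‖p‖ ^ (c - d) : ℝ) : ℂ) * ψ p) := by
    ext p
    push_cast
    ring
  have e2 : (fun x : Bdry d => (profile b c x : ℂ) * fourierT ψ x) =
      fun x => (b : ℂ) * (((‖x‖ ^ (-c) : ℝ) : ℂ) * fourierT ψ x) := by
    ext x
    rw [profile_eq]
    push_cast
    ring
  rw [e1, e2]
  refine ⟨h1.const_mul _, h2.const_mul _, ?_⟩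
  rw [integral_const_mul, integral_const_mul,
    integral_norm_rpow_mul_fourierT hc hcd ψ.integrable h1 h2]
  push_cast
  ring

/-! ### Second differences of Schwartz functions -/

/-- The exponent d + 1 is the least integer for which the bound is integrable. -/
theorem exists_schwartz_decay {F : Type*} [NormedAddCommGroup F] [NormedSpace ℝ F]
    (φ : 𝓢(Bdry d, F)) : ∃ C, 0 ≤ C ∧ ∀ z, ‖φ z‖ ≤ C * (1 + ‖z‖) ^ (-((d : ℝ) + 1)) := by
  refine ⟨2 ^ (d + 1) * ((Finset.Iic (d + 1, 0)).sup fun m => SchwartzMap.seminorm ℝ m.1 m.2) φ,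
    by positivity, fun z => ?_⟩
  have h := SchwartzMap.one_add_le_sup_seminorm_apply (𝕜 := ℝ) (m := (d + 1, 0)) (le_refl (d + 1))
    (le_refl 0) φ z
  rw [norm_iteratedFDeriv_zero] at h
  rw [Real.rpow_neg (by positivity), ← div_eq_mul_inv, le_div_iff₀ (by positivity), mul_comm]
  refine le_trans (le_of_eq ?_) h
  rw [← Nat.cast_add_one, Real.rpow_natCast]

/-- The second difference `ψ(x) - (ψ(x+y) + ψ(x-y))/2`. -/
def secondDiff (ψ : Bdry d → ℂ) (x y : Bdry d) : ℂ := ψ x - (ψ (x + y) + ψ (x - y)) / 2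

/-- For h(t) = ψ(x+ty) + ψ(x-ty), the derivative is a difference of first derivatives at points
2t‖y‖ apart, applied to y, hence at most 2M‖y‖². The mean value inequality on [0,1] gives the claim,
since the second difference is -(h(1) - h(0))/2. -/
theorem norm_secondDiff_le_of_hessian {ψ : 𝓢(Bdry d, ℂ)} {M : ℝ} {x y : Bdry d} (hy : ‖y‖ ≤ 1)
    (hM : ∀ z ∈ Metric.closedBall x 1,
      ‖SchwartzMap.fderivCLM ℝ _ _ (SchwartzMap.fderivCLM ℝ _ _ ψ) z‖ ≤ M) :
    ‖secondDiff ψ x y‖ ≤ M * ‖y‖ ^ 2 := by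
  set ψ₁ := SchwartzMap.fderivCLM ℝ (Bdry d) ℂ ψ with hψ₁
  have hd0 : ∀ z, HasFDerivAt ψ (ψ₁ z) z := fun z => ψ.differentiableAt.hasFDerivAt
  have hmem : ∀ t ∈ Icc (0 : ℝ) 1, ∀ s : ℝ, |s| = 1 → x + (s * t) • y ∈ Metric.closedBall x 1 := by
    intro t ht s hs
    rw [mem_closedBall_iff_norm, add_sub_cancel_left, norm_smul, Real.norm_eq_abs, abs_mul, hs,
      one_mul, abs_of_nonneg ht.1]
    exact mul_le_one₀ ht.2 (norm_nonneg _) hy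
  set h : ℝ → ℂ := fun t => ψ (x + ((1 : ℝ) * t) • y) + ψ (x + ((-1 : ℝ) * t) • y) with hh
  have hder : ∀ t, HasDerivAt h
      (ψ₁ (x + ((1 : ℝ) * t) • y) y - ψ₁ (x + ((-1 : ℝ) * t) • y) y) t := by
    intro t
    have hl : ∀ s : ℝ, HasDerivAt (fun t : ℝ => x + (s * t) • y) (s • y) t := fun s => by
      have := (((hasDerivAt_id t).const_mul s).smul_const y).const_add x
      simpa using this
    have h1 := (hd0 (x + ((1 : ℝ) * t) • y)).comp_hasDerivAt t (hl 1)
    have h2 := (hd0 (x + ((-1 : ℝ) * t) • y)).comp_hasDerivAt t (hl (-1))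
    convert! h1.add h2 using 1
    simp [sub_eq_add_neg]
  have hbound : ∀ t ∈ Ico (0 : ℝ) 1,
      ‖ψ₁ (x + ((1 : ℝ) * t) • y) y - ψ₁ (x + ((-1 : ℝ) * t) • y) y‖ ≤ 2 * M * ‖y‖ ^ 2 := by
    intro t ht
    have ht' : t ∈ Icc (0 : ℝ) 1 := Ico_subset_Icc_self ht
    have h1 := (convex_closedBall x 1).norm_image_sub_le_of_norm_fderiv_le (𝕜 := ℝ) (f := ψ₁)
      (fun z _ => ψ₁.differentiableAt) hM (hmem t ht' (-1) (by simp)) (hmem t ht' 1 (by simp))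
    have h2 : ‖x + ((1 : ℝ) * t) • y - (x + ((-1 : ℝ) * t) • y)‖ = 2 * t * ‖y‖ := by
      rw [show x + ((1 : ℝ) * t) • y - (x + ((-1 : ℝ) * t) • y) = (2 * t) • y by module, norm_smul,
        Real.norm_of_nonneg (by linarith [ht.1])]
    rw [h2] at h1
    have hM0 : 0 ≤ M := (norm_nonneg _).trans (hM x (Metric.mem_closedBall_self zero_le_one))
    calc _ = ‖(ψ₁ (x + ((1 : ℝ) * t) • y) - ψ₁ (x + ((-1 : ℝ) * t) • y)) y‖ := by
          rw [sub_apply]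
      _ ≤ (M * (2 * t * ‖y‖)) * ‖y‖ := (ContinuousLinearMap.le_opNorm _ _).trans
          (mul_le_mul_of_nonneg_right h1 (norm_nonneg _))
      _ = (2 * M * ‖y‖ ^ 2) * t := by ring
      _ ≤ 2 * M * ‖y‖ ^ 2 := mul_le_of_le_one_right (by positivity) ht.2.le
  have hfin := norm_image_sub_le_of_norm_deriv_le_segment_01'
    (fun t _ => (hder t).hasDerivWithinAt) hbound
  have heq : secondDiff ψ x y = -(h 1 - h 0) / 2 := by
    simp only [hh, secondDiff, mul_one, mul_zero, zero_smul, add_zero, one_smul, neg_smul,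
      ← sub_eq_add_neg]
    ring
  rw [heq, norm_div, norm_neg]
  simp only [Complex.norm_ofNat]
  linarith

/-- Decay of the Hessian at z is transferred to x: ‖z - x‖ ≤ 1 gives 1 + ‖z‖ ≥ (1 + ‖x‖)/2, at the
cost of a factor 2^(d+1). -/
theorem exists_norm_secondDiff_le (ψ : 𝓢(Bdry d, ℂ)) : ∃ C, 0 ≤ C ∧ ∀ x y : Bdry d, ‖y‖ ≤ 1 →
    ‖secondDiff ψ x y‖ ≤ C * (1 + ‖x‖) ^ (-((d : ℝ) + 1)) * ‖y‖ ^ 2 := by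
  obtain ⟨C, hC, h⟩ := exists_schwartz_decay
    (SchwartzMap.fderivCLM ℝ _ _ (SchwartzMap.fderivCLM ℝ _ _ ψ))
  refine ⟨C * 2 ^ ((d : ℝ) + 1), by positivity, fun x y hy => ?_⟩
  refine norm_secondDiff_le_of_hessian hy fun z hz => (h z).trans ?_
  rw [mul_assoc]
  refine mul_le_mul_of_nonneg_left ?_ hC
  rw [mem_closedBall_iff_norm'] at hz
  have h1 : (1 + ‖x‖) / 2 ≤ 1 + ‖z‖ := by
    have := norm_sub_norm_le x z
    have := norm_nonneg z
    linarith
  calc _ ≤ ((1 + ‖x‖) / 2) ^ (-((d : ℝ) + 1)) :=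
        Real.rpow_le_rpow_of_nonpos (by positivity) h1 (by linarith [(Nat.cast_nonneg d : (0:ℝ) ≤ d)])
    _ = _ := by
        rw [Real.div_rpow (by positivity) zero_le_two, Real.rpow_neg zero_le_two, div_inv_eq_mul,
          mul_comm]

theorem integrable_decay : Integrable fun x : Bdry d => (1 + ‖x‖) ^ (-((d : ℝ) + 1)) :=
  integrable_one_add_norm (by rw [finrank_euclideanSpace_fin]; linarith)

/-- Translation invariance makes the L¹ bound uniform in y; it is used for ‖y‖ ≥ 1. -/
theorem integrable_secondDiff (ψ : 𝓢(Bdry d, ℂ)) (y : Bdry d) :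
    Integrable (fun x => secondDiff ψ x y) ∧
      ∫ x, ‖secondDiff ψ x y‖ ≤ 2 * ∫ x, ‖ψ x‖ := by
  have h0 := ψ.integrable (μ := volume)
  have h1 : Integrable (fun x => ψ (x + y)) := h0.comp_add_right y
  have h2 : Integrable (fun x => ψ (x - y)) := h0.comp_sub_right y
  have h3 : Integrable (fun x => secondDiff ψ x y) := h0.sub ((h1.add h2).div_const 2)
  have h4 : Integrable (fun x => (‖ψ (x + y)‖ + ‖ψ (x - y)‖) / 2) := (h1.norm.add h2.norm).div_const 2
  refine ⟨h3, ?_⟩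
  calc _ ≤ ∫ x, (‖ψ x‖ + (‖ψ (x + y)‖ + ‖ψ (x - y)‖) / 2) := by
        refine integral_mono h3.norm (h0.norm.add h4) fun x => ?_
        refine (norm_sub_le _ _).trans (add_le_add_right ?_ _)
        rw [norm_div, Complex.norm_ofNat]
        linarith [norm_add_le (ψ (x + y)) (ψ (x - y))]
    _ = _ := by
        rw [integral_add h0.norm h4, integral_div,
          integral_add h1.norm h2.norm, integral_add_right_eq_self (fun x => ‖ψ x‖) y,
          integral_sub_right_eq_self (fun x => ‖ψ x‖) y]
        ring

/-- Near y = 0 the second difference supplies ‖y‖², and ‖y‖^(2-d-2ν) is integrable because ν < 1;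
for large y the uniform L¹ bound and ν > 0 suffice. -/
theorem integrable_secondDiff_prod [NeZero d] (ψ : 𝓢(Bdry d, ℂ)) {ν : ℝ} (hν0 : 0 < ν)
    (hν1 : ν < 1) : Integrable (Function.uncurry fun x y : Bdry d =>
      secondDiff ψ x y * ((‖y‖ ^ (-((d : ℝ) + 2 * ν)) : ℝ) : ℂ)) (volume.prod volume) := by
  have hψ := ψ.continuous
  have hm : AEStronglyMeasurable (Function.uncurry fun x y : Bdry d =>
      secondDiff ψ x y * ((‖y‖ ^ (-((d : ℝ) + 2 * ν)) : ℝ) : ℂ)) (volume.prod volume) := by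
    simp only [Function.uncurry_def, secondDiff]
    exact (Continuous.aestronglyMeasurable (by fun_prop)).mul
      (Measurable.aestronglyMeasurable (by fun_prop))
  rw [integrable_prod_iff' hm]
  refine ⟨Eventually.of_forall fun y => (integrable_secondDiff ψ y).1.mul_const
    ((‖y‖ ^ (-((d : ℝ) + 2 * ν)) : ℝ) : ℂ), ?_⟩
  have hn : ∀ y : Bdry d, ∫ x, ‖Function.uncurry (fun x y : Bdry d =>
      secondDiff ψ x y * ((‖y‖ ^ (-((d : ℝ) + 2 * ν)) : ℝ) : ℂ)) (x, y)‖ =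
      (∫ x, ‖secondDiff ψ x y‖) * ‖y‖ ^ (-((d : ℝ) + 2 * ν)) := by
    intro y
    rw [← integral_mul_const]
    refine integral_congr_ae (Eventually.of_forall fun x => ?_)
    simp only [Function.uncurry_apply_pair, norm_mul, Complex.norm_real,
      Real.norm_of_nonneg (show 0 ≤ ‖y‖ ^ (-((d : ℝ) + 2 * ν)) by positivity)]
  have hmn := hm.norm.prod_swap.integral_prod_right'
  simp only [Prod.swap_prod_mk] at hmn
  obtain ⟨C, hC, hCb⟩ := exists_norm_secondDiff_le ψ
  set W := ∫ x : Bdry d, (1 + ‖x‖) ^ (-((d : ℝ) + 1)) with hW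
  rw [← integrableOn_univ, ← union_compl_self (Metric.ball (0 : Bdry d) 1), integrableOn_union]
  constructor
  · refine Integrable.mono' (((integrableOn_ball_norm_rpow (a := d + 2 * ν - 2) one_pos).2
      (by linarith)).const_mul (C * W)) hmn.restrict ?_
    filter_upwards [ae_restrict_mem Metric.isOpen_ball.measurableSet,
      ae_restrict_of_ae (ae_ne_point (0 : Bdry d))] with y hy hy0
    rw [mem_ball_zero_iff] at hy
    have hY : 0 < ‖y‖ := norm_pos_iff.2 hy0
    rw [hn, Real.norm_of_nonneg (mul_nonneg (integral_nonneg fun x => norm_nonneg _) (by positivity))]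
    have h1 : ∫ x, ‖secondDiff ψ x y‖ ≤ C * W * ‖y‖ ^ 2 := by
      rw [hW, ← integral_const_mul, ← integral_mul_const]
      exact integral_mono (integrable_secondDiff ψ y).1.norm
        ((integrable_decay.const_mul C).mul_const _) fun x => hCb x y hy.le
    calc _ ≤ C * W * ‖y‖ ^ 2 * ‖y‖ ^ (-((d : ℝ) + 2 * ν)) :=
          mul_le_mul_of_nonneg_right h1 (by positivity)
      _ = _ := by
          rw [mul_assoc, ← Real.rpow_natCast, ← Real.rpow_add hY]
          congr 2
          push_cast
          ring
  · refine Integrable.mono' (((integrableOn_compl_ball_norm_rpow (a := d + 2 * ν) one_pos).2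
      (by linarith)).const_mul (2 * ∫ x, ‖ψ x‖)) hmn.restrict (Eventually.of_forall fun y => ?_)
    rw [hn, Real.norm_of_nonneg (mul_nonneg (integral_nonneg fun x => norm_nonneg _) (by positivity))]
    exact mul_le_mul_of_nonneg_right (integrable_secondDiff ψ y).2 (by positivity)

/-! ### The multiplier `|p|^{2ν}` as a superposition of second differences -/

/-- The integral `∫ (1 - cos p·y) |y|^{-d-2ν} dy`. -/
def levyIntegral (ν : ℝ) (p : Bdry d) : ℝ :=
  ∫ y : Bdry d, (1 - Real.cos (inner ℝ p y)) * ‖y‖ ^ (-((d : ℝ) + 2 * ν))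

theorem one_sub_cos_nonneg (t : ℝ) : 0 ≤ 1 - Real.cos t := sub_nonneg.2 (Real.cos_le_one t)

theorem integrable_levy [NeZero d] {ν : ℝ} (hν0 : 0 < ν) (hν1 : ν < 1) (p : Bdry d) :
    Integrable fun y : Bdry d => (1 - Real.cos (inner ℝ p y)) * ‖y‖ ^ (-((d : ℝ) + 2 * ν)) := by
  have hm : AEStronglyMeasurable (fun y : Bdry d =>
      (1 - Real.cos (inner ℝ p y)) * ‖y‖ ^ (-((d : ℝ) + 2 * ν))) volume :=
    (Continuous.aestronglyMeasurable (by fun_prop)).mul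
      (Measurable.aestronglyMeasurable (by fun_prop))
  rw [← integrableOn_univ, ← union_compl_self (Metric.ball (0 : Bdry d) 1), integrableOn_union]
  constructor
  · refine Integrable.mono' (((integrableOn_ball_norm_rpow (a := d + 2 * ν - 2) one_pos).2
      (by linarith)).const_mul (‖p‖ ^ 2)) hm.restrict ?_
    filter_upwards [ae_restrict_of_ae (ae_ne_point (0 : Bdry d))] with y hy0
    have hY : 0 < ‖y‖ := norm_pos_iff.2 hy0
    rw [Real.norm_of_nonneg (mul_nonneg (one_sub_cos_nonneg _) (by positivity))]
    have h1 : 1 - Real.cos (inner ℝ p y) ≤ ‖p‖ ^ 2 * ‖y‖ ^ 2 := by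
      have h2 := Real.one_sub_sq_div_two_le_cos (x := inner ℝ p y)
      have h3 := sq_le_sq' (by linarith [neg_le_of_abs_le (abs_real_inner_le_norm p y)])
        (le_of_abs_le (abs_real_inner_le_norm p y))
      rw [mul_pow] at h3
      nlinarith [sq_nonneg (‖p‖ * ‖y‖)]
    calc _ ≤ ‖p‖ ^ 2 * ‖y‖ ^ 2 * ‖y‖ ^ (-((d : ℝ) + 2 * ν)) :=
          mul_le_mul_of_nonneg_right h1 (by positivity)
      _ = _ := by
          rw [mul_assoc, ← Real.rpow_natCast ‖y‖, ← Real.rpow_add hY]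
          congr 2
          push_cast
          ring
  · refine Integrable.mono' (((integrableOn_compl_ball_norm_rpow (a := d + 2 * ν) one_pos).2
      (by linarith)).const_mul 2) hm.restrict (Eventually.of_forall fun y => ?_)
    rw [Real.norm_of_nonneg (mul_nonneg (one_sub_cos_nonneg _) (by positivity))]
    exact mul_le_mul_of_nonneg_right (by linarith [Real.neg_one_le_cos (inner ℝ p y)])
      (by positivity)

/-- The reflection in the hyperplane orthogonal to p - q maps p to q and preserves norm, inner
product and measure. -/
theorem levyIntegral_eq_of_norm_eq {ν : ℝ} {p q : Bdry d} (h : ‖p‖ = ‖q‖) :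
    levyIntegral ν p = levyIntegral ν q := by
  let A := (Submodule.span ℝ {p - q})ᗮ.reflection
  have hA : A p = q := Submodule.reflection_sub h
  unfold levyIntegral
  symm
  rw [← A.measurePreserving.integral_comp A.toHomeomorph.measurableEmbedding]
  refine integral_congr_ae (Eventually.of_forall fun y => ?_)
  simp only
  rw [← hA, A.inner_map_map, A.norm_map]

theorem levyIntegral_smul {ν t : ℝ} (ht : 0 < t) (p : Bdry d) :
    levyIntegral ν (t • p) = t ^ (2 * ν) * levyIntegral ν p := by
  have h := Measure.integral_comp_smul_of_nonneg volume (fun y : Bdry d =>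
    (1 - Real.cos (inner ℝ p y)) * ‖y‖ ^ (-((d : ℝ) + 2 * ν))) t (hR := ht.le)
  rw [finrank_euclideanSpace_fin, smul_eq_mul] at h
  have h2 : levyIntegral ν (t • p) = t ^ ((d : ℝ) + 2 * ν) * ∫ y : Bdry d,
      (1 - Real.cos (inner ℝ p (t • y))) * ‖t • y‖ ^ (-((d : ℝ) + 2 * ν)) := by
    rw [levyIntegral, ← integral_const_mul]
    refine integral_congr_ae (Eventually.of_forall fun y => ?_)
    simp only [inner_smul_left, inner_smul_right, norm_smul, Real.norm_of_nonneg ht.le]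
    rw [Real.mul_rpow ht.le (norm_nonneg y), Real.rpow_neg ht.le]
    have : t ^ ((d : ℝ) + 2 * ν) ≠ 0 := by positivity
    simp only [conj_trivial]
    field_simp
  rw [h2, h, ← mul_assoc, Real.rpow_add ht, Real.rpow_natCast]
  have : t ^ d ≠ 0 := by positivity
  rw [levyIntegral]
  field_simp

/-- The integrand is positive on the strip 0 < e·y < 1, which is open and nonempty. -/
theorem levyIntegral_pos [NeZero d] {ν : ℝ} (hν0 : 0 < ν) (hν1 : ν < 1) {e : Bdry d} (he : e ≠ 0) :
    0 < levyIntegral ν e := by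
  refine (integral_pos_iff_support_of_nonneg (fun y => mul_nonneg (one_sub_cos_nonneg _)
    (by positivity)) (integrable_levy hν0 hν1 e)).2 ?_
  set U : Set (Bdry d) := {y | inner ℝ e y ∈ Ioo (0 : ℝ) 1} with hU
  have hUo : IsOpen U := isOpen_Ioo.preimage (by fun_prop)
  have hUn : U.Nonempty := by
    refine ⟨(2 * ‖e‖ ^ 2)⁻¹ • e, ?_⟩
    have : 0 < ‖e‖ := norm_pos_iff.2 he
    simp only [hU, mem_ofPred_eq, inner_smul_right, real_inner_self_eq_norm_sq]
    have h : (2 * ‖e‖ ^ 2)⁻¹ * ‖e‖ ^ 2 = 1 / 2 := by field_simp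
    rw [h]
    constructor <;> norm_num
  refine (hUo.measure_pos volume hUn).trans_le (measure_mono fun y hy => ?_)
  have hy0 : y ≠ 0 := by
    rintro rfl
    simp [hU] at hy
  have h1 : Real.cos (inner ℝ e y) < 1 := by
    have := Real.cos_lt_cos_of_nonneg_of_le_pi_div_two (le_refl 0)
      (by linarith [Real.pi_gt_three, hy.2]) hy.1
    rwa [Real.cos_zero] at this
  have : 0 < ‖y‖ := norm_pos_iff.2 hy0
  exact mul_ne_zero (by linarith) (by positivity)

/-- Rotation invariance and scaling leave a single constant. Its value never matters, as it serves
only to prove integrability of (-□)^ν ψ. -/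
theorem exists_levyIntegral_eq [NeZero d] {ν : ℝ} (hν0 : 0 < ν) (hν1 : ν < 1) :
    ∃ C, 0 < C ∧ ∀ p : Bdry d, levyIntegral ν p = C * ‖p‖ ^ (2 * ν) := by
  obtain ⟨e, he⟩ := exists_norm_eq_one (d := d)
  have he0 : e ≠ 0 := norm_pos_iff.1 (by rw [he]; exact one_pos)
  refine ⟨levyIntegral ν e, levyIntegral_pos hν0 hν1 he0, fun p => ?_⟩
  rcases eq_or_ne p 0 with rfl | hp
  · simp [levyIntegral, Real.zero_rpow (by positivity : 2 * ν ≠ 0)]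
  · have hP : 0 < ‖p‖ := norm_pos_iff.2 hp
    rw [levyIntegral_eq_of_norm_eq (q := ‖p‖ • e) (by simp [norm_smul, he]), levyIntegral_smul hP,
      mul_comm]

/-! ### The fractional Laplacian of a Schwartz function -/

theorem integrable_mul_exp {g : Bdry d → ℂ} (hg : Integrable g) (x : Bdry d) :
    Integrable fun p => g p * Complex.exp (Complex.I * ((inner ℝ p x : ℝ) : ℂ)) := by
  refine hg.norm.mono' (hg.aestronglyMeasurable.mul (Continuous.aestronglyMeasurable (by fun_prop)))
    (Eventually.of_forall fun p => ?_)
  rw [norm_mul, norm_exp_I_mul, mul_one]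

theorem integrable_norm_rpow_mul_fourierT [NeZero d] {c : ℝ} (hcd : c < d) (ψ : 𝓢(Bdry d, ℂ)) :
    Integrable fun p : Bdry d => ((‖p‖ ^ (-c) : ℝ) : ℂ) * fourierT ψ p := by
  rw [← coe_fourierS]
  exact integrable_norm_rpow_mul_schwartz hcd _

/-- The symbol `|p|^{2ν} ψ̃(p)`. -/
def fracSymbol (ν : ℝ) (ψ : 𝓢(Bdry d, ℂ)) (p : Bdry d) : ℂ :=
  ((‖p‖ ^ (2 * ν) : ℝ) : ℂ) * fourierT ψ p

theorem integrable_fracSymbol [NeZero d] {ν : ℝ} (hν : 0 < ν) (ψ : 𝓢(Bdry d, ℂ)) :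
    Integrable (fracSymbol ν ψ) := by
  have h := integrable_norm_rpow_mul_fourierT (c := -(2 * ν))
    (by linarith [(Nat.cast_nonneg d : (0 : ℝ) ≤ d)]) ψ
  rwa [neg_neg] at h

/-- An inverse transform is a transform at -x, so the facts about `fourierT` of an integrable
function apply to (-□)^ν ψ. -/
theorem fracLaplacian_eq_fourierT (ν : ℝ) (ψ : 𝓢(Bdry d, ℂ)) (x : Bdry d) :
    fracLaplacian ν ψ x =
      ((1 / (2 * Real.pi) ^ d : ℝ) : ℂ) * fourierT (fracSymbol ν ψ) (-x) := by
  rw [fracLaplacian, fourierT]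
  congr 1
  refine integral_congr_ae (Eventually.of_forall fun p => ?_)
  simp only [fracSymbol, inner_neg_left, Complex.ofReal_neg, mul_neg, neg_neg]
  rw [mul_comm, real_inner_comm]

theorem continuous_fracLaplacian [NeZero d] {ν : ℝ} (hν : 0 < ν) (ψ : 𝓢(Bdry d, ℂ)) :
    Continuous (fracLaplacian ν ψ) := by
  rw [funext (fracLaplacian_eq_fourierT ν ψ)]
  exact continuous_const.mul ((continuous_fourierT (integrable_fracSymbol hν ψ)).comp continuous_neg)

theorem norm_fracLaplacian_le (ν : ℝ) (ψ : 𝓢(Bdry d, ℂ)) (x : Bdry d) :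
    ‖fracLaplacian ν ψ x‖ ≤ ‖((1 / (2 * Real.pi) ^ d : ℝ) : ℂ)‖ * ∫ p, ‖fracSymbol ν ψ p‖ := by
  rw [fracLaplacian_eq_fourierT, norm_mul]
  exact mul_le_mul_of_nonneg_left (norm_fourierT_le _ _) (norm_nonneg _)

/-- Fourier inversion at x, x + y and x - y, with the cosine written as a sum of exponentials. -/
theorem integral_one_sub_cos_mul (ψ : 𝓢(Bdry d, ℂ)) (x y : Bdry d) :
    ∫ p, ((1 - Real.cos (inner ℝ p y) : ℝ) : ℂ) *
        (fourierT ψ p * Complex.exp (Complex.I * ((inner ℝ p x : ℝ) : ℂ))) =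
      (((2 * Real.pi) ^ d : ℝ) : ℂ) * secondDiff ψ x y := by
  have hI : ∀ z : Bdry d, Integrable fun p =>
      fourierT ψ p * Complex.exp (Complex.I * ((inner ℝ p z : ℝ) : ℂ)) := fun z => by
    rw [← coe_fourierS]
    exact integrable_mul_exp (fourierS ψ).integrable z
  have hV : ∀ z : Bdry d, ∫ p, fourierT ψ p * Complex.exp (Complex.I * ((inner ℝ p z : ℝ) : ℂ)) =
      (((2 * Real.pi) ^ d : ℝ) : ℂ) * ψ z := fun z => by
    rw [← coe_fourierS, integral_exp_inner_mul, invFourierS_fourierS]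
  have hS : ∀ p, ((1 - Real.cos (inner ℝ p y) : ℝ) : ℂ) *
        (fourierT ψ p * Complex.exp (Complex.I * ((inner ℝ p x : ℝ) : ℂ))) =
      fourierT ψ p * Complex.exp (Complex.I * ((inner ℝ p x : ℝ) : ℂ)) -
      (fourierT ψ p * Complex.exp (Complex.I * ((inner ℝ p (x + y) : ℝ) : ℂ)) +
        fourierT ψ p * Complex.exp (Complex.I * ((inner ℝ p (x - y) : ℝ) : ℂ))) / 2 := by
    intro p
    simp only [inner_add_right, inner_sub_right, Complex.ofReal_add, Complex.ofReal_sub,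
      Complex.ofReal_one, Complex.ofReal_cos, mul_add, mul_sub, Complex.exp_add, Complex.exp_sub]
    rw [Complex.cos, neg_mul, Complex.exp_neg, mul_comm _ Complex.I]
    field_simp
  simp only [hS]
  have h2 : Integrable fun p => (fourierT ψ p * Complex.exp (Complex.I * ((inner ℝ p (x + y) : ℝ) : ℂ)) +
        fourierT ψ p * Complex.exp (Complex.I * ((inner ℝ p (x - y) : ℝ) : ℂ))) / 2 :=
    ((hI (x + y)).add (hI (x - y))).div_const 2
  rw [integral_sub (hI x) h2, integral_div, integral_add (hI _) (hI _), hV, hV, hV, secondDiff]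
  ring

/-- Fubini, after C|p|^(2ν) is written as the integral of (1 - cos p·y)|y|^(-d-2ν) over y: each y
contributes one second difference. -/
theorem fracLaplacian_eq_integral_secondDiff [NeZero d] {ν C : ℝ} (hν0 : 0 < ν) (hν1 : ν < 1)
    (hC : ∀ p : Bdry d, levyIntegral ν p = C * ‖p‖ ^ (2 * ν)) (ψ : 𝓢(Bdry d, ℂ)) (x : Bdry d) :
    (C : ℂ) * fracLaplacian ν ψ x =
      ∫ y, secondDiff ψ x y * ((‖y‖ ^ (-((d : ℝ) + 2 * ν)) : ℝ) : ℂ) := by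
  have hψ : Continuous (fourierT ψ) := by
    rw [← coe_fourierS]
    exact (fourierS ψ).continuous
  have h := (integral_mixture (μ := (volume : Measure (Bdry d))) (τ := (volume : Measure (Bdry d)))
    (k := fun p y => (1 - Real.cos (inner ℝ p y)) * ‖y‖ ^ (-((d : ℝ) + 2 * ν)))
    (κ := fun p => C * ‖p‖ ^ (2 * ν))
    (h := fun p => fourierT ψ p * Complex.exp (Complex.I * ((inner ℝ p x : ℝ) : ℂ)))
    (by
      simp only [Function.uncurry_def]
      exact (Continuous.measurable (by fun_prop)).mul (by fun_prop))
    (Eventually.of_forall fun p => Eventually.of_forall fun y =>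
      mul_nonneg (one_sub_cos_nonneg _) (by positivity))
    (Eventually.of_forall fun p => ⟨integrable_levy hν0 hν1 p, hC p⟩)
    (Continuous.aestronglyMeasurable (by fun_prop))
    (by
      refine ((integrable_mul_exp (integrable_fracSymbol hν0 ψ) x).const_mul (C : ℂ)).congr
        (Eventually.of_forall fun p => ?_)
      simp only [fracSymbol]
      push_cast
      ring)).2
  have hL : ∫ p : Bdry d, ((C * ‖p‖ ^ (2 * ν) : ℝ) : ℂ) *
      (fourierT ψ p * Complex.exp (Complex.I * ((inner ℝ p x : ℝ) : ℂ))) =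
      (((2 * Real.pi) ^ d : ℝ) : ℂ) * ((C : ℂ) * fracLaplacian ν ψ x) := by
    have h0 : (((2 * Real.pi) ^ d : ℝ) : ℂ) * ((1 / (2 * Real.pi) ^ d : ℝ) : ℂ) = 1 := by
      rw [← Complex.ofReal_mul, mul_one_div_cancel (by positivity), Complex.ofReal_one]
    rw [fracLaplacian, mul_left_comm, ← mul_assoc (((2 * Real.pi) ^ d : ℝ) : ℂ), h0, one_mul,
      ← integral_const_mul]
    refine integral_congr_ae (Eventually.of_forall fun p => ?_)
    push_cast
    ring
  have hR : ∀ y : Bdry d, ∫ p, (((1 - Real.cos (inner ℝ p y)) * ‖y‖ ^ (-((d : ℝ) + 2 * ν)) : ℝ) : ℂ) *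
      (fourierT ψ p * Complex.exp (Complex.I * ((inner ℝ p x : ℝ) : ℂ))) =
      (((2 * Real.pi) ^ d : ℝ) : ℂ) * (secondDiff ψ x y * ((‖y‖ ^ (-((d : ℝ) + 2 * ν)) : ℝ) : ℂ)) := by
    intro y
    rw [← mul_assoc, ← integral_one_sub_cos_mul, ← integral_mul_const]
    refine integral_congr_ae (Eventually.of_forall fun p => ?_)
    push_cast
    ring
  rw [hL] at h
  simp only [hR] at h
  rw [integral_const_mul] at h
  exact mul_left_cancel₀ (Complex.ofReal_ne_zero.2 (by positivity)) h

/-- The symbol |p|^(2ν) is not smooth at 0, so (-□)^ν ψ need not be a Schwartz function; its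
integrability comes from the second differences instead. -/
theorem integrable_fracLaplacian [NeZero d] {ν : ℝ} (hν0 : 0 < ν) (hν1 : ν < 1)
    (ψ : 𝓢(Bdry d, ℂ)) : Integrable (fracLaplacian ν ψ) := by
  obtain ⟨C, hC0, hC⟩ := exists_levyIntegral_eq (d := d) hν0 hν1
  have h := (integrable_secondDiff_prod ψ hν0 hν1).integral_prod_left.const_mul (C : ℂ)⁻¹
  refine h.congr (Eventually.of_forall fun x => ?_)
  simp only [Function.uncurry_apply_pair]
  rw [← fracLaplacian_eq_integral_secondDiff hν0 hν1 hC, inv_mul_cancel_left₀]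
  exact Complex.ofReal_ne_zero.2 hC0.ne'

theorem integrable_norm_rpow_mul_fracLaplacian [NeZero d] {ν c : ℝ} (hν0 : 0 < ν) (hν1 : ν < 1)
    (hc : 0 < c) (hcd : c < d) (ψ : 𝓢(Bdry d, ℂ)) :
    Integrable fun x : Bdry d => ((‖x‖ ^ (-c) : ℝ) : ℂ) * fracLaplacian ν ψ x :=
  integrable_norm_rpow_mul (k := 0) hcd (by simpa using hc.le)
    (continuous_fracLaplacian hν0 ψ).aestronglyMeasurable (norm_fracLaplacian_le ν ψ)
    (by simpa using (integrable_fracLaplacian hν0 hν1 ψ).norm)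

theorem norm_rpow_mul_fracSymbol [NeZero d] {ν c : ℝ} {p : Bdry d} (hp : p ≠ 0)
    (ψ : 𝓢(Bdry d, ℂ)) : ((‖p‖ ^ (c - d) : ℝ) : ℂ) * fracSymbol ν ψ p =
      ((‖p‖ ^ (-((d : ℝ) - (c + 2 * ν))) : ℝ) : ℂ) * fourierT ψ p := by
  rw [fracSymbol, ← mul_assoc, ← Complex.ofReal_mul, ← Real.rpow_add (norm_pos_iff.2 hp)]
  ring_nf

/-- The pairing of `|x|^{-c}` with `(-□)^ν ψ`. -/
theorem integral_norm_rpow_mul_fracLaplacian [NeZero d] {ν c : ℝ} (hν0 : 0 < ν) (hν1 : ν < 1)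
    (hc : 0 < c) (hcd : c < d) (ψ : 𝓢(Bdry d, ℂ)) :
    ∫ x : Bdry d, ((‖x‖ ^ (-c) : ℝ) : ℂ) * fracLaplacian ν ψ x =
      ((1 / (2 * Real.pi) ^ d * rieszFourierConst d c : ℝ) : ℂ) *
        ∫ p : Bdry d, ((‖p‖ ^ (-((d : ℝ) - (c + 2 * ν))) : ℝ) : ℂ) * fourierT ψ p := by
  have hae : (fun p : Bdry d => ((‖p‖ ^ (c - d) : ℝ) : ℂ) * fracSymbol ν ψ p) =ᵐ[volume]
      fun p => ((‖p‖ ^ (-((d : ℝ) - (c + 2 * ν))) : ℝ) : ℂ) * fourierT ψ p := by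
    filter_upwards [ae_ne_point (0 : Bdry d)] with p hp
    exact norm_rpow_mul_fracSymbol hp ψ
  have hpi : ((2 * Real.pi) ^ d : ℂ) ≠ 0 := by
    simp [Real.pi_ne_zero]
  -- The transform of `fracSymbol ν ψ` is (2π)^d times the reflected (-□)^ν ψ, and ‖x‖^(-c) is even;
  -- so the Fourier pairing for powers applies with the symbol as g.
  have e1 : ∀ x : Bdry d, ((‖x‖ ^ (-c) : ℝ) : ℂ) * fourierT (fracSymbol ν ψ) x =
      (((2 * Real.pi) ^ d : ℝ) : ℂ) * (((‖-x‖ ^ (-c) : ℝ) : ℂ) * fracLaplacian ν ψ (-x)) := by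
    intro x
    rw [fracLaplacian_eq_fourierT, neg_neg, norm_neg]
    push_cast
    field_simp
  have hI := ((integrable_norm_rpow_mul_fracLaplacian hν0 hν1 hc hcd ψ).comp_neg.const_mul
    ((((2 * Real.pi) ^ d : ℝ) : ℂ)))
  simp only [← e1] at hI
  have h := integral_norm_rpow_mul_fourierT hc hcd (integrable_fracSymbol hν0 ψ)
    ((integrable_congr hae).2 (integrable_norm_rpow_mul_fourierT (by linarith) ψ)) hI
  simp only [e1] at h
  rw [integral_const_mul, integral_congr_ae hae,
    integral_neg_eq_self (fun x : Bdry d => ((‖x‖ ^ (-c) : ℝ) : ℂ) * fracLaplacian ν ψ x)] at h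
  push_cast at h ⊢
  rw [mul_assoc, ← h]
  field_simp

/-- `(-□)^ν |x|^{-c}` is a multiple of `|x|^{-c-2ν}`. -/
theorem integral_norm_rpow_mul_fracLaplacian' [NeZero d] {ν c : ℝ} (hν0 : 0 < ν) (hν1 : ν < 1)
    (hc : 0 < c) (hcd : c + 2 * ν < d) (ψ : 𝓢(Bdry d, ℂ)) :
    ∫ x : Bdry d, ((‖x‖ ^ (-c) : ℝ) : ℂ) * fracLaplacian ν ψ x =
      ((1 / (2 * Real.pi) ^ d * rieszFourierConst d c *
        rieszFourierConst d (d - (c + 2 * ν)) : ℝ) : ℂ) *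
        ∫ x : Bdry d, ((‖x‖ ^ (-(c + 2 * ν)) : ℝ) : ℂ) * ψ x := by
  have e : (d : ℝ) - (c + 2 * ν) - d = -(c + 2 * ν) := by ring
  -- A second Fourier transform of a power, with exponent d - (c + 2ν), returns from p to x; c + 2ν
  -- < d makes this exponent positive.
  have h := integral_norm_rpow_mul_fourierT (d := d) (c := d - (c + 2 * ν)) (by linarith)
    (by linarith) ψ.integrable (by rw [e]; exact integrable_norm_rpow_mul_schwartz hcd ψ)
    (integrable_norm_rpow_mul_fourierT (by linarith) ψ)
  rw [integral_norm_rpow_mul_fracLaplacian hν0 hν1 hc (by linarith), h, e]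
  push_cast
  ring

/-! ### Test functions with a nonnegative Fourier transform -/

/-- A smooth bump function around the origin. -/
def bump (d : ℕ) : ContDiffBump (0 : Bdry d) := ⟨1, 2, one_pos, one_lt_two⟩

/-- The bump function as a complex Schwartz function. -/
def bumpS (d : ℕ) : 𝓢(Bdry d, ℂ) :=
  HasCompactSupport.toSchwartzMap (f := fun p => ((bump d p : ℝ) : ℂ))
    ((bump d).hasCompactSupport.comp_left (g := fun t : ℝ => (t : ℂ)) Complex.ofReal_zero)
    (Complex.ofRealCLM.contDiff.comp (bump d).contDiff)

theorem bumpS_apply (p : Bdry d) : bumpS d p = ((bump d p : ℝ) : ℂ) := rfl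

/-- The moments of the bump function. -/
def bumpMoment (d : ℕ) (s : ℝ) : ℝ := ∫ p : Bdry d, ‖p‖ ^ (-s) * bump d p

theorem integral_norm_rpow_mul_bumpS (s : ℝ) :
    ∫ p : Bdry d, ((‖p‖ ^ (-s) : ℝ) : ℂ) * bumpS d p = (bumpMoment d s : ℂ) := by
  rw [bumpMoment, ← integral_complex_ofReal]
  refine integral_congr_ae (Eventually.of_forall fun p => ?_)
  simp only [bumpS_apply]
  push_cast
  rfl

theorem bumpMoment_pos [NeZero d] {s : ℝ} (hs : s < d) : 0 < bumpMoment d s := by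
  have hI : Integrable fun p : Bdry d => ‖p‖ ^ (-s) * bump d p := by
    have h := (integrable_norm_rpow_mul_schwartz hs (bumpS d)).norm
    refine h.congr (Eventually.of_forall fun p => ?_)
    beta_reduce
    rw [bumpS_apply, norm_mul, Complex.norm_real, Complex.norm_real,
      Real.norm_of_nonneg (by positivity), Real.norm_of_nonneg (bump d).nonneg]
  refine (integral_pos_iff_support_of_nonneg (fun p => mul_nonneg (by positivity)
    (bump d).nonneg) hI).2 ?_
  have := nontrivial_bdry (d := d)
  -- The origin is removed because ‖0‖^(-s) can be 0 by convention; on the rest of the ball the bump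
  -- is 1.
  have h1 : 0 < volume (Metric.ball (0 : Bdry d) 1 \ {0}) := by
    rw [measure_sdiff_null (measure_singleton _)]
    exact Metric.measure_ball_pos _ _ one_pos
  refine h1.trans_le (measure_mono fun p hp => ?_)
  have hp0 : 0 < ‖p‖ := norm_pos_iff.2 hp.2
  have hp1 : bump d p = 1 := (bump d).one_of_mem_closedBall (Metric.ball_subset_closedBall hp.1)
  simp only [Function.mem_support, hp1]
  positivity

/-- Scaling of a pairing with a power. -/
theorem integral_norm_rpow_mul_comp_smul (s : ℝ) (h : Bdry d → ℂ) {t : ℝ} (ht : 0 < t) :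
    ∫ x : Bdry d, ((‖x‖ ^ (-s) : ℝ) : ℂ) * h (t • x) =
      ((t ^ (s - d) : ℝ) : ℂ) * ∫ x : Bdry d, ((‖x‖ ^ (-s) : ℝ) : ℂ) * h x := by
  have h1 := Measure.integral_comp_smul_of_nonneg volume (fun x : Bdry d =>
    ((‖x‖ ^ (-s) : ℝ) : ℂ) * h x) t (hR := ht.le)
  rw [finrank_euclideanSpace_fin, Complex.real_smul] at h1
  have h2 : ((t ^ (s - d) : ℝ) : ℂ) = ((t ^ s : ℝ) : ℂ) * (((t ^ d)⁻¹ : ℝ) : ℂ) := by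
    rw [← Complex.ofReal_mul, Real.rpow_sub ht, Real.rpow_natCast, div_eq_mul_inv]
  rw [h2, mul_assoc, ← h1, ← integral_const_mul]
  refine integral_congr_ae (Eventually.of_forall fun x => ?_)
  simp only [norm_smul, Real.norm_of_nonneg ht.le, Real.mul_rpow ht.le (norm_nonneg x),
    Real.rpow_neg ht.le]
  have : ((t ^ s : ℝ) : ℂ) ≠ 0 := Complex.ofReal_ne_zero.2 (by positivity)
  push_cast
  field_simp

/-- A test function whose Fourier transform is the bump function scaled by `t`. -/
def testS (d : ℕ) (t : ℝ) (ht : t ≠ 0) : 𝓢(Bdry d, ℂ) :=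
  invFourierS (scaleS t⁻¹ (inv_ne_zero ht) (bumpS d))

theorem fourierT_testS {t : ℝ} (ht : t ≠ 0) (p : Bdry d) :
    fourierT (testS d t ht) p = bumpS d (t⁻¹ • p) := by
  rw [testS, ← coe_fourierS, fourierS_invFourierS, scaleS_apply]

/-- Pairings of powers with these test functions are pure powers of t, here on the Fourier side and
in `integral_norm_rpow_mul_testS` on the position side, so varying t compares exponents. -/
theorem integral_norm_rpow_mul_fourierT_testS (s : ℝ) {t : ℝ} (ht : 0 < t) :
    ∫ p : Bdry d, ((‖p‖ ^ (-s) : ℝ) : ℂ) * fourierT (testS d t ht.ne') p =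
      ((t ^ ((d : ℝ) - s) * bumpMoment d s : ℝ) : ℂ) := by
  simp only [fourierT_testS]
  rw [integral_norm_rpow_mul_comp_smul s _ (inv_pos.2 ht), integral_norm_rpow_mul_bumpS,
    Real.inv_rpow ht.le, ← Real.rpow_neg ht.le, neg_sub]
  push_cast
  rfl

theorem testS_eq {t : ℝ} (ht : 0 < t) (x : Bdry d) :
    testS d t ht.ne' x = ((t ^ d : ℝ) : ℂ) * testS d 1 one_ne_zero (t • x) := by
  have h1 := integral_exp_inner_mul (scaleS t⁻¹ (inv_ne_zero ht.ne') (bumpS d)) x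
  have h2 := integral_exp_inner_mul (scaleS 1⁻¹ (inv_ne_zero one_ne_zero) (bumpS d)) (t • x)
  have h3 := Measure.integral_comp_smul_of_nonneg volume (fun p : Bdry d =>
    bumpS d p * Complex.exp (Complex.I * ((inner ℝ p (t • x) : ℝ) : ℂ))) t⁻¹
      (hR := (inv_pos.2 ht).le)
  rw [finrank_euclideanSpace_fin, Complex.real_smul] at h3
  simp only [inner_smul_left, inner_smul_right, conj_trivial,
    mul_inv_cancel_left₀ ht.ne', scaleS_apply, inv_one, one_smul] at h1 h2 h3
  have hpi : (((2 * Real.pi) ^ d : ℝ) : ℂ) ≠ 0 := Complex.ofReal_ne_zero.2 (by positivity)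
  rw [h1, h2] at h3
  refine mul_left_cancel₀ hpi (h3.trans ?_)
  rw [testS, inv_pow, inv_inv, mul_left_comm]
  simp only [inv_one]

theorem integral_norm_rpow_mul_testS (s : ℝ) {t : ℝ} (ht : 0 < t) :
    ∫ x : Bdry d, ((‖x‖ ^ (-s) : ℝ) : ℂ) * testS d t ht.ne' x =
      ((t ^ s : ℝ) : ℂ) * ∫ x : Bdry d, ((‖x‖ ^ (-s) : ℝ) : ℂ) * testS d 1 one_ne_zero x := by
  simp only [testS_eq ht, mul_left_comm _ ((t ^ d : ℝ) : ℂ)]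
  rw [integral_const_mul, integral_norm_rpow_mul_comp_smul s (testS d 1 one_ne_zero) ht, ← mul_assoc,
    ← Complex.ofReal_mul, Real.rpow_sub ht, Real.rpow_natCast, mul_div_cancel₀ _ (by positivity)]

/-- By inversion the value at 0 is (2π)^(-d) times the integral of the bump. Being nonzero there,
the test function detects a nonintegrable singularity at the origin. -/
theorem testS_zero_ne_zero [NeZero d] : testS d 1 one_ne_zero 0 ≠ 0 := by
  have h2 := integral_exp_inner_mul (scaleS 1⁻¹ (inv_ne_zero one_ne_zero) (bumpS d)) 0
  simp only [inner_zero_right, Complex.ofReal_zero, mul_zero, Complex.exp_zero, mul_one, scaleS_apply,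
    inv_one, one_smul] at h2
  have h3 := integral_norm_rpow_mul_bumpS (d := d) 0
  simp only [neg_zero, Real.rpow_zero, Complex.ofReal_one, one_mul] at h3
  have h4 := bumpMoment_pos (d := d) (s := 0) (by exact_mod_cast Nat.pos_of_neZero d)
  intro h0
  have h5 : invFourierS (scaleS 1 one_ne_zero (bumpS d)) (0 : Bdry d) = 0 := by
    rw [← h0, testS]
    simp only [inv_one]
  rw [h3, h5, mul_zero] at h2
  exact h4.ne' (Complex.ofReal_eq_zero.1 h2)

theorem fracLaplacian_testS_zero_ne_zero [NeZero d] {ν : ℝ} (hν : 0 < ν) :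
    fracLaplacian ν (testS d 1 one_ne_zero) 0 ≠ 0 := by
  have h1 := integral_norm_rpow_mul_fourierT_testS (d := d) (-(2 * ν)) one_pos
  have h2 := bumpMoment_pos (d := d) (s := -(2 * ν))
    (by linarith [(Nat.cast_nonneg d : (0 : ℝ) ≤ d)])
  rw [fracLaplacian]
  simp only [inner_zero_right, Complex.ofReal_zero, mul_zero, Complex.exp_zero, mul_one]
  rw [neg_neg] at h1
  rw [h1, ← Complex.ofReal_mul, Complex.ofReal_ne_zero]
  positivity

theorem lt_of_integrable_norm_rpow_mul [NeZero d] {c : ℝ} {h : Bdry d → ℂ} (hc : Continuous h)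
    (h0 : h 0 ≠ 0) (hi : Integrable fun x : Bdry d => ((‖x‖ ^ (-c) : ℝ) : ℂ) * h x) : c < d := by
  have hpos : 0 < ‖h 0‖ / 2 := half_pos (norm_pos_iff.2 h0)
  have hev : ∀ᶠ x in 𝓝 (0 : Bdry d), ‖h 0‖ / 2 < ‖h x‖ :=
    hc.norm.continuousAt.eventually (lt_mem_nhds (half_lt_self (norm_pos_iff.2 h0)))
  obtain ⟨r, hr, hball⟩ := Metric.eventually_nhds_iff_ball.1 hev
  rw [← integrableOn_ball_norm_rpow (a := c) hr]
  refine Integrable.mono' ((hi.norm.integrableOn (s := Metric.ball 0 r)).const_mul (‖h 0‖ / 2)⁻¹)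
    (Measurable.aestronglyMeasurable (by fun_prop)) ?_
  filter_upwards [ae_restrict_mem Metric.isOpen_ball.measurableSet] with x hx
  rw [norm_mul, Complex.norm_real, Real.norm_of_nonneg (by positivity), inv_mul_eq_div,
    le_div_iff₀ hpos]
  exact mul_le_mul_of_nonneg_left (hball x hx).le (by positivity)

/-! ### The distributional gap equation for power profiles -/

/-- The amplitude equation for the distributional form: the constant in (-□)^ν ‖x‖^(-c) times the
prefactor of the gap equation. The powers of π cancel and those of 2 collapse to the single factor 2
of the amplitude. -/
theorem gapConst_eq {ν l ξ ω : ℝ} (hν : 0 < ν) (hν1 : ν < 1) (hl : 0 < l)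
    (h : InstantonCondition d ν ξ ω) :
    (l / 2) ^ (2 * ν - 1) * (Real.Gamma (1 - ν) / Real.Gamma ν) *
      (1 / (2 * Real.pi) ^ d * rieszFourierConst d (2 * (ν / (ω - 2))) *
        rieszFourierConst d (d - (2 * (ν / (ω - 2)) + 2 * ν))) =
      -(ξ * ω * instantonAmplitude d ν l ξ ω) := by
  obtain ⟨h1, -, h3, -⟩ := h.params hν
  have h4 : 0 < ω := by linarith [h.1]
  have h6 : ξ ≠ 0 := h.2.1.ne
  rw [instantonAmplitude_eq hν h, rieszFourierConst, rieszFourierConst]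
  generalize ν / (ω - 2) = α at *
  rw [show ((d : ℝ) - 2 * α) / 2 = (d : ℝ) / 2 - α by ring,
    show 2 * α / 2 = α by ring,
    show ((d : ℝ) - (d - (2 * α + 2 * ν))) / 2 = α + ν by ring,
    show ((d : ℝ) - (2 * α + 2 * ν)) / 2 = (d : ℝ) / 2 - (α + ν) by ring,
    show (d : ℝ) - (d - (2 * α + 2 * ν)) = 2 * α + 2 * ν by ring,
    mul_pow, ← Real.rpow_natCast, ← Real.rpow_natCast, Real.div_rpow hl.le zero_le_two,
    Real.rpow_sub two_pos (d : ℝ), Real.rpow_add two_pos, Real.rpow_sub two_pos (2 * ν),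
    show (Real.pi : ℝ) ^ (d : ℝ) = Real.pi ^ ((d : ℝ) / 2) * Real.pi ^ ((d : ℝ) / 2) by
      rw [← Real.rpow_add Real.pi_pos]; ring_nf, Real.rpow_one]
  have := Real.Gamma_pos_of_pos hν
  have := Real.Gamma_pos_of_pos h1
  have := Real.Gamma_pos_of_pos (add_pos h1 hν)
  have := Real.Gamma_pos_of_pos (sub_pos.2 h3)
  have := Real.Gamma_pos_of_pos (sub_pos.2 hν1)
  have := Real.Gamma_pos_of_pos (show 0 < (d : ℝ) / 2 - α by linarith)
  generalize Real.Gamma ((d : ℝ) / 2 - α) = g₂ at *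
  generalize Real.Gamma ((d : ℝ) / 2 - (α + ν)) = g₃ at *
  have : 0 < Real.pi ^ ((d : ℝ) / 2) := by positivity
  have : (0 : ℝ) < 2 ^ (d : ℝ) := by positivity
  have : (0 : ℝ) < 2 ^ (2 * ν) := by positivity
  have : (0 : ℝ) < 2 ^ (2 * α) := by positivity
  generalize Real.pi ^ ((d : ℝ) / 2) = g₄ at *
  generalize (2 : ℝ) ^ (d : ℝ) = g₅ at *
  generalize (2 : ℝ) ^ (2 * ν) = g₆ at *
  generalize (2 : ℝ) ^ (2 * α) = g₇ at *
  field_simp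

theorem ae_deriv_mul_eq [NeZero d] {ξ ω b c : ℝ} (hb : 0 < b) (ψ : 𝓢(Bdry d, ℂ)) :
    (fun x : Bdry d => ((deriv (powPotential ξ ω) (profile b c x) : ℝ) : ℂ) * ψ x) =ᵐ[volume]
      fun x => ((ξ * ω * b ^ (ω - 1) : ℝ) : ℂ) *
        (((‖x‖ ^ (-(c * (ω - 1))) : ℝ) : ℂ) * ψ x) := by
  filter_upwards [ae_ne_point (0 : Bdry d)] with y hy
  rw [deriv_powPotential_profile hb hy]
  push_cast
  ring

theorem profile_mul_eq {ν b c : ℝ} (ψ : 𝓢(Bdry d, ℂ)) :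
    (fun x : Bdry d => (profile b c x : ℂ) * fracLaplacian ν ψ x) =
      fun x => (b : ℂ) * (((‖x‖ ^ (-c) : ℝ) : ℂ) * fracLaplacian ν ψ x) := by
  ext x
  rw [profile_eq]
  push_cast
  ring

/-- The power profiles that solve the gap equation in the sense of distributions. -/
theorem solvesGapEquation_iff [NeZero d] {ν l ξ ω b c : ℝ} (hν : 0 < ν) (hν1 : ν < 1)
    (hl : 0 < l) (hb : 0 < b) (hc : 0 < c) :
    SolvesGapEquation (d := d) ν l (powPotential ξ ω) 0 (profile b c) ↔
      IsInstanton d ν l ξ ω b c := by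
  have hbω : b ^ (ω - 1) = b ^ (ω - 2) * b := by
    rw [← Real.rpow_add_one hb.ne']
    ring_nf
  have hG1 := Real.Gamma_pos_of_pos (sub_pos.2 hν1)
  have hG2 := Real.Gamma_pos_of_pos hν
  have hK : 0 < (l / 2) ^ (2 * ν - 1) * (Real.Gamma (1 - ν) / Real.Gamma ν) := by positivity
  constructor
  · intro h
    have hcd : c < d := by
      have h1 := (h (testS d 1 one_ne_zero)).1
      rw [profile_mul_eq, integrable_const_mul_iff
        (isUnit_iff_ne_zero.2 (Complex.ofReal_ne_zero.2 hb.ne'))] at h1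
      exact lt_of_integrable_norm_rpow_mul (continuous_fracLaplacian hν _)
        (fracLaplacian_testS_zero_ne_zero hν) h1
    set A := 1 / (2 * Real.pi) ^ d * rieszFourierConst d c *
      bumpMoment d ((d : ℝ) - (c + 2 * ν)) with hA
    -- The moment exponent d - (c + 2ν) is below d in any case, so the left-hand side is known to be
    -- nonzero before c + 2ν < d is established.
    have hApos : 0 < A := by
      have := rieszFourierConst_pos hc hcd
      have := bumpMoment_pos (d := d) (s := (d : ℝ) - (c + 2 * ν)) (by linarith)
      positivity
    set B := ∫ x : Bdry d, ((‖x‖ ^ (-(c * (ω - 1))) : ℝ) : ℂ) * testS d 1 one_ne_zero x with hB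
    set K := (l / 2) ^ (2 * ν - 1) * (Real.Gamma (1 - ν) / Real.Gamma ν) with hKdef
    set k := ξ * ω * b ^ (ω - 1) with hk
    -- Both sides are pure powers of t; t = 1 and t = 2 then give the exponent relation.
    have heq : ∀ t : ℝ, 0 < t → ((-(K * (b * (t ^ (c + 2 * ν) * A))) : ℝ) : ℂ) =
        (k : ℂ) * (((t ^ (c * (ω - 1)) : ℝ) : ℂ) * B) := by
      intro t ht
      have h1 := (h (testS d t ht.ne')).2.2.2
      rw [profile_mul_eq, integral_congr_ae (ae_deriv_mul_eq hb _), integral_const_mul,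
        integral_const_mul, integral_norm_rpow_mul_fracLaplacian hν hν1 hc hcd,
        integral_norm_rpow_mul_fourierT_testS _ ht, integral_norm_rpow_mul_testS _ ht] at h1
      simp only [Pi.zero_apply, Complex.ofReal_zero, zero_mul, integral_zero] at h1
      rw [show (d : ℝ) - ((d : ℝ) - (c + 2 * ν)) = c + 2 * ν by ring] at h1
      rw [← sub_eq_zero.1 h1, hA, hKdef]
      push_cast
      ring
    have h1 := heq 1 one_pos
    have h2 := heq 2 two_pos
    simp only [Real.one_rpow, Complex.ofReal_one, one_mul] at h1
    have hne : ((-(K * (b * A)) : ℝ) : ℂ) ≠ 0 :=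
      Complex.ofReal_ne_zero.2 (neg_ne_zero.2 (by positivity))
    have hk0 : k ≠ 0 := by
      intro h0
      rw [h1, h0] at hne
      simp at hne
    -- Convergence of the pairing with f'(φ_-) near the origin; through the exponent relation below
    -- it becomes c + 2ν < d.
    have had : c * (ω - 1) < d := by
      have h3 := (h (testS d 1 one_ne_zero)).2.1
      rw [integrable_congr (ae_deriv_mul_eq hb _), integrable_const_mul_iff
        (isUnit_iff_ne_zero.2 (Complex.ofReal_ne_zero.2 hk0))] at h3
      exact lt_of_integrable_norm_rpow_mul (testS d 1 one_ne_zero).continuous testS_zero_ne_zero h3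
    have h3 : (2 : ℝ) ^ (c + 2 * ν) = 2 ^ (c * (ω - 1)) := by
      rw [mul_left_comm (k : ℂ), ← h1, ← Complex.ofReal_mul, Complex.ofReal_inj] at h2
      have h4 : K * (b * A) ≠ 0 := by positivity
      refine mul_right_cancel₀ h4 ?_
      linear_combination -h2
    have h4 := eq_of_two_rpow_eq h3
    have hcω : c * (ω - 2) = 2 * ν := by linarith
    have hω2 : 0 < ω - 2 := by
      by_contra hneg
      have := mul_nonpos_of_nonneg_of_nonpos hc.le (not_lt.1 hneg)
      linarith
    have hceq : c = 2 * ν / (ω - 2) := by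
      rw [← hcω]
      field_simp
    have hα : c = 2 * (ν / (ω - 2)) := by rw [hceq]; ring
    set D := 1 / (2 * Real.pi) ^ d * rieszFourierConst d c *
        rieszFourierConst d (d - (c + 2 * ν)) with hD
    have hDpos : 0 < D := by
      have := rieszFourierConst_pos hc hcd
      have := rieszFourierConst_pos (d := d) (c := d - (c + 2 * ν)) (by linarith) (by linarith)
      positivity
    -- The same pairing computed in p and in x. B is never evaluated: this relation shows B ≠ 0 and
    -- lets it be cancelled.
    have hAB : (A : ℂ) = (D : ℂ) * B := by
      have h5 := integral_norm_rpow_mul_fracLaplacian hν hν1 hc hcd (testS d 1 one_ne_zero)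
      rw [integral_norm_rpow_mul_fracLaplacian' hν hν1 hc (by linarith),
        integral_norm_rpow_mul_fourierT_testS _ one_pos, h4, ← hB, Real.one_rpow, one_mul,
        ← Complex.ofReal_mul, ← h4] at h5
      exact h5.symm
    have hkey : K * D = -(ξ * ω * b ^ (ω - 2)) := by
      have h6 : ((K * D * b : ℝ) : ℂ) * B = ((-(ξ * ω * b ^ (ω - 2)) * b : ℝ) : ℂ) * B := by
        rw [hk, hbω] at h1
        push_cast at h1 ⊢
        rw [hAB] at h1
        linear_combination -h1
      have hB0 : B ≠ 0 := by
        intro h0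
        rw [h0, mul_zero, Complex.ofReal_eq_zero] at hAB
        exact hApos.ne' hAB
      have h7 := Complex.ofReal_inj.1 (mul_right_cancel₀ hB0 h6)
      exact mul_right_cancel₀ hb.ne' h7
    have hξ : ξ < 0 := by
      by_contra hneg
      have h0 : 0 ≤ ξ := not_lt.1 hneg
      have h0' : 0 < ω := by linarith
      have : 0 ≤ ξ * ω * b ^ (ω - 2) := by positivity
      have : 0 < K * D := by positivity
      linarith
    have hcond : InstantonCondition d ν ξ ω := by
      refine ⟨by linarith, hξ, ?_⟩
      have : (ω - 1) * ν / (ω - 2) = c * (ω - 1) / 2 := by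
        rw [hceq]
        field_simp
      linarith
    refine ⟨hcond, hceq, ?_⟩
    have h5 := gapConst_eq hν hν1 hl hcond
    rw [← hα, ← hD, ← hKdef, hkey] at h5
    have h6 : ξ * ω ≠ 0 := mul_ne_zero hξ.ne (by linarith)
    exact mul_left_cancel₀ h6 (neg_inj.1 h5)
  · intro h ψ
    obtain ⟨h1, h2, h3, h4⟩ := h.1.params hν
    have hα := h.two_mul_alpha
    have ha : c * (ω - 1) = c + 2 * ν := by
      rw [hα]
      linear_combination h4
    refine ⟨?_, ?_, ?_, ?_⟩
    · rw [profile_mul_eq]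
      exact (integrable_norm_rpow_mul_fracLaplacian hν hν1 hc (by linarith) ψ).const_mul _
    · rw [integrable_congr (ae_deriv_mul_eq hb _)]
      exact (integrable_norm_rpow_mul_schwartz (by linarith) ψ).const_mul _
    · simp
    · have h5 := gapConst_eq hν hν1 hl h.1
      rw [← hα, ← h.2.2] at h5
      rw [profile_mul_eq, integral_congr_ae (ae_deriv_mul_eq hb _), integral_const_mul,
        integral_const_mul, integral_norm_rpow_mul_fracLaplacian' hν hν1 hc (by linarith), ha, hbω]
      simp only [Pi.zero_apply, Complex.ofReal_zero, zero_mul, integral_zero]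
      have h6 := congrArg (fun r : ℝ => (r : ℂ)) h5
      push_cast at h6 ⊢
      linear_combination (-(b : ℂ) * ∫ x : Bdry d, ((‖x‖ ^ (-(c + 2 * ν)) : ℝ) : ℂ) * ψ x) * h6

/-! ### Euler's integral for the hypergeometric function -/

/-- The weight in Euler's integral, in the variable `v = (1-t)/t`. -/
def eulerWeight (β γ v : ℝ) : ℝ := v ^ (γ - β - 1) * (1 + v) ^ (-γ)

theorem eulerWeight_pos (β γ : ℝ) {v : ℝ} (hv : 0 < v) : 0 < eulerWeight β γ v := by
  unfold eulerWeight
  positivity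

theorem measurable_eulerWeight (β γ : ℝ) : Measurable (eulerWeight β γ) := by
  unfold eulerWeight
  fun_prop

theorem integral_eulerWeight {β γ : ℝ} (hβ : 0 < β) (hγ : β < γ) :
    IntegrableOn (eulerWeight β γ) (Ioi 0) ∧
    ∫ v in Ioi (0 : ℝ), eulerWeight β γ v =
      Real.Gamma (γ - β) * Real.Gamma β / Real.Gamma γ := by
  have h := integral_betaPrime (sub_pos.2 hγ) hβ
  rw [sub_add_cancel] at h
  exact h

/-- In t = 1/(1+v) the shift multiplies the weight by t, the factor produced when (1 - zt)^(-α) is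
differentiated in z. -/
theorem eulerWeight_succ (β γ : ℝ) {v : ℝ} (hv : 0 < v) :
    eulerWeight (β + 1) (γ + 1) v = eulerWeight β γ v / (1 + v) := by
  rw [eulerWeight, eulerWeight, show γ + 1 - (β + 1) - 1 = γ - β - 1 by ring,
    show -(γ + 1) = -γ - 1 by ring, Real.rpow_sub_one (x := 1 + v) (by positivity),
    mul_div_assoc]

/-- Euler's integral `B(β, γ-β) F(α, β; γ; z)` for complex `z`. -/
def eulerInt (α β γ : ℝ) (z : ℂ) : ℂ :=
  ∫ v in Ioi (0 : ℝ), (eulerWeight β γ v : ℂ) * (1 - z / ((1 + v : ℝ) : ℂ)) ^ ((-α : ℝ) : ℂ)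

/-- As 0 < 1/(1+v) < 1, the half-plane Re z ≤ 1 - m is sent into Re ≥ m. This stays off the branch
cut and provides the dominating functions. -/
theorem le_re_one_sub_div {z : ℂ} {m v : ℝ} (hm : m ≤ 1) (hz : z.re ≤ 1 - m) (hv : 0 < v) :
    m ≤ (1 - z / ((1 + v : ℝ) : ℂ)).re := by
  rw [Complex.sub_re, Complex.one_re, Complex.div_ofReal_re]
  have h1 : z.re / (1 + v) ≤ 1 - m := by
    rw [div_le_iff₀ (by positivity)]
    have := mul_nonneg (sub_nonneg.2 hm) hv.le
    linarith
  linarith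

theorem norm_one_sub_div_cpow_le {z : ℂ} {m v α : ℝ} (hα : 0 ≤ α) (hm0 : 0 < m) (hm : m ≤ 1)
    (hz : z.re ≤ 1 - m) (hv : 0 < v) :
    ‖(1 - z / ((1 + v : ℝ) : ℂ)) ^ ((-α : ℝ) : ℂ)‖ ≤ m ^ (-α) := by
  rw [Complex.norm_cpow_real]
  exact Real.rpow_le_rpow_of_nonpos hm0
    ((le_re_one_sub_div hm hz hv).trans (Complex.re_le_norm _)) (by linarith)

theorem measurable_eulerIntegrand (α β γ : ℝ) (z : ℂ) : Measurable fun v : ℝ =>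
    (eulerWeight β γ v : ℂ) * (1 - z / ((1 + v : ℝ) : ℂ)) ^ ((-α : ℝ) : ℂ) :=
  (Complex.measurable_ofReal.comp (measurable_eulerWeight β γ)).mul (by fun_prop)

/-- A margin that keeps `1 - z/(1+v)` away from zero. -/
theorem exists_margin {z : ℂ} (hz : z.re < 1) : ∃ m, 0 < m ∧ m ≤ 1 ∧ z.re < 1 - m := by
  refine ⟨min 1 ((1 - z.re) / 2), lt_min one_pos (by linarith), min_le_left _ _, ?_⟩
  have := min_le_right 1 ((1 - z.re) / 2)
  linarith

theorem integrable_eulerIntegrand {α β γ : ℝ} (hα : 0 ≤ α) (hβ : 0 < β) (hγ : β < γ) {z : ℂ}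
    (hz : z.re < 1) : IntegrableOn (fun v : ℝ =>
      (eulerWeight β γ v : ℂ) * (1 - z / ((1 + v : ℝ) : ℂ)) ^ ((-α : ℝ) : ℂ)) (Ioi 0) := by
  obtain ⟨m, hm0, hm1, hmz⟩ := exists_margin hz
  refine Integrable.mono' ((integral_eulerWeight hβ hγ).1.mul_const (m ^ (-α)))
    (measurable_eulerIntegrand α β γ z).aestronglyMeasurable ?_
  filter_upwards [ae_restrict_mem measurableSet_Ioi] with v hv
  rw [norm_mul, Complex.norm_real, Real.norm_of_nonneg (eulerWeight_pos β γ hv).le]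
  exact mul_le_mul_of_nonneg_left (norm_one_sub_div_cpow_le hα hm0 hm1 hmz.le hv)
    (eulerWeight_pos β γ hv).le

/-- Differentiation under the integral. The variable is complex so that differentiability alone
yields analyticity and convergence of the Taylor series on the unit disc. -/
theorem hasDerivAt_eulerInt {α β γ : ℝ} (hα : 0 ≤ α) (hβ : 0 < β) (hγ : β < γ) {z : ℂ}
    (hz : z.re < 1) :
    HasDerivAt (eulerInt α β γ) ((α : ℂ) * eulerInt (α + 1) (β + 1) (γ + 1) z) z := by
  obtain ⟨m, hm0, hm1, hmz⟩ := exists_margin hz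
  have hs : {y : ℂ | y.re < 1 - m} ∈ 𝓝 z :=
    (isOpen_lt Complex.continuous_re continuous_const).mem_nhds hmz
  have h := (hasDerivAt_integral_of_dominated_loc_of_deriv_le (𝕜 := ℂ)
    (μ := (volume : Measure ℝ).restrict (Ioi 0)) (x₀ := z)
    (F := fun y v => (eulerWeight β γ v : ℂ) * (1 - y / ((1 + v : ℝ) : ℂ)) ^ ((-α : ℝ) : ℂ))
    (F' := fun y v => (α : ℂ) * ((eulerWeight (β + 1) (γ + 1) v : ℂ) *
      (1 - y / ((1 + v : ℝ) : ℂ)) ^ ((-(α + 1) : ℝ) : ℂ)))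
    (bound := fun v => α * (eulerWeight (β + 1) (γ + 1) v * m ^ (-(α + 1)))) hs
    (Eventually.of_forall fun y => (measurable_eulerIntegrand α β γ y).aestronglyMeasurable)
    (integrable_eulerIntegrand hα hβ hγ hz)
    ((measurable_eulerIntegrand (α + 1) (β + 1) (γ + 1) z).const_mul _).aestronglyMeasurable
    ?_ (((integral_eulerWeight (by linarith) (by linarith)).1.mul_const _).const_mul _) ?_).2
  · rw [integral_const_mul] at h
    exact h
  · filter_upwards [ae_restrict_mem measurableSet_Ioi] with v hv y hy
    rw [norm_mul, norm_mul, Complex.norm_real, Complex.norm_real, Real.norm_of_nonneg hα,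
      Real.norm_of_nonneg (eulerWeight_pos _ _ hv).le]
    exact mul_le_mul_of_nonneg_left (mul_le_mul_of_nonneg_left
      (norm_one_sub_div_cpow_le (by linarith) hm0 hm1 (le_of_lt hy) hv) (eulerWeight_pos _ _ hv).le) hα
  · filter_upwards [ae_restrict_mem measurableSet_Ioi] with v hv y hy
    have hv' : (0 : ℝ) < v := hv
    have hre := hm0.trans_le (le_re_one_sub_div hm1 (le_of_lt hy) hv')
    have h1 : HasDerivAt (fun y : ℂ => 1 - y / ((1 + v : ℝ) : ℂ)) (-(1 / ((1 + v : ℝ) : ℂ))) y :=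
      ((hasDerivAt_id y).div_const _).const_sub 1
    have h2 := (h1.cpow_const (c := ((-α : ℝ) : ℂ)) (Or.inl hre)).const_mul (eulerWeight β γ v : ℂ)
    refine h2.congr_deriv ?_
    rw [eulerWeight_succ β γ hv']
    have e : ((-(α + 1) : ℝ) : ℂ) = ((-α : ℝ) : ℂ) - 1 := by push_cast; ring
    rw [e]
    push_cast
    ring

theorem eulerInt_zero {α β γ : ℝ} (hβ : 0 < β) (hγ : β < γ) :
    eulerInt α β γ 0 = ((Real.Gamma (γ - β) * Real.Gamma β / Real.Gamma γ : ℝ) : ℂ) := by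
  rw [← (integral_eulerWeight hβ hγ).2, ← integral_complex_ofReal]
  simp [eulerInt]

theorem isOpen_re_lt_one : IsOpen {z : ℂ | z.re < 1} :=
  isOpen_lt Complex.continuous_re continuous_const

theorem iteratedDeriv_eulerInt {α β γ : ℝ} (hα : 0 ≤ α) (hβ : 0 < β) (hγ : β < γ) (n : ℕ) :
    ∀ z : ℂ, z.re < 1 → iteratedDeriv n (eulerInt α β γ) z =
      (((ascPochhammer ℝ n).eval α : ℝ) : ℂ) * eulerInt (α + n) (β + n) (γ + n) z := by
  induction n with
  | zero => intro z _; simp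
  | succ n ih =>
    intro z hz
    have h1 : iteratedDeriv n (eulerInt α β γ) =ᶠ[𝓝 z]
        fun z => (((ascPochhammer ℝ n).eval α : ℝ) : ℂ) * eulerInt (α + n) (β + n) (γ + n) z :=
      Filter.eventually_of_mem (isOpen_re_lt_one.mem_nhds hz) ih
    have hn : (0 : ℝ) ≤ n := n.cast_nonneg
    rw [iteratedDeriv_succ, h1.deriv_eq, ((hasDerivAt_eulerInt (by linarith) (by linarith)
      (by linarith) hz).const_mul _).deriv, ascPochhammer_succ_eval]
    push_cast
    rw [add_assoc, add_assoc, add_assoc, mul_assoc]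

theorem Gamma_add_nat {s : ℝ} (hs : 0 < s) (n : ℕ) :
    Real.Gamma (s + n) = (ascPochhammer ℝ n).eval s * Real.Gamma s := by
  induction n with
  | zero => simp
  | succ n ih =>
    rw [Nat.cast_succ, ← add_assoc, Real.Gamma_add_one (by positivity), ih, ascPochhammer_succ_eval]
    ring

/-- The real version of Euler's integral. -/
def eulerR (α β γ z : ℝ) : ℝ := (eulerInt α β γ (z : ℂ)).re

theorem eulerR_eq {α β γ z : ℝ} (hz : z < 1) :
    eulerR α β γ z = ∫ v in Ioi (0 : ℝ), eulerWeight β γ v * (1 - z / (1 + v)) ^ (-α) := by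
  have h : eulerInt α β γ (z : ℂ) =
      ((∫ v in Ioi (0 : ℝ), eulerWeight β γ v * (1 - z / (1 + v)) ^ (-α) : ℝ) : ℂ) := by
    rw [← integral_complex_ofReal]
    refine setIntegral_congr_fun measurableSet_Ioi fun v hv => ?_
    have hv' : (0 : ℝ) < v := hv
    have h1 : 0 ≤ 1 - z / (1 + v) := by
      rw [sub_nonneg, div_le_one (by positivity)]
      linarith
    rw [Complex.ofReal_mul, Complex.ofReal_cpow h1]
    push_cast
    rfl
  rw [eulerR, h, Complex.ofReal_re]

theorem integrable_eulerR {α β γ z : ℝ} (hα : 0 ≤ α) (hβ : 0 < β) (hγ : β < γ) (hz : z < 1) :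
    IntegrableOn (fun v => eulerWeight β γ v * (1 - z / (1 + v)) ^ (-α)) (Ioi 0) := by
  have h := (integrable_eulerIntegrand hα hβ hγ (z := (z : ℂ)) (by simpa using hz)).norm
  refine h.congr ?_
  filter_upwards [ae_restrict_mem measurableSet_Ioi] with v hv
  have hv' : (0 : ℝ) < v := hv
  have h1 : 0 ≤ 1 - z / (1 + v) := by
    rw [sub_nonneg, div_le_one (by positivity)]
    linarith
  have e : (1 : ℂ) - (z : ℂ) / ((1 + v : ℝ) : ℂ) = ((1 - z / (1 + v) : ℝ) : ℂ) := by push_cast; rfl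
  rw [norm_mul, Complex.norm_real, Complex.norm_cpow_real, e, Complex.norm_real,
    Real.norm_of_nonneg h1, Real.norm_of_nonneg (eulerWeight_pos β γ hv').le]

theorem hasDerivAt_eulerR {α β γ z : ℝ} (hα : 0 ≤ α) (hβ : 0 < β) (hγ : β < γ) (hz : z < 1) :
    HasDerivAt (eulerR α β γ) (α * eulerR (α + 1) (β + 1) (γ + 1) z) z := by
  have h := (hasDerivAt_eulerInt hα hβ hγ (z := (z : ℂ)) (by simpa using hz)).real_of_complex
  rw [Complex.re_ofReal_mul] at h
  exact h

theorem analyticOnNhd_eulerR {α β γ : ℝ} (hα : 0 ≤ α) (hβ : 0 < β) (hγ : β < γ) :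
    AnalyticOnNhd ℝ (eulerR α β γ) (Iio 1) := by
  intro z hz
  have h1 : DifferentiableOn ℂ (eulerInt α β γ) {z : ℂ | z.re < 1} := fun y hy =>
    (hasDerivAt_eulerInt hα hβ hγ hy).differentiableAt.differentiableWithinAt
  exact (h1.analyticAt (isOpen_re_lt_one.mem_nhds (by simpa using hz))).re_ofReal

/-- The hypergeometric function on `(-∞, 1)` by Euler's integral. -/
def hypF (α β γ z : ℝ) : ℝ :=
  Real.Gamma γ / (Real.Gamma (γ - β) * Real.Gamma β) * eulerR α β γ z

/-- The Taylor coefficients at 0 are Pochhammer symbols times Euler integrals at z = 0, which are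
Beta values; Γ(s+n) = (s)_n Γ(s) turns them into Gauss' coefficients. -/
theorem hypF_eq_ordinaryHypergeometric {α β γ z : ℝ} (hα : 0 ≤ α) (hβ : 0 < β) (hγ : β < γ)
    (hz : z ∈ Ioo (-1 : ℝ) 1) : hypF α β γ z = ordinaryHypergeometric α β γ z := by
  have hG1 := Real.Gamma_pos_of_pos hβ
  have hG2 := Real.Gamma_pos_of_pos (hβ.trans hγ)
  have hG3 := Real.Gamma_pos_of_pos (sub_pos.2 hγ)
  have hball : Metric.ball (0 : ℂ) 1 ⊆ {z : ℂ | z.re < 1} := fun y hy =>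
    (Complex.re_le_norm y).trans_lt (by simpa using hy)
  have h1 : DifferentiableOn ℂ (eulerInt α β γ) (Metric.ball 0 1) := fun y hy =>
    (hasDerivAt_eulerInt hα hβ hγ (hball hy)).differentiableAt.differentiableWithinAt
  have hzb : (z : ℂ) ∈ Metric.ball (0 : ℂ) 1 := by
    rw [mem_ball_zero_iff, Complex.norm_real, Real.norm_eq_abs]
    exact abs_lt.2 hz
  have h2 := Complex.hasSum_re (Complex.hasSum_taylorSeries_on_ball h1 hzb)
  have h3 := (h2.mul_left (Real.Gamma γ / (Real.Gamma (γ - β) * Real.Gamma β))).tsum_eq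
  rw [hypF, eulerR, ← h3, ordinaryHypergeometric_eq_tsum]
  refine tsum_congr fun n => ?_
  have hn : (0 : ℝ) ≤ n := n.cast_nonneg
  have hγ0 : (ascPochhammer ℝ n).eval γ ≠ 0 := (ascPochhammer_pos n γ (hβ.trans hγ)).ne'
  have e : (((n.factorial : ℂ)⁻¹ • ((z : ℂ) - 0) ^ n • iteratedDeriv n (eulerInt α β γ) 0)) =
      (((n.factorial : ℝ)⁻¹ * (z ^ n * ((ascPochhammer ℝ n).eval α *
        (Real.Gamma (γ - β) * Real.Gamma (β + n) / Real.Gamma (γ + n)))) : ℝ) : ℂ) := by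
    rw [iteratedDeriv_eulerInt hα hβ hγ n 0 (by simp), eulerInt_zero (by linarith) (by linarith),
      show γ + n - (β + n) = γ - β by ring]
    simp only [smul_eq_mul, sub_zero]
    push_cast
    rfl
  rw [e, Complex.ofReal_re, Gamma_add_nat hβ, Gamma_add_nat (hβ.trans hγ), smul_eq_mul]
  field_simp

theorem isHypergeometric_hypF {α β γ : ℝ} (hα : 0 ≤ α) (hβ : 0 < β) (hγ : β < γ) :
    IsHypergeometric α β γ (hypF α β γ) :=
  ⟨fun z hz => (analyticAt_const.mul (analyticOnNhd_eulerR hα hβ hγ z hz)),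
    fun _ hz => hypF_eq_ordinaryHypergeometric hα hβ hγ hz⟩

/-! ### The hypergeometric equation and a contiguity relation -/

theorem one_sub_div_pos {z v : ℝ} (hz : z < 1) (hv : 0 < v) : 0 < 1 - z / (1 + v) := by
  rw [sub_pos, div_lt_one (by positivity)]
  linarith

/-- Under the integral this is zt + (1 - zt) = 1 with t = 1/(1+v). Since the z-derivative is α times
the shifted integral, it says that z d/dz + α raises α to α + 1, which is how the radial momentum is
computed. -/
theorem eulerR_contiguous {α β γ z : ℝ} (hα : 0 ≤ α) (hβ : 0 < β) (hγ : β < γ) (hz : z < 1) :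
    z * eulerR (α + 1) (β + 1) (γ + 1) z + eulerR α β γ z = eulerR (α + 1) β γ z := by
  rw [eulerR_eq hz, eulerR_eq hz, eulerR_eq hz, ← integral_const_mul, ← integral_add
    ((integrable_eulerR (by linarith) (by linarith) (by linarith) hz).const_mul z)
    (integrable_eulerR hα hβ hγ hz)]
  refine setIntegral_congr_fun measurableSet_Ioi fun v hv => ?_
  have hv' : (0 : ℝ) < v := hv
  have hq := one_sub_div_pos hz hv'
  have hq' : 1 + v - z ≠ 0 := by linarith
  rw [eulerWeight_succ β γ hv', show -(α + 1) = -α - 1 by ring, Real.rpow_sub_one hq.ne']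
  generalize (1 - z / (1 + v)) ^ (-α) = c
  field_simp
  ring

theorem continuousAt_eulerBoundary_zero {α β γ z : ℝ} (hγ : β < γ) (hz : z < 1) :
    ContinuousAt
      (fun v : ℝ => v ^ (γ - β) * (1 + v) ^ (-γ) * (1 - z / (1 + v)) ^ (-(α + 1))) 0 := by
  refine ((continuousAt_id.rpow_const (Or.inr (sub_nonneg.2 hγ.le))).mul
    (ContinuousAt.rpow_const (by fun_prop) (Or.inl (by norm_num)))).mul
    (ContinuousAt.rpow_const ?_ (Or.inl ?_))
  · exact continuousAt_const.sub (continuousAt_const.div (by fun_prop) (by norm_num))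
  · simp only [add_zero, div_one]
    linarith

theorem tendsto_eulerBoundary_atTop {α β γ z : ℝ} (hβ : 0 < β) (hγ : β < γ) :
    Tendsto (fun v : ℝ => v ^ (γ - β) * (1 + v) ^ (-γ) * (1 - z / (1 + v)) ^ (-(α + 1)))
      atTop (𝓝 0) := by
  have h1 : Tendsto (fun v : ℝ => 1 + v) atTop atTop := tendsto_atTop_add_const_left _ _ tendsto_id
  have h2 : Tendsto (fun v : ℝ => 1 - z / (1 + v)) atTop (𝓝 (1 - 0)) :=
    tendsto_const_nhds.sub (tendsto_const_nhds.div_atTop h1)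
  rw [sub_zero] at h2
  have h3 := h2.rpow_const (p := -(α + 1)) (Or.inl one_ne_zero)
  have h4 : Tendsto (fun v : ℝ => v ^ (γ - β) * (1 + v) ^ (-γ)) atTop (𝓝 0) := by
    refine squeeze_zero' ?_ ?_ ((tendsto_rpow_neg_atTop hβ).comp h1)
    · filter_upwards [eventually_gt_atTop 0] with v hv
      positivity
    · filter_upwards [eventually_gt_atTop 0] with v hv
      calc v ^ (γ - β) * (1 + v) ^ (-γ) ≤ (1 + v) ^ (γ - β) * (1 + v) ^ (-γ) := by
            gcongr
            linarith
        _ = ((fun x : ℝ => x ^ (-β)) ∘ fun v => 1 + v) v := by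
            rw [← Real.rpow_add (by positivity), Function.comp_apply]
            ring_nf
  simpa using h4.mul h3

/-- The primitive behind the hypergeometric equation; in t = 1/(1+v) it is t^β (1-t)^(γ-β)
(1-zt)^(-α-1). -/
theorem hasDerivAt_eulerBoundary (α β γ : ℝ) {z v : ℝ} (hz : z < 1) (hv : 0 < v) :
    HasDerivAt (fun v : ℝ => v ^ (γ - β) * (1 + v) ^ (-γ) * (1 - z / (1 + v)) ^ (-(α + 1)))
      (z * (1 - z) * (α + 1) * (eulerWeight (β + 1 + 1) (γ + 1 + 1) v *
          (1 - z / (1 + v)) ^ (-(α + 1 + 1))) +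
        (γ - (α + β + 1) * z) * (eulerWeight (β + 1) (γ + 1) v *
          (1 - z / (1 + v)) ^ (-(α + 1))) -
        β * (eulerWeight β γ v * (1 - z / (1 + v)) ^ (-α))) v := by
  have hq := one_sub_div_pos hz hv
  have hv1 : (0 : ℝ) < 1 + v := by positivity
  have h1 := Real.hasDerivAt_rpow_const (x := v) (p := γ - β) (Or.inl hv.ne')
  have h0 : HasDerivAt (fun v : ℝ => 1 + v) 1 v := (hasDerivAt_id v).const_add 1
  have h2 := h0.rpow_const (p := -γ) (Or.inl hv1.ne')
  have h3 : HasDerivAt (fun v : ℝ => 1 - z / (1 + v)) (z / (1 + v) ^ 2) v := by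
    have := ((hasDerivAt_const v z).div h0 hv1.ne').const_sub 1
    exact this.congr_deriv (by ring)
  have h4 := h3.rpow_const (p := -(α + 1)) (Or.inl hq.ne')
  refine ((h1.mul h2).mul h4).congr_deriv ?_
  have e1 : v ^ (γ - β) = v ^ (γ - β - 1) * v := by
    rw [← Real.rpow_add_one hv.ne', sub_add_cancel]
  rw [Pi.mul_apply, eulerWeight_succ (β + 1) (γ + 1) hv, eulerWeight_succ β γ hv, eulerWeight, e1,
    show -(α + 1 + 1) = -α - 1 - 1 by ring, show -(α + 1) = -α - 1 by ring,
    Real.rpow_sub_one hv1.ne' (-γ), Real.rpow_sub_one hq.ne' (-α - 1),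
    Real.rpow_sub_one hq.ne' (-α)]
  have hq' : 1 + v - z ≠ 0 := by linarith
  generalize v ^ (γ - β - 1) = a at *
  generalize (1 + v) ^ (-γ) = b at *
  generalize (1 - z / (1 + v)) ^ (-α) = c at *
  field_simp
  ring

/-- The integrand is a total derivative whose boundary values vanish, at v = 0 because β < γ and at
infinity because β > 0. It is the hypergeometric equation with a common factor α removed. -/
theorem eulerR_ode {α β γ z : ℝ} (hα : 0 ≤ α) (hβ : 0 < β) (hγ : β < γ) (hz : z < 1) :
    z * (1 - z) * (α + 1) * eulerR (α + 1 + 1) (β + 1 + 1) (γ + 1 + 1) z +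
      (γ - (α + β + 1) * z) * eulerR (α + 1) (β + 1) (γ + 1) z - β * eulerR α β γ z = 0 := by
  have i2 := (integrable_eulerR (α := α + 1 + 1) (β := β + 1 + 1) (γ := γ + 1 + 1) (by linarith)
    (by linarith) (by linarith) hz).const_mul (z * (1 - z) * (α + 1))
  have i1 := (integrable_eulerR (α := α + 1) (β := β + 1) (γ := γ + 1) (by linarith)
    (by linarith) (by linarith) hz).const_mul (γ - (α + β + 1) * z)
  have i0 := (integrable_eulerR hα hβ hγ hz).const_mul β
  have i21 : IntegrableOn (fun v => z * (1 - z) * (α + 1) *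
        (eulerWeight (β + 1 + 1) (γ + 1 + 1) v * (1 - z / (1 + v)) ^ (-(α + 1 + 1))) +
      (γ - (α + β + 1) * z) * (eulerWeight (β + 1) (γ + 1) v * (1 - z / (1 + v)) ^ (-(α + 1))))
      (Ioi 0) := i2.add i1
  have h := integral_Ioi_of_hasDerivAt_of_tendsto
    (continuousAt_eulerBoundary_zero hγ hz).continuousWithinAt
    (fun v hv => hasDerivAt_eulerBoundary α β γ hz hv) (i21.sub i0)
    (tendsto_eulerBoundary_atTop hβ hγ)
  rw [integral_sub i21 i0, integral_add i2 i1, integral_const_mul, integral_const_mul,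
    integral_const_mul, ← eulerR_eq hz, ← eulerR_eq hz, ← eulerR_eq hz,
    Real.zero_rpow (sub_pos.2 hγ).ne', zero_mul, zero_mul, sub_zero] at h
  exact h

/-! ### Asymptotics of Euler's integral at `-∞` -/

theorem eulerWeight_mul_rpow (α β γ : ℝ) {v : ℝ} (hv : 0 < v) :
    eulerWeight β γ v * (1 + v) ^ α = eulerWeight (β - α) (γ - α) v := by
  rw [eulerWeight, eulerWeight, mul_assoc, ← Real.rpow_add (by positivity)]
  ring_nf

/-- X^α (1 + X/(1+v))^(-α) increases to (1+v)^α; this limit is integrable against the weight because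
α < β, and so dominates. -/
theorem tendsto_rpow_mul_eulerR_of_lt {α β γ : ℝ} (hα : 0 ≤ α) (hβ : α < β) (hγ : β < γ) :
    Tendsto (fun X : ℝ => X ^ α * eulerR α β γ (-X)) atTop
      (𝓝 (Real.Gamma (γ - β) * Real.Gamma (β - α) / Real.Gamma (γ - α))) := by
  obtain ⟨hi, he⟩ := integral_eulerWeight (sub_pos.2 hβ) (sub_lt_sub_right hγ α)
  rw [sub_sub_sub_cancel_right] at he
  rw [← he]
  have h : Tendsto (fun X : ℝ => ∫ v in Ioi (0 : ℝ),
      eulerWeight β γ v * (1 / X + 1 / (1 + v)) ^ (-α)) atTop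
      (𝓝 (∫ v in Ioi (0 : ℝ), eulerWeight (β - α) (γ - α) v)) := by
    refine tendsto_integral_filter_of_dominated_convergence (eulerWeight (β - α) (γ - α))
      (Eventually.of_forall fun X => ?_) ?_ hi ?_
    · exact ((measurable_eulerWeight β γ).mul (by fun_prop)).aestronglyMeasurable
    · filter_upwards [eventually_gt_atTop 0] with X hX
      filter_upwards [ae_restrict_mem measurableSet_Ioi] with v hv
      have hv' : (0 : ℝ) < v := hv
      have hw := eulerWeight_pos β γ hv'
      rw [Real.norm_of_nonneg (by positivity), ← eulerWeight_mul_rpow α β γ hv']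
      refine mul_le_mul_of_nonneg_left ?_ hw.le
      calc (1 / X + 1 / (1 + v)) ^ (-α) ≤ (1 / (1 + v)) ^ (-α) :=
            Real.rpow_le_rpow_of_nonpos (by positivity)
              (le_add_of_nonneg_left (by positivity)) (by linarith)
        _ = (1 + v) ^ α := by
            rw [one_div, Real.inv_rpow (by positivity), Real.rpow_neg (by positivity), inv_inv]
    · filter_upwards [ae_restrict_mem measurableSet_Ioi] with v hv
      have hv' : (0 : ℝ) < v := hv
      rw [← eulerWeight_mul_rpow α β γ hv']
      refine Tendsto.const_mul _ ?_
      have h0 : Tendsto (fun X : ℝ => 1 / X + 1 / (1 + v)) atTop (𝓝 (0 + 1 / (1 + v))) :=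
        (tendsto_const_nhds.div_atTop tendsto_id).add tendsto_const_nhds
      rw [zero_add] at h0
      have h1 := h0.rpow_const (p := -α) (Or.inl (by positivity))
      rwa [one_div (1 + v), Real.inv_rpow (by positivity), Real.rpow_neg (by positivity), inv_inv,
        ← one_div] at h1
  refine h.congr' ?_
  filter_upwards [eventually_gt_atTop 0] with X hX
  rw [eulerR_eq (by linarith), ← integral_const_mul]
  refine setIntegral_congr_fun measurableSet_Ioi fun v hv => ?_
  have hv' : (0 : ℝ) < v := hv
  have e : 1 - -X / (1 + v) = X * (1 / X + 1 / (1 + v)) := by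
    field_simp
    ring
  have e1 : X ^ α * X ^ (-α) = 1 := by rw [← Real.rpow_add hX, add_neg_cancel, Real.rpow_zero]
  rw [e, Real.mul_rpow hX.le (by positivity)]
  linear_combination -(eulerWeight β γ v * (1 / X + 1 / (1 + v)) ^ (-α)) * e1

/-- For β < α the integral is governed by v of order X, hence the substitution v = Xw; all powers of
X then cancel. -/
theorem scaled_eulerIntegrand (α β γ : ℝ) {X w : ℝ} (hX : 0 < X) (hw : 0 < w) :
    X ^ (β + 1) * (eulerWeight β γ (X * w) * (1 - -X / (1 + X * w)) ^ (-α)) =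
      w ^ (γ - β - 1) * ((1 / X + w) ^ (α - γ) * (1 + (1 / X + w)) ^ (-α)) := by
  have hy : 0 < 1 / X + w := by positivity
  have e1 : 1 + X * w = X * (1 / X + w) := by field_simp
  have e2 : 1 - -X / (1 + X * w) = (1 + (1 / X + w)) / (1 / X + w) := by
    field_simp
    ring
  have e3 : X ^ (β + 1) * X ^ (γ - β - 1) * X ^ (-γ) = 1 := by
    rw [← Real.rpow_add hX, ← Real.rpow_add hX]
    ring_nf
    exact Real.rpow_zero X
  rw [e2, eulerWeight, e1]
  generalize 1 / X + w = y at hy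
  rw [Real.mul_rpow hX.le hw.le, Real.mul_rpow hX.le hy.le,
    Real.div_rpow (by positivity) hy.le, Real.rpow_neg hy.le α, div_inv_eq_mul,
    show α - γ = -γ + α by ring, Real.rpow_add hy]
  linear_combination
    (w ^ (γ - β - 1) * (y ^ (-γ) * y ^ α * (1 + y) ^ (-α))) * e3

theorem tendsto_rpow_mul_eulerR_of_gt {α β γ : ℝ} (hβ0 : 0 < β) (hβ : β < α) (hγ : β < γ) :
    Tendsto (fun X : ℝ => X ^ β * eulerR α β γ (-X)) atTop
      (𝓝 (Real.Gamma (α - β) * Real.Gamma β / Real.Gamma α)) := by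
  obtain ⟨hi, he⟩ := integral_eulerWeight hβ0 hβ
  rw [← he]
  have h : Tendsto (fun X : ℝ => ∫ w in Ioi (0 : ℝ),
      w ^ (γ - β - 1) * ((1 / X + w) ^ (α - γ) * (1 + (1 / X + w)) ^ (-α))) atTop
      (𝓝 (∫ w in Ioi (0 : ℝ), eulerWeight β α w)) := by
    refine tendsto_integral_filter_of_dominated_convergence
      (fun w => eulerWeight β α w + eulerWeight β γ w)
      (Eventually.of_forall fun X => ?_) ?_ (hi.add (integral_eulerWeight hβ0 hγ).1) ?_
    · exact Measurable.aestronglyMeasurable (by fun_prop)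
    · filter_upwards [eventually_ge_atTop 1] with X hX
      have hX0 : 0 < X := by linarith
      have hX1 : 1 / X ≤ 1 := by
        rw [div_le_one hX0]
        exact hX
      filter_upwards [ae_restrict_mem measurableSet_Ioi] with w hw
      have hw' : (0 : ℝ) < w := hw
      have hX2 : 0 < 1 / X := by positivity
      rw [Real.norm_of_nonneg (by positivity)]
      -- The sign of α - γ is unknown, so the bounds for both signs are added; each summand yields
      -- one Euler weight.
      have b1 : (1 / X + w) ^ (α - γ) ≤ w ^ (α - γ) + (1 + w) ^ (α - γ) := by
        rcases le_total (α - γ) 0 with hn | hn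
        · refine (Real.rpow_le_rpow_of_nonpos hw' (by linarith) hn).trans ?_
          exact le_add_of_nonneg_right (by positivity)
        · refine (Real.rpow_le_rpow (add_pos hX2 hw').le
            (add_le_add_left hX1 w) hn).trans ?_
          exact le_add_of_nonneg_left (by positivity)
      have b2 : (1 + (1 / X + w)) ^ (-α) ≤ (1 + w) ^ (-α) :=
        Real.rpow_le_rpow_of_nonpos (by positivity) (by linarith) (by linarith)
      calc _ ≤ w ^ (γ - β - 1) * ((w ^ (α - γ) + (1 + w) ^ (α - γ)) * (1 + w) ^ (-α)) := by
            gcongr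
        _ = w ^ (γ - β - 1) * w ^ (α - γ) * (1 + w) ^ (-α) +
            w ^ (γ - β - 1) * ((1 + w) ^ (α - γ) * (1 + w) ^ (-α)) := by ring
        _ = eulerWeight β α w + eulerWeight β γ w := by
            rw [← Real.rpow_add hw', ← Real.rpow_add (by positivity), eulerWeight, eulerWeight]
            ring_nf
    · filter_upwards [ae_restrict_mem measurableSet_Ioi] with w hw
      have hw' : (0 : ℝ) < w := hw
      have h0 : Tendsto (fun X : ℝ => 1 / X + w) atTop (𝓝 (0 + w)) :=
        (tendsto_const_nhds.div_atTop tendsto_id).add tendsto_const_nhds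
      rw [zero_add] at h0
      have h1 := (h0.rpow_const (p := α - γ) (Or.inl hw'.ne')).mul
        ((h0.const_add 1).rpow_const (p := -α) (Or.inl (by positivity)))
      convert! h1.const_mul (w ^ (γ - β - 1)) using 2
      rw [← mul_assoc, ← Real.rpow_add hw', eulerWeight]
      ring_nf
  refine h.congr' ?_
  filter_upwards [eventually_gt_atTop 0] with X hX
  have hs := integral_comp_mul_left_Ioi
    (fun v => eulerWeight β γ v * (1 - -X / (1 + v)) ^ (-α)) 0 hX
  rw [mul_zero, smul_eq_mul] at hs
  rw [eulerR_eq (by linarith), ← mul_inv_cancel_left₀ hX.ne'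
    (∫ v in Ioi (0 : ℝ), eulerWeight β γ v * (1 - -X / (1 + v)) ^ (-α)), ← hs,
    ← mul_assoc, ← Real.rpow_add_one hX.ne', ← integral_const_mul]
  exact setIntegral_congr_fun measurableSet_Ioi fun w hw =>
    (scaled_eulerIntegrand α β γ hX hw).symm

/-! ### The Klein-Gordon equation -/

/-- Radial functions are taken as functions of ‖y‖², which is smooth, so the origin needs no
separate treatment. -/
theorem laplacian_comp_normSq {h h1 h2 : ℝ → ℝ} (H1 : ∀ s, 0 ≤ s → HasDerivAt h (h1 s) s)
    (H2 : ∀ s, 0 ≤ s → HasDerivAt h1 (h2 s) s) (x : Bdry d) :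
    Laplacian.laplacian (fun y : Bdry d => h (‖y‖ ^ 2)) x =
      4 * ‖x‖ ^ 2 * h2 (‖x‖ ^ 2) + 2 * d * h1 (‖x‖ ^ 2) := by
  have hN : ∀ y : Bdry d, HasFDerivAt (fun y : Bdry d => ‖y‖ ^ 2) (2 • innerSL ℝ y) y :=
    fun y => (hasStrictFDerivAt_norm_sq y).hasFDerivAt
  have hf : fderiv ℝ (fun y : Bdry d => h (‖y‖ ^ 2)) =
      fun y => (2 * h1 (‖y‖ ^ 2)) • innerSL ℝ y := by
    funext y
    have := ((H1 _ (sq_nonneg ‖y‖)).comp_hasFDerivAt y (hN y)).fderiv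
    rw [Function.comp_def] at this
    rw [this]
    ext v
    simp
    ring
  have hc : HasFDerivAt (fun y : Bdry d => 2 * h1 (‖y‖ ^ 2))
      ((4 * h2 (‖x‖ ^ 2)) • innerSL ℝ x) x := by
    have := ((H2 _ (sq_nonneg ‖x‖)).comp_hasFDerivAt x (hN x)).const_mul 2
    refine this.congr_fderiv ?_
    ext v
    simp
    ring
  have hf2 := (hc.smul (innerSL ℝ (E := Bdry d)).hasFDerivAt).fderiv
  set v := EuclideanSpace.basisFun (Fin d) ℝ
  rw [InnerProductSpace.laplacian_eq_iteratedFDeriv_orthonormalBasis _ v]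
  have hs : ∑ i, inner ℝ x (v i) ^ 2 = ‖x‖ ^ 2 := by
    have := v.sum_sq_norm_inner_left x
    simpa using this
  calc _ = ∑ i, (2 * h1 (‖x‖ ^ 2) + 4 * h2 (‖x‖ ^ 2) * inner ℝ x (v i) ^ 2) := by
        refine Finset.sum_congr rfl fun i _ => ?_
        rw [iteratedFDeriv_two_apply, hf]
        erw [hf2]
        have hv : inner ℝ (v i) (v i) = (1 : ℝ) := by simp
        change 2 * h1 (‖x‖ ^ 2) * inner ℝ (v i) (v i) +
          4 * h2 (‖x‖ ^ 2) * inner ℝ x (v i) * inner ℝ x (v i) = _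
        rw [hv]
        ring
    _ = _ := by
        rw [Finset.sum_add_distrib, ← Finset.mul_sum _ _ (4 * h2 (‖x‖ ^ 2)), hs,
          Finset.sum_const, Finset.card_univ, Fintype.card_fin, nsmul_eq_mul]
        ring

/-- The argument z of G satisfies ∂_r z = 2z/l, so l∂_r acts as 2z d/dz - κ and preserves the shape;
a second application gives the second derivative. -/
theorem hasDerivAt_bulk (A κ l N : ℝ) {r g : ℝ} {G : ℝ → ℝ}
    (hG : HasDerivAt G g (-(1 / l ^ 2 * Real.exp (2 * r / l) * N))) :
    HasDerivAt (fun s => A * Real.exp (-(κ * (s / l))) *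
        G (-(1 / l ^ 2 * Real.exp (2 * s / l) * N)))
      (A / l * Real.exp (-(κ * (r / l))) * (2 * -(1 / l ^ 2 * Real.exp (2 * r / l) * N) * g -
        κ * G (-(1 / l ^ 2 * Real.exp (2 * r / l) * N)))) r := by
  have h1 : HasDerivAt (fun s => Real.exp (-(κ * (s / l))))
      (Real.exp (-(κ * (r / l))) * -(κ * (1 / l))) r :=
    (((hasDerivAt_id r).div_const l).const_mul κ).neg.exp
  have h2 : HasDerivAt (fun s => Real.exp (2 * s / l)) (Real.exp (2 * r / l) * (2 * 1 / l)) r :=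
    (((hasDerivAt_id r).const_mul 2).div_const l).exp
  have h3 : HasDerivAt (fun s => -(1 / l ^ 2 * Real.exp (2 * s / l) * N))
      (-(1 / l ^ 2 * (Real.exp (2 * r / l) * (2 * 1 / l)) * N)) r :=
    ((h2.const_mul (1 / l ^ 2)).mul_const N).neg
  refine ((h1.const_mul A).mul (hG.comp r h3)).congr_deriv ?_
  simp only [Function.comp_apply]
  ring

/-- With θ = z d/dz, l² times the radial part is (2θ - κ)² + d(2θ - κ), and the Laplacian
contributes -4zF'' - 2dF'. Since κ(κ - d) - m²l² = 4αβ, the sum minus m²l²F is -4 times the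
hypergeometric operator. -/
theorem solvesKleinGordon_of_ode {α β κ ν l A : ℝ} {F F1 F2 : ℝ → ℝ} (hl : l ≠ 0)
    (hF : AnalyticOnNhd ℝ F (Iio 1))
    (H1 : ∀ z < 1, HasDerivAt F (F1 z) z) (H2 : ∀ z < 1, HasDerivAt F1 (F2 z) z)
    (hode : ∀ z < 1, z * (1 - z) * F2 z + ((d : ℝ) / 2 - (α + β + 1) * z) * F1 z -
      α * β * F z = 0)
    (hκ : κ = (d : ℝ) / 2 - (α + β)) (hν : β = α + ν) :
    SolvesKleinGordon (d := d) l (massSq d ν l) fun r x =>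
      A * Real.exp (-(κ * (r / l))) * F (-(1 / l ^ 2 * Real.exp (2 * r / l) * ‖x‖ ^ 2)) := by
  have hz : ∀ (r : ℝ) (x : Bdry d), -(1 / l ^ 2 * Real.exp (2 * r / l) * ‖x‖ ^ 2) < 1 := by
    intro r x
    have : 0 ≤ 1 / l ^ 2 * Real.exp (2 * r / l) * ‖x‖ ^ 2 := by positivity
    linarith
  refine ⟨?_, fun r x => ?_⟩
  · rw [contDiff_iff_contDiffAt]
    intro q
    refine ContDiffAt.mul (ContDiff.contDiffAt (by fun_prop)) ?_
    exact ContDiffAt.comp (g := F)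
      (f := fun q : ℝ × Bdry d => -(1 / l ^ 2 * Real.exp (2 * q.1 / l) * ‖q.2‖ ^ 2)) q
      (hF _ (hz q.1 q.2)).contDiffAt
      (ContDiff.contDiffAt (((contDiff_const.mul (by fun_prop)).mul
        (contDiff_snd.norm_sq ℝ)).neg))
  have hG : ∀ z < 1, HasDerivAt (fun z => 2 * z * F1 z - κ * F z)
      (2 * F1 z + 2 * z * F2 z - κ * F1 z) z := by
    intro z hz1
    refine ((((hasDerivAt_id z).const_mul 2).mul (H2 z hz1)).sub
      ((H1 z hz1).const_mul κ)).congr_deriv ?_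
    simp
  have hr1 : ∀ s, deriv (fun t => A * Real.exp (-(κ * (t / l))) *
      F (-(1 / l ^ 2 * Real.exp (2 * t / l) * ‖x‖ ^ 2))) s = _ :=
    fun s => (hasDerivAt_bulk A κ l _ (H1 _ (hz s x))).deriv
  have hE : HasDerivAt (fun s => Real.exp (d * s / l)) (Real.exp (d * r / l) * (d * 1 / l)) r :=
    (((hasDerivAt_id r).const_mul _).div_const l).exp
  have hr2 := hE.mul (hasDerivAt_bulk (A / l) κ l (‖x‖ ^ 2) (hG _ (hz r x)))
  have hL := laplacian_comp_normSq (d := d)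
    (h := fun s => A * Real.exp (-(κ * (r / l))) * F (-(1 / l ^ 2 * Real.exp (2 * r / l) * s)))
    (h1 := fun s => A * Real.exp (-(κ * (r / l))) *
      (F1 (-(1 / l ^ 2 * Real.exp (2 * r / l) * s)) * -(1 / l ^ 2 * Real.exp (2 * r / l))))
    (h2 := fun s => A * Real.exp (-(κ * (r / l))) *
      (F2 (-(1 / l ^ 2 * Real.exp (2 * r / l) * s)) * -(1 / l ^ 2 * Real.exp (2 * r / l)) *
        -(1 / l ^ 2 * Real.exp (2 * r / l)))) ?_ ?_ x
  · rw [hL]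
    simp only [hr1]
    erw [hr2.deriv]
    have e1 : Real.exp (-(d * r / l)) = (Real.exp (d * r / l))⁻¹ := Real.exp_neg _
    have e2 : Real.exp (-(2 * r / l)) = (Real.exp (2 * r / l))⁻¹ := Real.exp_neg _
    have ho := hode _ (hz r x)
    have p1 := (Real.exp_pos (d * r / l)).ne'
    have p2 := (Real.exp_pos (2 * r / l)).ne'
    rw [e1, e2, massSq, deltaPlus]
    generalize Real.exp (d * r / l) = y1 at *
    generalize Real.exp (2 * r / l) = y2 at *
    generalize Real.exp (-(κ * (r / l))) = y3 at *
    set z := -(1 / l ^ 2 * y2 * ‖x‖ ^ 2) with hzd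
    have hN : ‖x‖ ^ 2 = -(z * l ^ 2 / y2) := by
      rw [hzd]
      field_simp
    rw [hN]
    generalize F z = f0 at *
    generalize F1 z = f1 at *
    generalize F2 z = f2 at *
    clear_value z
    subst hκ hν
    field_simp
    linear_combination (16 * A * y3) * ho
  · intro s hs
    have hz' : -(1 / l ^ 2 * Real.exp (2 * r / l) * s) < 1 := by
      have : 0 ≤ 1 / l ^ 2 * Real.exp (2 * r / l) * s := by positivity
      linarith
    have h3 : HasDerivAt (fun s => -(1 / l ^ 2 * Real.exp (2 * r / l) * s))
        (-(1 / l ^ 2 * Real.exp (2 * r / l) * 1)) s := ((hasDerivAt_id s).const_mul _).neg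
    rw [mul_one] at h3
    exact ((H1 _ hz').comp s h3).const_mul _
  · intro s hs
    have hz' : -(1 / l ^ 2 * Real.exp (2 * r / l) * s) < 1 := by
      have : 0 ≤ 1 / l ^ 2 * Real.exp (2 * r / l) * s := by positivity
      linarith
    have h3 : HasDerivAt (fun s => -(1 / l ^ 2 * Real.exp (2 * r / l) * s))
        (-(1 / l ^ 2 * Real.exp (2 * r / l) * 1)) s := ((hasDerivAt_id s).const_mul _).neg
    rw [mul_one] at h3
    exact (((H2 _ hz').comp s h3).mul_const _).const_mul _

/-! ### The Bessel function as a superposition of Gaussians -/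

theorem integrableOn_rpow_mul_exp_add_inv {ν r : ℝ} (hν : 0 < ν) (hr : 0 < r) :
    IntegrableOn (fun s : ℝ => s ^ (-ν - 1) * Real.exp (-(s + r / s))) (Ioi 0) := by
  refine (integrableOn_rpow_mul_exp_inv hν hr).mono' (Measurable.aestronglyMeasurable (by fun_prop))
    ?_
  filter_upwards [ae_restrict_mem measurableSet_Ioi] with s hs
  have hs' : (0 : ℝ) < s := hs
  rw [Real.norm_of_nonneg (by positivity)]
  gcongr
  linarith

theorem image_exp_univ {a : ℝ} (ha : 0 < a) : (fun t => a * Real.exp t) '' univ = Ioi 0 := by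
  ext s
  simp only [image_univ, mem_range, mem_Ioi]
  constructor
  · rintro ⟨t, rfl⟩
    positivity
  · intro hs
    exact ⟨Real.log (s / a), by rw [Real.exp_log (by positivity)]; field_simp⟩

theorem integral_rpow_mul_exp_add_inv {ν z : ℝ} (hν : 0 < ν) (hz : 0 < z) :
    ∫ s in Ioi (0 : ℝ), s ^ (-ν - 1) * Real.exp (-(s + z ^ 2 / 4 / s)) =
      2 * (z / 2) ^ (-ν) * besselK ν z := by
  have hz2 : 0 < z / 2 := by positivity
  have hd : ∀ t ∈ univ, HasDerivWithinAt (fun t => z / 2 * Real.exp t) (z / 2 * Real.exp t) univ t :=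
    fun t _ => ((Real.hasDerivAt_exp t).const_mul _).hasDerivWithinAt
  have hinj : InjOn (fun t => z / 2 * Real.exp t) univ := fun s _ t _ h =>
    Real.exp_injective (mul_left_cancel₀ hz2.ne' h)
  -- The substitution s = (z/2)e^t turns s + z²/(4s) into z cosh t; folding t ↦ -t afterwards turns
  -- e^(-νt) into 2 cosh(νt).
  have hg : ∀ t : ℝ, |z / 2 * Real.exp t| • ((z / 2 * Real.exp t) ^ (-ν - 1) *
      Real.exp (-(z / 2 * Real.exp t + z ^ 2 / 4 / (z / 2 * Real.exp t)))) =
      (z / 2) ^ (-ν) * (Real.exp (-(z * Real.cosh t)) * Real.exp (-(ν * t))) := by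
    intro t
    have h1 : 0 < z / 2 * Real.exp t := by positivity
    have h2 : Real.exp (-(ν * t)) = Real.exp t ^ (-ν) := by
      rw [← Real.exp_mul]
      ring_nf
    have h3 : z / 2 * Real.exp t + z ^ 2 / 4 / (z / 2 * Real.exp t) = z * Real.cosh t := by
      rw [Real.cosh_eq, Real.exp_neg]
      field_simp
      ring
    rw [abs_of_pos h1, smul_eq_mul, h3, h2, ← mul_assoc, mul_comm (z / 2 * Real.exp t),
      ← Real.rpow_add_one h1.ne', sub_add_cancel, Real.mul_rpow hz2.le (Real.exp_pos t).le]
    ring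
  have hI := integrableOn_rpow_mul_exp_add_inv hν (r := z ^ 2 / 4) (by positivity)
  rw [← image_exp_univ hz2] at hI ⊢
  rw [integrableOn_image_iff_integrableOn_abs_deriv_smul MeasurableSet.univ hd hinj] at hI
  rw [integral_image_eq_integral_abs_deriv_smul MeasurableSet.univ hd hinj]
  simp only [hg] at hI ⊢
  rw [integrableOn_univ, integrable_const_mul_iff (Ne.isUnit (by positivity))] at hI
  have hsplit := intervalIntegral.integral_Iic_add_Ioi (b := (0 : ℝ)) hI.integrableOn
    hI.integrableOn
  have hneg := integral_comp_neg_Ioi (0 : ℝ)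
    fun t => Real.exp (-(z * Real.cosh t)) * Real.exp (-(ν * t))
  rw [neg_zero] at hneg
  rw [setIntegral_univ, integral_const_mul, ← hsplit, ← hneg,
    ← integral_add hI.comp_neg.integrableOn hI.integrableOn, besselK, mul_comm 2, mul_assoc,
    ← integral_const_mul (2 : ℝ)]
  congr 1
  refine integral_congr_ae (Eventually.of_forall fun t => ?_)
  simp only [Real.cosh_neg, Real.cosh_eq (ν * t)]
  ring_nf

/-- The measure on the parameter space of the superposition. -/
abbrev mixMeasure : Measure (ℝ × ℝ) :=
  ((volume : Measure ℝ).restrict (Ioi 0)).prod ((volume : Measure ℝ).restrict (Ioi 0))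

theorem ae_mixMeasure : ∀ᵐ t ∂mixMeasure, 0 < t.1 ∧ 0 < t.2 := by
  rw [mixMeasure, Measure.prod_restrict]
  filter_upwards [ae_restrict_mem (measurableSet_Ioi.prod measurableSet_Ioi)] with t ht
  exact ht

/-- The inverse width of the Gaussians. -/
def mixRate (ε : ℝ) (t : ℝ × ℝ) : ℝ := ε ^ 2 * (1 + t.2) / (4 * t.1)

/-- The weight of the Gaussians. -/
def mixWeight (γ α ν : ℝ) (t : ℝ × ℝ) : ℝ :=
  t.1 ^ (α - γ - 1) * Real.exp (-t.1) * t.2 ^ (γ - α - ν - 1)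

theorem mixRate_pos {ε : ℝ} (hε : 0 < ε) {t : ℝ × ℝ} (h : 0 < t.1 ∧ 0 < t.2) :
    0 < mixRate ε t := by
  obtain ⟨h1, h2⟩ := h
  unfold mixRate
  positivity

theorem mixWeight_pos (γ α ν : ℝ) {t : ℝ × ℝ} (h : 0 < t.1 ∧ 0 < t.2) :
    0 < mixWeight γ α ν t := by
  obtain ⟨h1, h2⟩ := h
  unfold mixWeight
  positivity

/-- After the Fourier transform of the Gaussians, with t = (s, v), the mixture is a Gamma integrand
in s with exponent α, at a rate depending on v, times the Euler weight in v. -/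
theorem mixWeight_mul (γ α ν : ℝ) {ε : ℝ} (hε : 0 < ε) (N : ℝ) {t : ℝ × ℝ}
    (h : 0 < t.1 ∧ 0 < t.2) :
    mixWeight γ α ν t * ((Real.pi / mixRate ε t) ^ γ * Real.exp (-(N / (4 * mixRate ε t)))) =
      (4 * Real.pi / ε ^ 2) ^ γ * (t.1 ^ (α - 1) *
        Real.exp (-((1 - -(N / ε ^ 2) / (1 + t.2)) * t.1)) * eulerWeight (α + ν) γ t.2) := by
  obtain ⟨h1, h2⟩ := h
  have e1 : Real.pi / mixRate ε t = 4 * Real.pi / ε ^ 2 * (t.1 * (1 + t.2)⁻¹) := by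
    unfold mixRate
    field_simp
  have e2 : Real.exp (-t.1) * Real.exp (-(N / (4 * mixRate ε t))) =
      Real.exp (-((1 - -(N / ε ^ 2) / (1 + t.2)) * t.1)) := by
    rw [← Real.exp_add]
    unfold mixRate
    congr 1
    field_simp
    ring
  have e3 : t.1 ^ (α - γ - 1) * t.1 ^ γ = t.1 ^ (α - 1) := by
    rw [← Real.rpow_add h1]
    ring_nf
  rw [← e2, ← e3, e1, Real.mul_rpow (by positivity) (by positivity),
    Real.mul_rpow h1.le (by positivity), Real.inv_rpow (by positivity),
    ← Real.rpow_neg (by positivity), mixWeight, eulerWeight, ← sub_sub γ α ν]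
  ring

theorem integrable_mixWeight_mul {γ α ν ε : ℝ} (hα : 0 < α) (hν : 0 < ν) (hγ : α + ν < γ)
    (hε : 0 < ε) :
    Integrable (fun t => mixWeight γ α ν t * (Real.pi / mixRate ε t) ^ γ) mixMeasure := by
  have h1 := integrableOn_rpow_mul_exp hα one_pos
  have h2 := (integral_eulerWeight (β := α + ν) (by linarith) hγ).1
  refine ((h1.mul_prod h2).const_mul ((4 * Real.pi / ε ^ 2) ^ γ)).congr ?_
  filter_upwards [ae_mixMeasure] with t ht
  have := mixWeight_mul γ α ν hε 0 ht
  simpa using this.symm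

theorem integral_mixWeight_mul {γ α ν ε : ℝ} (hα : 0 < α) (hν : 0 < ν) (hγ : α + ν < γ)
    (hε : 0 < ε) {N : ℝ} (hN : 0 ≤ N) :
    ∫ t, mixWeight γ α ν t * ((Real.pi / mixRate ε t) ^ γ *
        Real.exp (-(N / (4 * mixRate ε t)))) ∂mixMeasure =
      (4 * Real.pi / ε ^ 2) ^ γ * (Real.Gamma α * eulerR α (α + ν) γ (-(N / ε ^ 2))) := by
  have hz : -(N / ε ^ 2) < 1 := by
    have : 0 ≤ N / ε ^ 2 := by positivity
    linarith
  have hI : Integrable (fun t : ℝ × ℝ => t.1 ^ (α - 1) *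
      Real.exp (-((1 - -(N / ε ^ 2) / (1 + t.2)) * t.1)) * eulerWeight (α + ν) γ t.2)
      mixMeasure := by
    refine Integrable.mono' ((integrableOn_rpow_mul_exp hα one_pos).mul_prod
      (integral_eulerWeight (β := α + ν) (by linarith) hγ).1) ?_ ?_
    · have := measurable_eulerWeight (α + ν) γ
      exact Measurable.aestronglyMeasurable (by fun_prop)
    · filter_upwards [ae_mixMeasure] with t ht
      obtain ⟨h1, h2⟩ := ht
      have h3 := eulerWeight_pos (α + ν) γ h2
      rw [Real.norm_of_nonneg (by positivity)]
      have h4 : 0 ≤ N / ε ^ 2 / (1 + t.2) := by positivity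
      gcongr
      rw [neg_div]
      linarith
  rw [integral_congr_ae (ae_mixMeasure.mono fun t ht => mixWeight_mul γ α ν hε N ht),
    integral_const_mul, integral_prod_symm _ hI, eulerR_eq hz, ← integral_const_mul (Real.Gamma α)]
  congr 1
  refine setIntegral_congr_fun (μ := volume) measurableSet_Ioi fun v (hv : (0 : ℝ) < v) => ?_
  dsimp only
  rw [integral_mul_const, integral_rpow_mul_exp hα (one_sub_div_pos hz hv)]
  ring

theorem measurable_mixKernel (γ α ν ε : ℝ) : Measurable fun q : Bdry d × (ℝ × ℝ) =>
    mixWeight γ α ν q.2 * Real.exp (-(mixRate ε q.2 * ‖q.1‖ ^ 2)) := by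
  unfold mixWeight mixRate
  fun_prop

theorem integrable_mixKernel {α ν ε : ℝ} (hα : 0 < α) (hν : 0 < ν) (hγ : α + ν < (d : ℝ) / 2)
    (hε : 0 < ε) :
    Integrable (fun q : Bdry d × (ℝ × ℝ) =>
      mixWeight ((d : ℝ) / 2) α ν q.2 * Real.exp (-(mixRate ε q.2 * ‖q.1‖ ^ 2)))
      (volume.prod mixMeasure) := by
  rw [integrable_prod_iff' (measurable_mixKernel _ α ν ε).aestronglyMeasurable]
  refine ⟨ae_mixMeasure.mono fun t ht =>
    (integrable_gaussian (d := d) (mixRate_pos hε ht)).const_mul (mixWeight ((d : ℝ) / 2) α ν t), ?_⟩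
  refine (integrable_mixWeight_mul hα hν hγ hε).congr ?_
  filter_upwards [ae_mixMeasure] with t ht
  have h := mixWeight_pos ((d : ℝ) / 2) α ν ht
  simp only [norm_mul, Real.norm_of_nonneg h.le, Real.norm_of_nonneg (Real.exp_pos _).le]
  rw [integral_const_mul, integral_gaussian (mixRate_pos hε ht)]

/-- The v-integral is a Gamma integral and supplies a power of N; the s-integral is the
representation of K_ν. -/
theorem integral_mixKernel {γ α ν ε N : ℝ} (hν : 0 < ν) (hγ : α + ν < γ) (hε : 0 < ε)
    (hN : 0 < N) (hI : Integrable (fun t => mixWeight γ α ν t *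
      Real.exp (-(mixRate ε t * N ^ 2))) mixMeasure) :
    ∫ t, mixWeight γ α ν t * Real.exp (-(mixRate ε t * N ^ 2)) ∂mixMeasure =
      2 * Real.Gamma (γ - α - ν) * (ε / 2) ^ (2 * α + ν - 2 * γ) *
        (N ^ (2 * α + ν - 2 * γ) * besselK ν (ε * N)) := by
  have e1 : (ε * N / 2) ^ (2 * α + ν - 2 * γ) =
      (ε / 2) ^ (2 * α + ν - 2 * γ) * N ^ (2 * α + ν - 2 * γ) := by
    rw [← Real.mul_rpow (by positivity) hN.le]
    ring_nf
  have e2 : (ε * N / 2) ^ (2 * α + ν - 2 * γ) =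
      ((ε * N) ^ 2 / 4) ^ (-(γ - α - ν)) * (ε * N / 2) ^ (-ν) := by
    have : (ε * N) ^ 2 / 4 = (ε * N / 2) ^ (2 : ℝ) := by
      rw [Real.rpow_two]
      ring
    rw [this, ← Real.rpow_mul (by positivity), ← Real.rpow_add (by positivity)]
    ring_nf
  rw [integral_prod _ hI]
  calc _ = ∫ s in Ioi (0 : ℝ), Real.Gamma (γ - α - ν) * ((ε * N) ^ 2 / 4) ^ (-(γ - α - ν)) *
        (s ^ (-ν - 1) * Real.exp (-(s + (ε * N) ^ 2 / 4 / s))) := by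
        refine setIntegral_congr_fun (μ := volume) measurableSet_Ioi fun s (hs : (0 : ℝ) < s) => ?_
        have hR : 0 < (ε * N) ^ 2 / 4 / s := by positivity
        have e3 : ∀ v : ℝ, mixWeight γ α ν (s, v) * Real.exp (-(mixRate ε (s, v) * N ^ 2)) =
            s ^ (α - γ - 1) * Real.exp (-(s + (ε * N) ^ 2 / 4 / s)) *
              (v ^ (γ - α - ν - 1) * Real.exp (-((ε * N) ^ 2 / 4 / s * v))) := by
          intro v
          have : Real.exp (-s) * Real.exp (-(mixRate ε (s, v) * N ^ 2)) =
              Real.exp (-(s + (ε * N) ^ 2 / 4 / s)) * Real.exp (-((ε * N) ^ 2 / 4 / s * v)) := by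
            rw [← Real.exp_add, ← Real.exp_add, mixRate]
            congr 1
            field_simp
            ring
          rw [mixWeight]
          linear_combination s ^ (α - γ - 1) * v ^ (γ - α - ν - 1) * this
        have e4 : s ^ (α - γ - 1) * s ^ (γ - α - ν) = s ^ (-ν - 1) := by
          rw [← Real.rpow_add hs]
          ring_nf
        simp only [e3]
        rw [integral_const_mul, integral_rpow_mul_exp (by linarith) hR,
          Real.div_rpow (by positivity) hs.le, ← e4, Real.rpow_neg hs.le, div_inv_eq_mul]
        ring
    _ = _ := by
        rw [integral_const_mul, integral_rpow_mul_exp_add_inv hν (by positivity)]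
        linear_combination (2 * Real.Gamma (γ - α - ν) * besselK ν (ε * N)) * (e1 - e2)

/-- One mixture of Gaussians is evaluated on both sides of the Fourier transform: in p it is
‖p‖^(2α+ν-d) K_ν(ε‖p‖), in x it is Euler's integral. -/
theorem integral_besselK_mul_exp [NeZero d] {α ν ε : ℝ} (hα : 0 < α) (hν : 0 < ν)
    (hγ : α + ν < (d : ℝ) / 2) (hε : 0 < ε) (x : Bdry d) :
    Integrable (fun p : Bdry d => ((‖p‖ ^ (2 * α + ν - d) * besselK ν (ε * ‖p‖) : ℝ) : ℂ) *
      Complex.exp (Complex.I * ((inner ℝ p x : ℝ) : ℂ))) ∧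
    ((2 * Real.Gamma ((d : ℝ) / 2 - α - ν) * (ε / 2) ^ (2 * α + ν - d) : ℝ) : ℂ) *
      ∫ p : Bdry d, ((‖p‖ ^ (2 * α + ν - d) * besselK ν (ε * ‖p‖) : ℝ) : ℂ) *
        Complex.exp (Complex.I * ((inner ℝ p x : ℝ) : ℂ)) =
      (((4 * Real.pi / ε ^ 2) ^ ((d : ℝ) / 2) * (Real.Gamma α *
        eulerR α (α + ν) ((d : ℝ) / 2) (-(‖x‖ ^ 2 / ε ^ 2))) : ℝ) : ℂ) := by
  have hP := integrable_mixKernel hα hν hγ hε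
  have hC : 0 < 2 * Real.Gamma ((d : ℝ) / 2 - α - ν) * (ε / 2) ^ (2 * α + ν - d) := by
    have := Real.Gamma_pos_of_pos (s := (d : ℝ) / 2 - α - ν) (by linarith)
    positivity
  set C := 2 * Real.Gamma ((d : ℝ) / 2 - α - ν) * (ε / 2) ^ (2 * α + ν - d) with hCd
  have hrep : ∀ᵐ p : Bdry d, Integrable (fun t => mixWeight ((d : ℝ) / 2) α ν t *
        Real.exp (-(mixRate ε t * ‖p‖ ^ 2))) mixMeasure ∧
      ∫ t, mixWeight ((d : ℝ) / 2) α ν t * Real.exp (-(mixRate ε t * ‖p‖ ^ 2)) ∂mixMeasure =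
        C * (‖p‖ ^ (2 * α + ν - d) * besselK ν (ε * ‖p‖)) := by
    filter_upwards [hP.prod_right_ae, ae_ne_point (0 : Bdry d)] with p hp hp0
    refine ⟨hp, ?_⟩
    rw [integral_mixKernel hν hγ hε (norm_pos_iff.2 hp0) hp,
      show 2 * α + ν - 2 * ((d : ℝ) / 2) = 2 * α + ν - d by ring]
  have hκ : Integrable fun p : Bdry d => C * (‖p‖ ^ (2 * α + ν - d) * besselK ν (ε * ‖p‖)) :=
    hP.integral_prod_left.congr (hrep.mono fun p hp => hp.2)
  have hexp : Continuous fun p : Bdry d =>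
      Complex.exp (Complex.I * ((inner ℝ p x : ℝ) : ℂ)) := by fun_prop
  have hκ' : Integrable fun p : Bdry d =>
      ((C * (‖p‖ ^ (2 * α + ν - d) * besselK ν (ε * ‖p‖)) : ℝ) : ℂ) *
        Complex.exp (Complex.I * ((inner ℝ p x : ℝ) : ℂ)) :=
    integrable_mul_exp hκ.ofReal x
  have hm := (integral_mixture (k := fun (p : Bdry d) t => mixWeight ((d : ℝ) / 2) α ν t *
      Real.exp (-(mixRate ε t * ‖p‖ ^ 2))) (measurable_mixKernel _ α ν ε)
    (Eventually.of_forall fun p => ae_mixMeasure.mono fun t ht =>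
      (mul_pos (mixWeight_pos _ α ν ht) (Real.exp_pos _)).le) hrep
    hexp.aestronglyMeasurable hκ').2
  have hinner : ∀ᵐ t ∂mixMeasure, (∫ p : Bdry d, ((mixWeight ((d : ℝ) / 2) α ν t *
      Real.exp (-(mixRate ε t * ‖p‖ ^ 2)) : ℝ) : ℂ) *
        Complex.exp (Complex.I * ((inner ℝ p x : ℝ) : ℂ))) =
      ((mixWeight ((d : ℝ) / 2) α ν t * ((Real.pi / mixRate ε t) ^ ((d : ℝ) / 2) *
        Real.exp (-(‖x‖ ^ 2 / (4 * mixRate ε t)))) : ℝ) : ℂ) := by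
    filter_upwards [ae_mixMeasure] with t ht
    rw [Complex.ofReal_mul, ← integral_gaussian_mul_exp_inner (mixRate_pos hε ht),
      ← integral_const_mul]
    congr 1
    funext p
    push_cast
    ring
  rw [integral_congr_ae hinner, integral_complex_ofReal,
    integral_mixWeight_mul hα hν hγ hε (sq_nonneg _)] at hm
  have hsplit : ∀ p : Bdry d, ((C * (‖p‖ ^ (2 * α + ν - d) * besselK ν (ε * ‖p‖)) : ℝ) : ℂ) *
        Complex.exp (Complex.I * ((inner ℝ p x : ℝ) : ℂ)) =
      (C : ℂ) * (((‖p‖ ^ (2 * α + ν - d) * besselK ν (ε * ‖p‖) : ℝ) : ℂ) *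
        Complex.exp (Complex.I * ((inner ℝ p x : ℝ) : ℂ))) := by
    intro p
    push_cast
    ring
  simp only [hsplit] at hm hκ'
  rw [integral_const_mul] at hm
  exact ⟨(integrable_const_mul_iff (Ne.isUnit (by exact_mod_cast hC.ne')) _).1 hκ', hm⟩

/-! ### The bulk field -/

/-- Collects the powers in the normalization of the bulk field, for t = 2, p = π, q = r/l. Writing
the positive bases as exponentials leaves an identity between exponents. -/
theorem bulk_powers (d : ℕ) (α ν q : ℝ) {l t p : ℝ} (hl : 0 < l) (ht : 0 < t) (hp : 0 < p) :
    l ^ ν / t ^ (ν - 1) * Real.exp (-((d : ℝ) / 2 * q)) * (1 / (t * p) ^ d) *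
        (p ^ ((d : ℝ) / 2) * t ^ ((d : ℝ) - 2 * α)) *
        (t * t * p / (l * Real.exp (-q)) ^ 2) ^ ((d : ℝ) / 2) =
      t * (l * Real.exp (-q) / t) ^ (2 * α + ν - d) *
        (l ^ (-(2 * α)) * Real.exp (-(((d : ℝ) / 2 - (2 * α + ν)) * q))) := by
  obtain ⟨L, rfl⟩ : ∃ L, Real.exp L = l := ⟨_, Real.exp_log hl⟩
  obtain ⟨T, rfl⟩ : ∃ T, Real.exp T = t := ⟨_, Real.exp_log ht⟩
  obtain ⟨P, rfl⟩ : ∃ P, Real.exp P = p := ⟨_, Real.exp_log hp⟩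
  simp only [one_div, ← Real.exp_add, ← Real.exp_sub, ← Real.exp_neg, ← Real.exp_mul,
    ← Real.exp_nat_mul]
  congr 1
  push_cast
  ring

/-- The instanton in the bulk with `α = ν/(ω-2)`. -/
def bulk (ν l α b : ℝ) (r : ℝ) (x : Bdry d) : ℝ :=
  b * l ^ (-(2 * α)) *
    (Real.Gamma ((d : ℝ) / 2 - α) * Real.Gamma (α + ν) / (Real.Gamma ((d : ℝ) / 2) * Real.Gamma ν)) *
    Real.exp (-(((d : ℝ) / 2 - (2 * α + ν)) * (r / l))) *
    hypF α (α + ν) ((d : ℝ) / 2) (-(1 / l ^ 2 * Real.exp (2 * r / l) * ‖x‖ ^ 2))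

theorem isBulkField_bulk [NeZero d] {α ν l b : ℝ} (hα : 0 < α) (hν : 0 < ν)
    (hγ : α + ν < (d : ℝ) / 2) (hl : 0 < l) :
    IsBulkField (d := d) ν l (profile b (2 * α)) (bulk ν l α b) := by
  refine ⟨_, isFourierTransform_profile (by linarith) (by linarith), fun r x => ?_⟩
  set ε := l * Real.exp (-(r / l)) with hε
  have hε0 : 0 < ε := by positivity
  obtain ⟨hI, hval⟩ := integral_besselK_mul_exp hα hν hγ hε0 x
  have hae : ∀ᵐ p : Bdry d, ((b * rieszFourierConst d (2 * α) : ℝ) : ℂ) *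
      (((‖p‖ ^ (2 * α + ν - d) * besselK ν (ε * ‖p‖) : ℝ) : ℂ) *
        Complex.exp (Complex.I * ((inner ℝ p x : ℝ) : ℂ))) =
      ((b * rieszFourierConst d (2 * α) * ‖p‖ ^ (2 * α - d) : ℝ) : ℂ) *
        ((‖p‖ ^ ν * besselK ν (l * ‖p‖ * Real.exp (-(r / l))) : ℝ) : ℂ) *
        Complex.exp (Complex.I * ((inner ℝ p x : ℝ) : ℂ)) := by
    filter_upwards [ae_ne_point (0 : Bdry d)] with p hp
    rw [show 2 * α + ν - d = 2 * α - d + ν by ring, Real.rpow_add (norm_pos_iff.2 hp), hε,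
      mul_right_comm l]
    push_cast
    ring
  refine ⟨(hI.const_mul _).congr hae, ?_⟩
  rw [← integral_congr_ae hae, integral_const_mul]
  have hG1 := Real.Gamma_pos_of_pos (s := (d : ℝ) / 2 - α - ν) (by linarith)
  have hG2 := Real.Gamma_pos_of_pos hα
  have hG3 := Real.Gamma_pos_of_pos hν
  have hG4 := Real.Gamma_pos_of_pos (s := (d : ℝ) / 2) (by linarith)
  have hG5 := Real.Gamma_pos_of_pos (s := α + ν) (by linarith)
  have hC : 0 < 2 * Real.Gamma ((d : ℝ) / 2 - α - ν) * (ε / 2) ^ (2 * α + ν - d) := by positivity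
  rw [mul_comm] at hval
  rw [eq_div_of_mul_eq (by exact_mod_cast hC.ne') hval]
  norm_cast
  have hp := bulk_powers d α ν (r / l) hl two_pos Real.pi_pos
  rw [← hε] at hp
  have hz : ‖x‖ ^ 2 / ε ^ 2 = 1 / l ^ 2 * Real.exp (2 * r / l) * ‖x‖ ^ 2 := by
    rw [hε, mul_pow, ← Real.exp_nat_mul, show ((2 : ℕ) : ℝ) * -(r / l) = -(2 * r / l) by
      push_cast
      ring, Real.exp_neg]
    field_simp
  rw [bulk, hypF, hz, rieszFourierConst, show d * r / (2 * l) = d / 2 * (r / l) by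
    field_simp, show (4 : ℝ) = 2 * 2 by norm_num, sub_sub ((d : ℝ) / 2),
    show ((d : ℝ) - 2 * α) / 2 = d / 2 - α by ring, mul_div_cancel_left₀ α two_ne_zero]
  rw [sub_sub] at hG1
  generalize eulerR α (α + ν) ((d : ℝ) / 2) _ = R
  generalize Real.Gamma ((d : ℝ) / 2 - (α + ν)) = g1 at *
  generalize Real.Gamma ((d : ℝ) / 2 - α) = g0 at *
  generalize Real.Gamma α = g2 at *
  generalize Real.Gamma ν = g3 at *
  generalize Real.Gamma ((d : ℝ) / 2) = g4 at *
  generalize Real.Gamma (α + ν) = g5 at *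
  have hY : 0 < (ε / 2) ^ (2 * α + ν - d) := by positivity
  generalize (ε / 2) ^ (2 * α + ν - d) = Y at *
  generalize (2 * 2 * Real.pi / ε ^ 2) ^ ((d : ℝ) / 2) = Z at *
  generalize Real.pi ^ ((d : ℝ) / 2) = Q at *
  generalize (2 : ℝ) ^ ((d : ℝ) - 2 * α) = U at *
  generalize l ^ (-(2 * α)) = V at *
  generalize Real.exp (-(((d : ℝ) / 2 - (2 * α + ν)) * (r / l))) = E at *
  generalize Real.exp (-((d : ℝ) / 2 * (r / l))) = E' at *
  generalize 1 / (2 * Real.pi) ^ d = D at *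
  have hB : 0 < (2 : ℝ) ^ (ν - 1) := by positivity
  generalize (2 : ℝ) ^ (ν - 1) = B at *
  generalize l ^ ν = A at *
  field_simp at hp ⊢
  linear_combination (-(b * g0 * R)) * hp

theorem hasDerivAt_hypF {α β γ z : ℝ} (hα : 0 ≤ α) (hβ : 0 < β) (hγ : β < γ) (hz : z < 1) :
    HasDerivAt (hypF α β γ) (Real.Gamma γ / (Real.Gamma (γ - β) * Real.Gamma β) *
      (α * eulerR (α + 1) (β + 1) (γ + 1) z)) z :=
  (hasDerivAt_eulerR hα hβ hγ hz).const_mul _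

theorem solvesKleinGordon_bulk {α ν l b : ℝ} (hα : 0 < α) (hν : 0 < ν)
    (hγ : α + ν < (d : ℝ) / 2) (hl : 0 < l) :
    SolvesKleinGordon (d := d) l (massSq d ν l) (bulk ν l α b) := by
  have hβ : 0 < α + ν := by linarith
  refine solvesKleinGordon_of_ode (α := α) (β := α + ν) hl.ne'
    (isHypergeometric_hypF hα.le hβ hγ).1 (fun z hz => hasDerivAt_hypF hα.le hβ hγ hz)
    (fun z hz => ((hasDerivAt_eulerR (by linarith) (by linarith) (by linarith) hz).const_mul
      α).const_mul _) (fun z hz => ?_) (by ring) rfl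
  rw [hypF]
  linear_combination (Real.Gamma ((d : ℝ) / 2) / (Real.Gamma ((d : ℝ) / 2 - (α + ν)) *
    Real.Gamma (α + ν)) * α) * eulerR_ode hα.le hβ hγ hz

/-! ### Behaviour at the boundary -/

/-- The derivative of e^(Δ_- r/l)φ - u is e^(Δ_- r/l)(∂_r φ + Δ_- φ/l). L'Hôpital against e^(-2νr/l)
therefore converts the momentum into the normalizable mode, with no subleading expansion of φ. -/
theorem hasModes_of_hasRenMomentum {ν l u P : ℝ} {φ : ℝ → Bdry d → ℝ} {x : Bdry d} (hν : 0 < ν)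
    (hl : 0 < l) (hφ : Differentiable ℝ fun r => φ r x)
    (hu : Tendsto (fun r : ℝ => Real.exp (deltaMinus d ν * r / l) * φ r x) atTop (𝓝 u))
    (hP : HasRenMomentum ν l φ x P) : HasModes ν l φ x u (-(l / (2 * ν) * P)) := by
  refine ⟨hu, ?_⟩
  have hE : ∀ a r : ℝ, HasDerivAt (fun s => Real.exp (a * s / l))
      (Real.exp (a * r / l) * (a * 1 / l)) r := fun a r =>
    (((hasDerivAt_id r).const_mul a).div_const l).exp
  have hadd : ∀ r, Real.exp (deltaPlus d ν * r / l) =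
      Real.exp (deltaMinus d ν * r / l) / Real.exp (-(2 * ν) * r / l) := by
    intro r
    rw [← Real.exp_sub, deltaPlus, deltaMinus]
    ring_nf
  have h := HasDerivAt.lhopital_zero_atTop (l := 𝓝 (-(l / (2 * ν) * P)))
    (f := fun r => Real.exp (deltaMinus d ν * r / l) * φ r x - u)
    (g := fun r => Real.exp (-(2 * ν) * r / l))
    (Eventually.of_forall fun r => ((hE _ r).mul (hφ r).hasDerivAt).sub_const u)
    (Eventually.of_forall fun r => hE _ r)
    (Eventually.of_forall fun r => by
      have := Real.exp_pos (-(2 * ν) * r / l)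
      have h2 : 0 < 2 * ν * 1 / l := by positivity
      rw [neg_mul, neg_div]
      exact mul_ne_zero (Real.exp_pos _).ne' (by rw [neg_mul, neg_div]; exact neg_ne_zero.2 h2.ne'))
    (by simpa using hu.sub_const u) ?_ ?_
  · refine h.congr fun r => ?_
    rw [hadd, Real.exp_neg]
    field_simp
  · have h1 : Tendsto (fun r : ℝ => 2 * ν / l * r) atTop atTop :=
      tendsto_id.const_mul_atTop (by positivity)
    refine (Real.tendsto_exp_neg_atTop_nhds_zero.comp h1).congr fun r => ?_
    simp only [Function.comp_apply]
    congr 1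
    ring
  · have := (Tendsto.const_mul (l / (2 * ν)) hP).neg
    refine this.congr fun r => ?_
    rw [hadd]
    field_simp
    ring

theorem hasDerivAt_bulk_radial {α ν l b : ℝ} (hα : 0 < α) (hν : 0 < ν)
    (hγ : α + ν < (d : ℝ) / 2) (r : ℝ) (x : Bdry d) :
    HasDerivAt (fun s => bulk ν l α b s x) (-(deltaMinus d ν / l * bulk ν l α b r x) +
      b * l ^ (-(2 * α)) * (Real.Gamma ((d : ℝ) / 2 - α) /
        (Real.Gamma ((d : ℝ) / 2 - (α + ν)) * Real.Gamma ν)) * (2 * α / l) *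
        (Real.exp (-(((d : ℝ) / 2 - (2 * α + ν)) * (r / l))) *
        eulerR (α + 1) (α + ν) ((d : ℝ) / 2) (-(1 / l ^ 2 * Real.exp (2 * r / l) * ‖x‖ ^ 2)))) r := by
  have hβ : 0 < α + ν := by linarith
  have hz : -(1 / l ^ 2 * Real.exp (2 * r / l) * ‖x‖ ^ 2) < 1 := by
    have : 0 ≤ 1 / l ^ 2 * Real.exp (2 * r / l) * ‖x‖ ^ 2 := by positivity
    linarith
  have hG1 := Real.Gamma_pos_of_pos (s := (d : ℝ) / 2) (by linarith)
  have hG2 := Real.Gamma_pos_of_pos hβ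
  refine (hasDerivAt_bulk _ ((d : ℝ) / 2 - (2 * α + ν)) l (‖x‖ ^ 2)
    (hasDerivAt_hypF hα.le hβ hγ hz)).congr_deriv ?_
  rw [← eulerR_contiguous hα.le hβ hγ hz, bulk, hypF, deltaMinus]
  field_simp
  ring

theorem exp_eq_scaled_rpow {l N a r : ℝ} (hl : 0 < l) (hN : 0 < N) :
    Real.exp (2 * a * (r / l)) =
      l ^ (2 * a) * N ^ (-(2 * a)) * (1 / l ^ 2 * Real.exp (2 * r / l) * N ^ 2) ^ a := by
  have h : 1 / l ^ 2 * Real.exp (2 * r / l) * N ^ 2 = (Real.exp (r / l) * (l⁻¹ * N)) ^ 2 := by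
    rw [mul_pow, ← Real.exp_nat_mul, ← mul_div_assoc]
    push_cast
    field_simp
  rw [h, ← Real.rpow_two, ← Real.rpow_mul (by positivity), Real.mul_rpow (by positivity)
    (by positivity), Real.mul_rpow (by positivity) hN.le, ← Real.exp_mul, Real.inv_rpow hl.le,
    Real.rpow_neg hN.le]
  have h1 : 0 < l ^ (2 * a) := by positivity
  have h2 : 0 < N ^ (2 * a) := by positivity
  rw [mul_comm (r / l)]
  field_simp

theorem tendsto_bulk_scale {l N : ℝ} (hl : 0 < l) (hN : 0 < N) :
    Tendsto (fun r : ℝ => 1 / l ^ 2 * Real.exp (2 * r / l) * N ^ 2) atTop atTop := by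
  refine Tendsto.atTop_mul_const (by positivity) (Tendsto.const_mul_atTop (by positivity)
    (Real.tendsto_exp_atTop.comp ?_))
  refine ((tendsto_id (α := ℝ)).const_mul_atTop (r := 2 / l) (by positivity)).congr fun r => ?_
  rw [id]
  ring

theorem tendsto_bulk {α ν l b : ℝ} (hα : 0 < α) (hν : 0 < ν) (hγ : α + ν < (d : ℝ) / 2)
    (hl : 0 < l) {x : Bdry d} (hx : x ≠ 0) :
    Tendsto (fun r : ℝ => Real.exp (deltaMinus d ν * r / l) * bulk ν l α b r x) atTop
      (𝓝 (profile b (2 * α) x)) := by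
  have hN := norm_pos_iff.2 hx
  have hG1 := Real.Gamma_pos_of_pos (s := (d : ℝ) / 2) (by linarith)
  have hG2 := Real.Gamma_pos_of_pos (s := α + ν) (by linarith)
  have hG3 := Real.Gamma_pos_of_pos hν
  have hG4 := Real.Gamma_pos_of_pos (s := (d : ℝ) / 2 - (α + ν)) (by linarith)
  have hG5 := Real.Gamma_pos_of_pos (s := (d : ℝ) / 2 - α) (by linarith)
  have h := ((tendsto_rpow_mul_eulerR_of_lt hα.le (lt_add_of_pos_right α hν) hγ).comp
    (tendsto_bulk_scale hl hN)).const_mul (b * l ^ (-(2 * α)) * (Real.Gamma ((d : ℝ) / 2 - α) /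
      (Real.Gamma ((d : ℝ) / 2 - (α + ν)) * Real.Gamma ν)) * (l ^ (2 * α) * ‖x‖ ^ (-(2 * α))))
  have hll : l ^ (-(2 * α)) * l ^ (2 * α) = 1 := by
    rw [← Real.rpow_add hl, neg_add_cancel, Real.rpow_zero]
  convert! h using 1
  · funext r
    have he : Real.exp (deltaMinus d ν * r / l) * Real.exp (-(((d : ℝ) / 2 - (2 * α + ν)) * (r / l))) =
        Real.exp (2 * α * (r / l)) := by
      rw [← Real.exp_add, deltaMinus]
      ring_nf
    rw [exp_eq_scaled_rpow hl hN] at he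
    simp only [Function.comp_apply]
    generalize (1 / l ^ 2 * Real.exp (2 * r / l) * ‖x‖ ^ 2) ^ α = W at *
    rw [bulk, hypF]
    generalize Real.exp (deltaMinus d ν * r / l) = E1 at *
    generalize Real.exp (-(((d : ℝ) / 2 - (2 * α + ν)) * (r / l))) = E2 at *
    generalize eulerR α (α + ν) ((d : ℝ) / 2) _ = R at *
    generalize l ^ (-(2 * α)) = l1 at *
    generalize Real.Gamma ((d : ℝ) / 2 - (α + ν)) = g1 at *
    generalize Real.Gamma ((d : ℝ) / 2 - α) = g0 at *
    generalize l ^ (2 * α) = l2 at *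
    generalize ‖x‖ ^ (-(2 * α)) = N at *
    field_simp
    linear_combination (b * l1 * R) * he
  · rw [profile_eq, add_sub_cancel_left]
    congr 1
    generalize Real.Gamma ((d : ℝ) / 2 - (α + ν)) = g1 at *
    generalize Real.Gamma ((d : ℝ) / 2 - α) = g0 at *
    generalize l ^ (-(2 * α)) = l1 at *
    generalize l ^ (2 * α) = l2 at *
    generalize ‖x‖ ^ (-(2 * α)) = N at *
    field_simp
    linear_combination (-(b * N)) * hll

/-- Here ν < 1 enters: α + 1 > α + ν, so the raised Euler integral decays like X^(-(α+ν)), the rate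
that matches e^(-Δ_+ r/l). -/
theorem hasRenMomentum_bulk {α ν l b : ℝ} (hα : 0 < α) (hν : 0 < ν) (hν1 : ν < 1)
    (hγ : α + ν < (d : ℝ) / 2) (hl : 0 < l) {x : Bdry d} (hx : x ≠ 0) :
    HasRenMomentum ν l (bulk ν l α b) x (b * ‖x‖ ^ (-(2 * (α + ν))) *
      (2 * l ^ (2 * ν - 1) * Real.Gamma (1 - ν) * Real.Gamma ((d : ℝ) / 2 - α) *
        Real.Gamma (α + ν) / (Real.Gamma ν * Real.Gamma α *
          Real.Gamma ((d : ℝ) / 2 - (α + ν))))) := by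
  have hN := norm_pos_iff.2 hx
  have hG2 := Real.Gamma_pos_of_pos hα
  have hG3 := Real.Gamma_pos_of_pos hν
  have hG4 := Real.Gamma_pos_of_pos (s := (d : ℝ) / 2 - (α + ν)) (by linarith)
  have h := ((tendsto_rpow_mul_eulerR_of_gt (α := α + 1) (β := α + ν) (by linarith) (by linarith)
    hγ).comp (tendsto_bulk_scale hl hN)).const_mul (b * l ^ (-(2 * α)) *
      (Real.Gamma ((d : ℝ) / 2 - α) / (Real.Gamma ((d : ℝ) / 2 - (α + ν)) * Real.Gamma ν)) *
      (2 * α / l) * (l ^ (2 * (α + ν)) * ‖x‖ ^ (-(2 * (α + ν)))))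
  have hll : l ^ (-(2 * α)) * l ^ (2 * (α + ν)) = l ^ (2 * ν - 1) * l := by
    rw [← Real.rpow_add hl, ← Real.rpow_add_one hl.ne']
    ring_nf
  rw [HasRenMomentum]
  convert! h using 1
  · funext r
    have he : Real.exp (deltaPlus d ν * r / l) * Real.exp (-(((d : ℝ) / 2 - (2 * α + ν)) * (r / l))) =
        Real.exp (2 * (α + ν) * (r / l)) := by
      rw [← Real.exp_add, deltaPlus]
      ring_nf
    rw [exp_eq_scaled_rpow hl hN] at he
    rw [(hasDerivAt_bulk_radial hα hν hγ r x).deriv]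
    simp only [Function.comp_apply]
    generalize (1 / l ^ 2 * Real.exp (2 * r / l) * ‖x‖ ^ 2) ^ (α + ν) = W at *
    generalize Real.exp (deltaPlus d ν * r / l) = E1 at *
    generalize Real.exp (-(((d : ℝ) / 2 - (2 * α + ν)) * (r / l))) = E2 at *
    generalize eulerR (α + 1) (α + ν) ((d : ℝ) / 2) _ = R at *
    linear_combination (b * l ^ (-(2 * α)) * (Real.Gamma ((d : ℝ) / 2 - α) /
        (Real.Gamma ((d : ℝ) / 2 - (α + ν)) * Real.Gamma ν)) * (2 * α / l) * R) * he
  · rw [show α + 1 - (α + ν) = 1 - ν by ring, Real.Gamma_add_one hα.ne']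
    congr 1
    generalize l ^ (-(2 * α)) = l1 at *
    generalize l ^ (2 * (α + ν)) = l2 at *
    generalize l ^ (2 * ν - 1) = l3 at *
    generalize Real.Gamma ((d : ℝ) / 2 - (α + ν)) = g1 at *
    generalize Real.Gamma ((d : ℝ) / 2 - α) = g0 at *
    generalize ‖x‖ ^ (-(2 * (α + ν))) = N at *
    field_simp
    linear_combination (-(b * N * Real.Gamma (1 - ν) * g0)) * hll

/-- The Gamma quotient is ω|ξ| times the prescribed b^(ω-2), so the momentum of the bulk field is
-f'(φ_-). -/
theorem renMomentum_eq [NeZero d] {ν l ξ ω b c : ℝ} (hν : 0 < ν) (hb : 0 < b)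
    (h : IsInstanton d ν l ξ ω b c) {x : Bdry d} (hx : x ≠ 0) :
    b * ‖x‖ ^ (-(2 * (ν / (ω - 2) + ν))) *
      (2 * l ^ (2 * ν - 1) * Real.Gamma (1 - ν) * Real.Gamma ((d : ℝ) / 2 - ν / (ω - 2)) *
        Real.Gamma (ν / (ω - 2) + ν) / (Real.Gamma ν * Real.Gamma (ν / (ω - 2)) *
          Real.Gamma ((d : ℝ) / 2 - (ν / (ω - 2) + ν)))) =
      -(ω * ξ * profile b c x ^ (ω - 1)) := by
  have hN := norm_pos_iff.2 hx
  obtain ⟨hα, -, -, h4⟩ := h.1.params hν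
  have hA := h.2.2
  rw [instantonAmplitude_eq hν h.1] at hA
  have hω : 0 < ω := by linarith [h.1.1]
  have hξ : -ξ ≠ 0 := (neg_pos.2 h.1.2.1).ne'
  have e1 : profile b c x ^ (ω - 1) = b ^ (ω - 2) * b * ‖x‖ ^ (-(2 * (ν / (ω - 2) + ν))) := by
    rw [profile_eq, Real.mul_rpow hb.le (by positivity), ← Real.rpow_mul hN.le,
      ← Real.rpow_add_one hb.ne', show ω - 2 + 1 = ω - 1 by ring, h.two_mul_alpha,
      show -(2 * (ν / (ω - 2))) * (ω - 1) = -(2 * (ν / (ω - 2) + ν)) by linear_combination -h4]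
  rw [e1, hA]
  generalize ‖x‖ ^ (-(2 * (ν / (ω - 2) + ν))) = N
  generalize Real.Gamma ((d : ℝ) / 2 - (ν / (ω - 2) + ν)) = g1
  generalize Real.Gamma ((d : ℝ) / 2 - ν / (ω - 2)) = g2
  generalize Real.Gamma (ν / (ω - 2) + ν) = g3
  generalize Real.Gamma (ν / (ω - 2)) = g4
  generalize l ^ (2 * ν - 1) = l1
  have e2 : ω * ξ / (ω * -ξ) = -1 := by
    have : ξ ≠ 0 := h.1.2.1.ne
    field_simp
  calc _ = -(ω * ξ / (ω * -ξ)) * (b * N * (2 * l1 * Real.Gamma (1 - ν) * g2 * g3 /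
        (Real.Gamma ν * g4 * g1))) := by
        rw [e2]
        ring
    _ = _ := by
        simp only [div_eq_mul_inv, mul_inv]
        ring

theorem hasModes_and_mixedBC [NeZero d] {ν l ξ ω b c : ℝ} (hν : 0 < ν) (hν1 : ν < 1) (hl : 0 < l)
    (hb : 0 < b) (h : IsInstanton d ν l ξ ω b c) {x : Bdry d} (hx : x ≠ 0) :
    HasModes ν l (bulk ν l (ν / (ω - 2)) b) x (profile b c x)
        (l / (2 * ν) * ω * ξ * profile b c x ^ (ω - 1)) ∧
      SatisfiesMixedBC ν l (powPotential ξ ω) (bulk ν l (ν / (ω - 2)) b) x := by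
  obtain ⟨hα, -, hγ, -⟩ := h.1.params hν
  have hP := hasRenMomentum_bulk (b := b) hα hν hν1 hγ hl hx
  rw [renMomentum_eq hν hb h hx] at hP
  have hu := tendsto_bulk (b := b) hα hν hγ hl hx
  rw [← h.two_mul_alpha] at hu
  have hM := hasModes_of_hasRenMomentum hν hl
    (fun r => (hasDerivAt_bulk_radial hα hν hγ r x).differentiableAt) hu hP
  have e : -(l / (2 * ν) * -(ω * ξ * profile b c x ^ (ω - 1))) =
      l / (2 * ν) * ω * ξ * profile b c x ^ (ω - 1) := by ring
  rw [e] at hM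
  refine ⟨hM, _, _, _, hM, hP, ?_⟩
  have hN := norm_pos_iff.2 hx
  rw [deriv_powPotential ξ ω (by rw [profile_eq]; positivity)]
  ring

theorem instantonBulk_eq_bulk {ν l ω b : ℝ} (h5 : (ω - 1) * ν / (ω - 2) = ν / (ω - 2) + ν) :
    instantonBulk (d := d) ν l ω b
      (hypF (ν / (ω - 2)) ((ω - 1) * ν / (ω - 2)) ((d : ℝ) / 2)) = bulk ν l (ν / (ω - 2)) b := by
  funext r x
  have e1 : 2 * ν / (ω - 2) = 2 * (ν / (ω - 2)) := by ring
  have e2 : ω * ν / (ω - 2) = 2 * (ν / (ω - 2)) + ν := by linear_combination h5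
  rw [instantonBulk, bulk, e1, e2, h5]

end AdSToy

end

/-! ### Assembly of the main theorem -/

theorem mainTheorem6 (d : ℕ) (hd : 1 ≤ d) (ν l ξ ω : ℝ)
    (hν0 : 0 < ν) (hν1 : ν < 1) (hl : 0 < l) :
    -- for which parameters there is a solution of the form `b / |x|^c`
    ((∃ b c : ℝ, 0 < b ∧
        AdSToy.SolvesIntegralGapEquation (d := d) ν l (AdSToy.powPotential ξ ω)
          (AdSToy.profile b c)) ↔
      2 < ω ∧ ξ < 0 ∧ (ω - 1) * ν / (ω - 2) < (d : ℝ) / 2) ∧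
    ((∃ b c : ℝ, 0 < b ∧ 0 < c ∧
        AdSToy.SolvesGapEquation (d := d) ν l (AdSToy.powPotential ξ ω) 0
          (AdSToy.profile b c)) ↔
      2 < ω ∧ ξ < 0 ∧ (ω - 1) * ν / (ω - 2) < (d : ℝ) / 2) ∧
    -- which ones are solutions
    (∀ b c : ℝ, 0 < b →
      (AdSToy.SolvesIntegralGapEquation (d := d) ν l (AdSToy.powPotential ξ ω)
          (AdSToy.profile b c) ↔
        (2 < ω ∧ ξ < 0 ∧ (ω - 1) * ν / (ω - 2) < (d : ℝ) / 2) ∧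
          c = 2 * ν / (ω - 2) ∧ b ^ (ω - 2) = AdSToy.instantonAmplitude d ν l ξ ω)) ∧
    (∀ b c : ℝ, 0 < b → 0 < c →
      (AdSToy.SolvesGapEquation (d := d) ν l (AdSToy.powPotential ξ ω) 0
          (AdSToy.profile b c) ↔
        (2 < ω ∧ ξ < 0 ∧ (ω - 1) * ν / (ω - 2) < (d : ℝ) / 2) ∧
          c = 2 * ν / (ω - 2) ∧ b ^ (ω - 2) = AdSToy.instantonAmplitude d ν l ξ ω)) ∧
    -- the bulk solution that corresponds to such a solution
    (∀ b c : ℝ, 0 < b →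
      AdSToy.SolvesIntegralGapEquation (d := d) ν l (AdSToy.powPotential ξ ω)
          (AdSToy.profile b c) →
      ∃ F : ℝ → ℝ,
        AdSToy.IsHypergeometric (ν / (ω - 2)) ((ω - 1) * ν / (ω - 2)) ((d : ℝ) / 2) F ∧
        AdSToy.IsBulkField (d := d) ν l (AdSToy.profile b c)
          (AdSToy.instantonBulk ν l ω b F) ∧
        AdSToy.SolvesKleinGordon (d := d) l (AdSToy.massSq d ν l)
          (AdSToy.instantonBulk ν l ω b F) ∧
        ∀ x : AdSToy.Bdry d, x ≠ 0 →
          AdSToy.HasModes ν l (AdSToy.instantonBulk ν l ω b F) x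
            (AdSToy.profile b c x)
            (l / (2 * ν) * ω * ξ * AdSToy.profile b c x ^ (ω - 1)) ∧
          AdSToy.SatisfiesMixedBC ν l (AdSToy.powPotential ξ ω)
            (AdSToy.instantonBulk ν l ω b F) x) := by
  have : NeZero d := ⟨by omega⟩
  refine ⟨?_, ?_, fun b c hb => AdSToy.solvesIntegralGapEquation_iff hν0 hν1 hl hb,
    fun b c hb hc => AdSToy.solvesGapEquation_iff hν0 hν1 hl hb hc, fun b c hb hs => ?_⟩
  · refine Iff.trans ?_ (AdSToy.exists_isInstanton_iff (d := d) hν0 hν1 hl)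
    constructor
    · rintro ⟨b, c, hb, hs⟩
      have hI := (AdSToy.solvesIntegralGapEquation_iff hν0 hν1 hl hb).1 hs
      -- For the integral equation c > 0 is a consequence: c = 2α with α > 0.
      exact ⟨b, c, hb, by linarith [hI.two_mul_alpha, (hI.1.params hν0).1], hI⟩
    · rintro ⟨b, c, hb, -, hI⟩
      exact ⟨b, c, hb, (AdSToy.solvesIntegralGapEquation_iff hν0 hν1 hl hb).2 hI⟩
  · refine Iff.trans ?_ (AdSToy.exists_isInstanton_iff (d := d) hν0 hν1 hl)
    exact exists_congr fun b => exists_congr fun c => and_congr_right fun hb =>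
      and_congr_right fun hc => AdSToy.solvesGapEquation_iff hν0 hν1 hl hb hc
  · have hI := (AdSToy.solvesIntegralGapEquation_iff hν0 hν1 hl hb).1 hs
    obtain ⟨hα, h5, hγ, -⟩ := hI.1.params hν0
    refine ⟨AdSToy.hypF (ν / (ω - 2)) ((ω - 1) * ν / (ω - 2)) ((d : ℝ) / 2), ?_, ?_⟩
    · exact AdSToy.isHypergeometric_hypF hα.le (by rw [h5]; linarith) (by rw [h5]; exact hγ)
    · rw [AdSToy.instantonBulk_eq_bulk h5]
      refine ⟨?_, AdSToy.solvesKleinGordon_bulk hα hν0 hγ hl,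
        fun x hx => AdSToy.hasModes_and_mixedBC hν0 hν1 hl hb hI hx⟩
      rw [hI.two_mul_alpha]
      exact AdSToy.isBulkField_bulk hα hν0 hγ hl
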